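/- Throughout, $\log$ is base 2 and natural numbers $w,m,m_0,c$ are positive. A $(w,d)$-automaton with fail state is a function $Q:[w+1]\times\{0,1\}^d\to[w+1]$ with $Q(w+1;y)=w+1$ for all $y$; $Q^m(q;x)$ denotes the state reached from $q$ after $m$ steps that read the successive $d$-bit blocks of $x\in\{0,1\}^{md}$. A function $\mathsf{Sim}$ that maps $(Q,q,x)$, with $Q$ such an automaton, $q\in[w+1]$ and $x\in\{0,1\}^s$, to $[w+1]$ is an $\epsilon$-simulator for $\tilde{\mathbf Q}^m_{w,d}$ with seed length $s$ if for all $Q,q$ the total variation distance between $\mathsf{Sim}(Q,q,U_s)$ and $Q^m(q;U_{md})$ is at most $\epsilon$, where $U_n$ is uniform on $\{0,1\}^n$. An implicit oracle algorithm with access to a set $A\subseteq\{0,1\}^*$ may invoke the oracle. After an invocation the oracle may repeatedly read a position $j$, which hands $j$ and control to the algorithm; the algorithm, possibly after further (nested) invocations, resolves the most recent unresolved read by giving a query value in $\{0,1,\bot\}$; finally the oracle resolves the most recent unresolved invocation by giving a Boolean answer. If for some $x\in\{0,1\}^*$ the query values in an invocation are $x_j$ (with $x_j=\bot$ beyond the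 end of $x$), then the oracle makes finitely many reads, none beyond the first position after the end of $x$, and answers whether $x\in A$. Access to a function $f$ means access to $A=\{(x,b,0):|f(x)|\le b\}\cup\{(x,b,1):f(x)_b=1\}$. An algorithm with implicit oracle access to a simulator may also query the parameters $w,d,m_0,\epsilon,s$ of the simulator. Only the algorithm's own work memory counts as its space. **Theorem 2.** There are a positive integer $c$ and a deterministic implicit oracle algorithm $\mathsf{SZA}$ with the following properties. Let $w\in\mathbb N$ and $0<\epsilon\le w$, and let $d=\lceil c\log(w/\epsilon)\rceil$. Suppose that $\mathsf{Sim}$ is an $\epsilon$-simulator for $\tilde{\mathbf Q}^{m_0}_{w,d}$ with seed length $s$, where $s\le m_0\le w$ and $m_0\ge 2$. Let $m\ge 1$ be an integer (an additional input of $\mathsf{SZA}$) and $u=\lceil \log m/\log m_0\rceil$. Then: 1. there is some $m'\ge m$ such that $\mathsf{SZA}_m^{\mathsf{Sim}}$ is a $(12m\epsilon)$-simulator for $\tilde{\mathbf Q}^{m'}_{w,d}$; 2. at any moment in the execution of $\mathsf{SZA}_m^{\mathsf{Sim}}$ there are at most $u$ unresolved oracle invocations and at most one unresolved read of the seed of $\mathsf{Sim}$;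 3. the seed length of $\mathsf{SZA}_m^{\mathsf{Sim}}$ is $O(s+u\log(w/\epsilon))$ and its space is $O(1+s+u\log(w/\epsilon))$, where the constants in $O(\cdot)$ are absolute. -/

import Mathlib

noncomputable section

namespace SZ

/-! ### Automata with fail state and simulators -/

/-- A `(w, d)`-automaton with fail state: the states are `0, …, w`, the last one, `w`, being the
fail state, which is never left. -/
structure FailAutomaton (w d : ℕ) where
  next : Fin (w + 1) → (Fin d → Bool) → Fin (w + 1)
  next_last : ∀ y, next (Fin.last w) y = Fin.last w

/-- `Q^m(q; x)`: the state reached from `q` after reading the `m` blocks of `x`, first block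
first. The `m * d` input bits are presented as `m` blocks of `d` bits. -/
def FailAutomaton.run {w d m : ℕ} (Q : FailAutomaton w d) (q : Fin (w + 1))
    (x : Fin m → Fin d → Bool) : Fin (w + 1) :=
  (List.ofFn x).foldl Q.next q

open scoped Classical in
/-- The probability of the event `p` at a uniformly random point of a finite type. -/
def unifProb {α : Type*} [Fintype α] (p : α → Prop) : ℝ :=
  ((Finset.univ.filter p).card : ℝ) / (Fintype.card α : ℝ)

/-- `f(U) ∼_ε g(U')`: for uniformly random arguments, the total variation distance (supremum
over events) between the two output distributions is at most `ε`. -/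
def TVClose {α β σ : Type*} [Fintype α] [Fintype β] (f : α → σ) (g : β → σ) (ε : ℝ) : Prop :=
  ∀ E : Set σ, |unifProb (fun x => f x ∈ E) - unifProb (fun y => g y ∈ E)| ≤ ε

/-- The type of candidate simulators of seed length `s` for `(w, d)`-automata with fail state. -/
abbrev SimFun (w d s : ℕ) : Type :=
  FailAutomaton w d → Fin (w + 1) → (Fin s → Bool) → Fin (w + 1)

/-- `Sim` is an `ε`-simulator for `m` steps of `(w, d)`-automata with fail state. -/
def IsSimulator {w d s : ℕ} (m : ℕ) (ε : ℝ) (Sim : SimFun w d s) : Prop :=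
  ∀ (Q : FailAutomaton w d) (q : Fin (w + 1)),
    TVClose (Sim Q q) (fun x : Fin m → Fin d → Bool => Q.run q x) ε

/-! ### Bit strings -/

/-- The lowest `L` binary digits of `n`, least significant first. -/
def natBits (L n : ℕ) : List Bool :=
  (List.range L).map fun i => n.testBit i

/-- The transition table of `Q`: for each state in increasing order and each `z ∈ {0,1}^d` (in the
order of the number with binary digits `z`), the next state, written with `Nat.size w` digits. -/
def encTable {w d : ℕ} (Q : FailAutomaton w d) : List Bool :=
  (List.finRange (w + 1)).flatMap fun q =>
    (List.range (2 ^ d)).flatMap fun v =>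
      natBits (Nat.size w) (Q.next q fun i : Fin d => v.testBit i)

/-- The string presenting `(Q, q, x)`: an automaton, a start state and a seed. -/
def encInput {w d s : ℕ} (Q : FailAutomaton w d) (q : Fin (w + 1)) (x : Fin s → Bool) :
    List Bool :=
  encTable Q ++ natBits (Nat.size w) q ++ List.ofFn x

/-- The string presenting the oracle query `((Q, q, x), b, tag)`. -/
def encQuery {w d s : ℕ} (Q : FailAutomaton w d) (q : Fin (w + 1)) (x : Fin s → Bool)
    (b : ℕ) (tag : Bool) : List Bool :=
  encInput Q q x ++ Nat.bits b ++ [tag]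

/-- Position `j` (counted from `0`) of a query string lies in the seed part. -/
def IsSeedPos (w d s j : ℕ) : Prop :=
  (w + 1) * 2 ^ d * Nat.size w + Nat.size w ≤ j ∧
    j < (w + 1) * 2 ^ d * Nat.size w + Nat.size w + s

/-- The correct answer to the oracle query `((Q, q, x), b, tag)`, where the value of the function
is the string of the `Nat.size w` digits of the state `Sim Q q x`: tag `0` asks whether this string
has length at most `b`, and tag `1` asks whether it has a one at position `b`. -/
def queryAnswer {w d s : ℕ} (Sim : SimFun w d s) (Q : FailAutomaton w d) (q : Fin (w + 1))
    (x : Fin s → Bool) (b : ℕ) (tag : Bool) : Bool :=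
  let out := natBits (Nat.size w) (Sim Q q x)
  if tag then out[b]? == some true else decide (out.length ≤ b)

/-! ### Implicit oracles -/

/-- What an oracle in control can do: read a position of its query or give its answer. -/
inductive OracleMove where
  | read (j : ℕ)
  | answer (b : Bool)

/-- The behaviour of the oracle in one invocation: its next move as a function of the query values
received so far in this invocation (latest first; `none` is the value `⊥`). -/
abbrev Strategy : Type := List (Option Bool) → OracleMove

/-- Having received the values `h`, the strategy `τ`, when all its further reads are answered
according to the string `x`, makes finitely many reads, all of them at positions of `x` or at the
first position beyond its end, and then answers `b`. -/
inductive Strategy.RunsTo (τ : Strategy) (x : List Bool) : List (Option Bool) → Bool → Prop where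
  | answer {h : List (Option Bool)} {b : Bool} : τ h = .answer b → RunsTo τ x h b
  | read {h : List (Option Bool)} {j : ℕ} {b : Bool} : τ h = .read j → j ≤ x.length →
      RunsTo τ x (x[j]? :: h) b → RunsTo τ x h b

/-- `σ` is an implicit oracle for `Sim`; `σ n` is its behaviour in the `n`-th invocation, and
different invocations may behave differently. Nothing is guaranteed on strings that do not present
a query. -/
def IsOracleFor {w d s : ℕ} (Sim : SimFun w d s) (σ : ℕ → Strategy) : Prop :=
  ∀ (n : ℕ) (Q : FailAutomaton w d) (q : Fin (w + 1)) (x : Fin s → Bool) (b : ℕ) (tag : Bool),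
    (σ n).RunsTo (encQuery Q q x b tag) [] (queryAnswer Sim Q q x b tag)

/-! ### Implicit oracle algorithms

A deterministic algorithm is a finite program for a machine with a fixed finite set of registers
which hold natural numbers; the space in use is the total binary length of the registers. All
operations on numbers are computable in linear space, so up to a constant factor this is the work
space of a Turing machine. The input is read-only. -/

/-- Arithmetic expressions in the registers, with truncated subtraction and rounded division. -/
inductive Expr (R : Type) where
  | const (n : ℕ)
  | reg (r : R)
  | add (a b : Expr R)
  | sub (a b : Expr R)
  | mul (a b : Expr R)
  | div (a b : Expr R)
  | mod (a b : Expr R)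

def Expr.eval {R : Type} (v : R → ℕ) : Expr R → ℕ
  | .const n => n
  | .reg r => v r
  | .add a b => a.eval v + b.eval v
  | .sub a b => a.eval v - b.eval v
  | .mul a b => a.eval v * b.eval v
  | .div a b => a.eval v / b.eval v
  | .mod a b => a.eval v % b.eval v

/-- The natural-number parameters that an algorithm can query. -/
inductive Param where
  | w
  | d
  | m₀
  | s
  | m

/-- Instructions, over a set `R` of registers and a set `Λ` of labels. -/
inductive Instr (R Λ : Type) where
  /-- Store the value of `e` in `dst`. -/
  | assign (dst : R) (e : Expr R) (next : Λ)
  /-- Jump according to whether `e` is nonzero. -/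
  | branch (e : Expr R) (ifNonzero ifZero : Λ)
  /-- Store in `dst` the input bit at position `e` (or `2` if the input has no such position). -/
  | input (dst : R) (e : Expr R) (next : Λ)
  /-- Store a parameter in `dst`. -/
  | param (dst : R) (p : Param) (next : Λ)
  /-- Query the real parameter `ε`: jump according to whether `a ≤ b * ε`. -/
  | testEps (a b : Expr R) (ifTrue ifFalse : Λ)
  /-- Invoke the oracle. When control comes back, either the oracle reads a position, which is
  stored in `dst`, and the execution goes on at `onRead`, or the oracle gives its answer, which is
  stored in `dst`, and the execution goes on at `onAnswer`. -/
  | invoke (dst : R) (onRead onAnswer : Λ)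
  /-- Give the oracle a query value (`0` or `1` for a bit, anything else for `⊥`), which resolves
  the most recent unresolved read. Control comes back as for `invoke`. -/
  | respond (e : Expr R) (dst : R) (onRead onAnswer : Λ)
  /-- Halt with the content of `r` as output. -/
  | halt (r : R)

/-- A deterministic implicit oracle algorithm. -/
structure Machine where
  R : Type
  Λ : Type
  [fintypeR : Fintype R]
  [decEqR : DecidableEq R]
  [fintypeΛ : Fintype Λ]
  start : Λ
  code : Λ → Instr R Λ

attribute [instance] Machine.fintypeR Machine.decEqR Machine.fintypeΛ

/-- Everything a computation depends on besides the program. -/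
structure Env where
  w : ℕ
  d : ℕ
  m₀ : ℕ
  s : ℕ
  m : ℕ
  ε : ℝ
  input : List Bool
  oracle : ℕ → Strategy

def Env.param (env : Env) : Param → ℕ
  | .w => env.w
  | .d => env.d
  | .m₀ => env.m₀
  | .s => env.s
  | .m => env.m

/-- An unresolved oracle invocation: the behaviour of the oracle in it, the query values received
so far (latest first), and the position of the unresolved read, if there is one. -/
structure Frame where
  strategy : Strategy
  history : List (Option Bool)
  pending : Option ℕ

/-- Who is in control. -/
inductive Control (R Λ : Type) where
  | alg (l : Λ)
  | oracle (dst : R) (onRead onAnswer : Λ)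
  | halted (out : ℕ)

/-- Configurations: who is in control, the registers, the unresolved invocations (latest first),
and the number of invocations so far. -/
structure Config (R Λ : Type) where
  control : Control R Λ
  regs : R → ℕ
  stack : List Frame
  count : ℕ

/-- The query value denoted by a number. -/
def queryValue : ℕ → Option Bool
  | 0 => some false
  | 1 => some true
  | _ => none

namespace Machine

variable (M : Machine)

def init : Config M.R M.Λ where
  control := .alg M.start
  regs := fun _ => 0
  stack := []
  count := 0

open scoped Classical in
/-- One step; `none` if the computation has halted, or if the algorithm gives a query value while
there is no unresolved read. -/
def step (env : Env) (c : Config M.R M.Λ) : Option (Config M.R M.Λ) :=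
  match c.control with
  | .halted _ => none
  | .alg l =>
    match M.code l with
    | .assign dst e next =>
      some { c with control := .alg next, regs := Function.update c.regs dst (e.eval c.regs) }
    | .branch e l₁ l₀ =>
      some { c with control := .alg (if e.eval c.regs ≠ 0 then l₁ else l₀) }
    | .input dst e next =>
      some { c with
        control := .alg next
        regs := Function.update c.regs dst
          (match env.input[e.eval c.regs]? with
            | some b => b.toNat
            | none => 2) }
    | .param dst p next =>
      some { c with control := .alg next, regs := Function.update c.regs dst (env.param p) }
    | .testEps a b l₁ l₀ =>
      some { c with
        control := .alg (if (a.eval c.regs : ℝ) ≤ (b.eval c.regs : ℝ) * env.ε then l₁ else l₀) }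
    | .invoke dst onRead onAnswer =>
      some { c with
        control := .oracle dst onRead onAnswer
        stack := ⟨env.oracle c.count, [], none⟩ :: c.stack
        count := c.count + 1 }
    | .respond e dst onRead onAnswer =>
      match c.stack with
      | ⟨τ, h, some _⟩ :: rest =>
        some { c with
          control := .oracle dst onRead onAnswer
          stack := ⟨τ, queryValue (e.eval c.regs) :: h, none⟩ :: rest }
      | _ => none
    | .halt r => some { c with control := .halted (c.regs r) }
  | .oracle dst onRead onAnswer =>
    match c.stack with
    | [] => none
    | f :: rest =>
      match f.strategy f.history with
      | .read j =>
        some { c with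
          control := .alg onRead
          regs := Function.update c.regs dst j
          stack := { f with pending := some j } :: rest }
      | .answer b =>
        some { c with
          control := .alg onAnswer
          regs := Function.update c.regs dst b.toNat
          stack := rest }

/-- `c` occurs in the execution of the algorithm. -/
def Reaches (env : Env) (c : Config M.R M.Λ) : Prop :=
  Relation.ReflTransGen (fun c₁ c₂ => M.step env c₁ = some c₂) M.init c

/-- The algorithm halts with output `out`. -/
def Outputs (env : Env) (out : ℕ) : Prop :=
  ∃ c, M.Reaches env c ∧ c.control = .halted out

end Machine

/-- The space in use. -/
def Config.space {R Λ : Type} [Fintype R] (c : Config R Λ) : ℕ :=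
  ∑ r, Nat.size (c.regs r)

/-- The number of unresolved oracle invocations. -/
def Config.numInvocations {R Λ : Type} (c : Config R Λ) : ℕ :=
  c.stack.length

open scoped Classical in
/-- The number of unresolved reads of the seed of a simulator with parameters `w, d, s`. -/
def Config.numSeedReads {R Λ : Type} (w d s : ℕ) (c : Config R Λ) : ℕ :=
  c.stack.countP fun f => decide (∃ j, f.pending = some j ∧ IsSeedPos w d s j)

end SZ

end

namespace SZ

open Finset

/-! ### Averages over initial segments -/

/-- The average of `f` over `0, …, N - 1`. -/
noncomputable def avg (N : ℕ) (f : ℕ → ℝ) : ℝ := (∑ x ∈ range N, f x) / N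

theorem avg_congr {N : ℕ} {f g : ℕ → ℝ} (h : ∀ x < N, f x = g x) : avg N f = avg N g := by
  unfold avg
  rw [Finset.sum_congr rfl fun x hx => h x (mem_range.1 hx)]

theorem avg_mono {N : ℕ} {f g : ℕ → ℝ} (h : ∀ x < N, f x ≤ g x) : avg N f ≤ avg N g := by
  unfold avg
  gcongr with x hx
  exact h x (mem_range.1 hx)

theorem avg_const {N : ℕ} (hN : 0 < N) (c : ℝ) : avg N (fun _ => c) = c := by
  unfold avg
  have : (N : ℝ) ≠ 0 := by positivity
  simp
  field_simp

theorem avg_le {N : ℕ} (hN : 0 < N) {f : ℕ → ℝ} {c : ℝ} (h : ∀ x < N, f x ≤ c) : avg N f ≤ c :=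
  (avg_mono h).trans_eq (avg_const hN c)

theorem avg_nonneg {N : ℕ} {f : ℕ → ℝ} (h : ∀ x < N, 0 ≤ f x) : 0 ≤ avg N f := by
  unfold avg
  exact div_nonneg (sum_nonneg fun x hx => h x (mem_range.1 hx)) (Nat.cast_nonneg _)

theorem avg_add (N : ℕ) (f g : ℕ → ℝ) : avg N (fun x => f x + g x) = avg N f + avg N g := by
  simp [avg, sum_add_distrib, add_div]

theorem avg_sub (N : ℕ) (f g : ℕ → ℝ) : avg N (fun x => f x - g x) = avg N f - avg N g := by
  simp [avg, sum_sub_distrib, sub_div]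

theorem avg_mul_left (N : ℕ) (c : ℝ) (f : ℕ → ℝ) : avg N (fun x => c * f x) = c * avg N f := by
  simp [avg, ← mul_sum, mul_div_assoc]

theorem avg_mul_right (N : ℕ) (c : ℝ) (f : ℕ → ℝ) : avg N (fun x => f x * c) = avg N f * c := by
  simp [mul_comm _ c, avg_mul_left]

theorem avg_sum {ι : Type*} (N : ℕ) (S : Finset ι) (f : ι → ℕ → ℝ) :
    avg N (fun x => ∑ i ∈ S, f i x) = ∑ i ∈ S, avg N (f i) := by
  simp only [avg]
  rw [sum_comm, sum_div]

theorem avg_comm (A B : ℕ) (f : ℕ → ℕ → ℝ) :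
    avg A (fun a => avg B fun b => f a b) = avg B (fun b => avg A fun a => f a b) := by
  simp only [avg, ← sum_div]
  rw [sum_comm, div_right_comm]

theorem abs_avg_le {N : ℕ} (f : ℕ → ℝ) : |avg N f| ≤ avg N fun x => |f x| := by
  unfold avg
  rw [abs_div, Nat.abs_cast]
  gcongr
  exact abs_sum_le_sum_abs _ _

theorem abs_avg_sub_avg_le {N : ℕ} (f g : ℕ → ℝ) :
    |avg N f - avg N g| ≤ avg N fun x => |f x - g x| := by
  rw [← avg_sub]
  exact abs_avg_le _

theorem sum_range_mul_eq (A B : ℕ) (f : ℕ → ℝ) :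
    ∑ x ∈ range (A * B), f x = ∑ b ∈ range B, ∑ a ∈ range A, f (a + A * b) := by
  induction B with
  | zero => simp
  | succ B ih =>
    rw [Nat.mul_succ, sum_range_add, sum_range_succ, ih]
    simp [add_comm]

theorem avg_mul (A B : ℕ) (f : ℕ → ℝ) :
    avg (A * B) f = avg A fun a => avg B fun b => f (a + A * b) := by
  rw [avg_comm]
  simp only [avg, sum_range_mul_eq, ← sum_div, div_div, Nat.cast_mul]

theorem avg_shift (M c : ℕ) (f : ℕ → ℝ) :
    avg M (fun x => f ((c + x) % M)) = avg M f := by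
  have h0 : avg M (fun x => f (x % M)) = avg M f :=
    avg_congr fun x hx => by rw [Nat.mod_eq_of_lt hx]
  rw [← h0]
  induction c with
  | zero => simp
  | succ c ih =>
    rw [← ih]
    unfold avg
    congr 1
    have h1 := sum_range_succ (fun x => f ((c + x) % M)) M
    have h2 := sum_range_succ' (fun x => f ((c + x) % M)) M
    have h3 : f ((c + M) % M) = f ((c + 0) % M) := by simp
    have h4 : ∑ x ∈ range M, f ((c + 1 + x) % M) = ∑ x ∈ range M, f ((c + (x + 1)) % M) :=
      sum_congr rfl fun x _ => by rw [add_assoc, add_comm 1 x]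
    linarith

theorem avg_mul_coprime {M o : ℕ} (h : o.Coprime M) (f : ℕ → ℝ) :
    avg M (fun x => f (x * o % M)) = avg M f := by
  unfold avg
  congr 1
  rcases Nat.eq_zero_or_pos M with rfl | hM
  · simp
  have hinj : Set.InjOn (fun x => x * o % M) (range M : Set ℕ) := by
    intro x hx y hy hxy
    have h1 : x ≡ y [MOD M] := Nat.ModEq.cancel_right_of_coprime (h.symm) hxy
    have hx' := mem_range.1 (mem_coe.1 hx)
    have hy' := mem_range.1 (mem_coe.1 hy)
    rwa [Nat.ModEq, Nat.mod_eq_of_lt hx', Nat.mod_eq_of_lt hy'] at h1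
  have himg : (range M).image (fun x => x * o % M) = range M := by
    apply eq_of_subset_of_card_le
    · intro x hx
      obtain ⟨y, -, rfl⟩ := mem_image.1 hx
      exact mem_range.2 (Nat.mod_lt _ hM)
    · rw [card_image_of_injOn hinj]
  conv_rhs => rw [← himg]
  rw [sum_image hinj]

/-! ### Multiply–shift hashing -/

/-- The multiply–shift hash function with key `(a, b)`, from `d` bits to `s` bits. -/
def hash (d s a b y : ℕ) : ℕ := (a * y + b) / 2 ^ d % 2 ^ s

theorem hash_lt (d s a b y : ℕ) : hash d s a b y < 2 ^ s := Nat.mod_lt _ (by positivity)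

theorem div_mod_two_pow (d s n : ℕ) : n / 2 ^ d % 2 ^ s = n % 2 ^ (d + s) / 2 ^ d := by
  rw [pow_add, Nat.mod_mul_right_div_self]

theorem div_mod_periodic (d s n m : ℕ) (h : n % 2 ^ (d + s) = m % 2 ^ (d + s)) :
    n / 2 ^ d % 2 ^ s = m / 2 ^ d % 2 ^ s := by
  rw [div_mod_two_pow, div_mod_two_pow, h]

theorem avg_top_bits {d s : ℕ} (c : ℕ) (ψ : ℕ → ℝ) :
    avg (2 ^ (d + s)) (fun b => ψ ((c + b) / 2 ^ d % 2 ^ s)) = avg (2 ^ s) ψ := by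
  have h := avg_shift (2 ^ (d + s)) c (fun x => ψ (x / 2 ^ d % 2 ^ s))
  have h' : avg (2 ^ (d + s)) (fun b => ψ ((c + b) / 2 ^ d % 2 ^ s)) =
      avg (2 ^ (d + s)) (fun x => ψ (x / 2 ^ d % 2 ^ s)) := by
    rw [← h]
    refine avg_congr fun x _ => ?_
    rw [div_mod_periodic d s (c + x) ((c + x) % 2 ^ (d + s)) (by simp)]
  rw [h', pow_add, avg_mul]
  have : ∀ a < 2 ^ d, avg (2 ^ s) (fun b => ψ ((a + 2 ^ d * b) / 2 ^ d % 2 ^ s)) =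
      avg (2 ^ s) ψ := by
    intro a ha
    refine avg_congr fun b hb => ?_
    rw [Nat.add_mul_div_left _ _ (by positivity), Nat.div_eq_of_lt ha, zero_add,
      Nat.mod_eq_of_lt hb]
  rw [avg_congr this, avg_const (by positivity)]

theorem avg_top_bits_mul {d s z : ℕ} (hz0 : z ≠ 0) (hz : z < 2 ^ d) (c : ℕ) (ψ : ℕ → ℝ) :
    avg (2 ^ (d + s)) (fun a => ψ ((c + a * z) / 2 ^ d % 2 ^ s)) = avg (2 ^ s) ψ := by
  obtain ⟨t, o, ho, rfl⟩ := Nat.exists_eq_two_pow_mul_odd hz0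
  have ho1 : 1 ≤ o := ho.pos
  have ht : t < d := by
    by_contra h
    have h1 : 2 ^ d ≤ 2 ^ t := Nat.pow_le_pow_right (by norm_num) (not_lt.1 h)
    have h2 : 2 ^ t * 1 ≤ 2 ^ t * o := Nat.mul_le_mul_left _ ho1
    omega
  have hco : o.Coprime (2 ^ (d + s)) := (Nat.coprime_two_right.2 ho).pow_right _
  have h1 := avg_mul_coprime hco (fun x => ψ ((c + x * 2 ^ t) / 2 ^ d % 2 ^ s))
  have h2 : avg (2 ^ (d + s)) (fun a => ψ ((c + a * (2 ^ t * o)) / 2 ^ d % 2 ^ s)) =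
      avg (2 ^ (d + s)) (fun x => ψ ((c + x * 2 ^ t) / 2 ^ d % 2 ^ s)) := by
    rw [← h1]
    refine avg_congr fun x _ => ?_
    rw [div_mod_periodic]
    rw [show x * (2 ^ t * o) = x * o * 2 ^ t by ring]
    exact Nat.ModEq.add_left _ (Nat.ModEq.mul_right _ (Nat.mod_modEq _ _).symm)
  obtain ⟨e, rfl⟩ := Nat.exists_eq_add_of_lt ht
  rw [h2, show 2 ^ (t + e + 1 + s) = 2 ^ (e + 1) * (2 ^ (t + s)) by rw [← pow_add]; ring_nf,
    avg_mul]
  have h3 : ∀ a < 2 ^ (e + 1), avg (2 ^ (t + s))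
      (fun b => ψ ((c + (a + 2 ^ (e + 1) * b) * 2 ^ t) / 2 ^ (t + e + 1) % 2 ^ s)) =
      avg (2 ^ s) ψ := by
    intro a _
    have h4 : ∀ b, (c + (a + 2 ^ (e + 1) * b) * 2 ^ t) / 2 ^ (t + e + 1) =
        (c + a * 2 ^ t) / 2 ^ (t + e + 1) + b := by
      intro b
      rw [show c + (a + 2 ^ (e + 1) * b) * 2 ^ t = (c + a * 2 ^ t) + 2 ^ (t + e + 1) * b by ring,
        Nat.add_mul_div_left _ _ (by positivity)]
    simp only [h4]
    rw [add_comm t s, pow_add, avg_mul]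
    have h5 : ∀ x < 2 ^ s, avg (2 ^ t)
        (fun b => ψ (((c + a * 2 ^ t) / 2 ^ (t + e + 1) + (x + 2 ^ s * b)) % 2 ^ s)) =
        ψ (((c + a * 2 ^ t) / 2 ^ (t + e + 1) + x) % 2 ^ s) := by
      intro x _
      simp only [← add_assoc, Nat.add_mul_mod_self_left]
      exact avg_const (by positivity) _
    rw [avg_congr h5, avg_shift]
  rw [avg_congr h3, avg_const (by positivity)]

theorem avg_hash_pair_of_lt {d s y y' : ℕ} (hy : y < y') (hy' : y' < 2 ^ d) (φ ψ : ℕ → ℝ) :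
    avg (2 ^ (d + s)) (fun a => avg (2 ^ (d + s)) fun b =>
      φ (hash d s a b y) * ψ (hash d s a b y')) = avg (2 ^ s) φ * avg (2 ^ s) ψ := by
  obtain ⟨z, rfl⟩ := Nat.exists_eq_add_of_lt hy
  have h1 : ∀ a < 2 ^ (d + s), (avg (2 ^ (d + s)) fun b =>
      φ (hash d s a b y) * ψ (hash d s a b (y + z + 1))) =
      avg (2 ^ (d + s)) fun b =>
        φ (b / 2 ^ d % 2 ^ s) * ψ ((b + a * (z + 1)) / 2 ^ d % 2 ^ s) := by
    intro a _
    rw [← avg_shift _ (a * y) fun b =>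
      φ (b / 2 ^ d % 2 ^ s) * ψ ((b + a * (z + 1)) / 2 ^ d % 2 ^ s)]
    refine avg_congr fun b _ => ?_
    unfold hash
    congr 2
    · exact div_mod_periodic _ _ _ _ (by simp)
    · refine div_mod_periodic _ _ _ _ ?_
      rw [show a * (y + z + 1) + b = (a * y + b) + a * (z + 1) by ring]
      exact Nat.ModEq.add_right _ (Nat.mod_modEq _ _).symm
  rw [avg_congr h1, avg_comm]
  simp only [avg_mul_left]
  have h2 : ∀ b < 2 ^ (d + s), φ (b / 2 ^ d % 2 ^ s) *
      avg (2 ^ (d + s)) (fun a => ψ ((b + a * (z + 1)) / 2 ^ d % 2 ^ s)) =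
      φ ((0 + b) / 2 ^ d % 2 ^ s) * avg (2 ^ s) ψ := by
    intro b _
    rw [avg_top_bits_mul (by omega) (by omega), zero_add]
  rw [avg_congr h2, avg_mul_right, avg_top_bits]

theorem avg_hash_pair {d s y y' : ℕ} (h : y ≠ y') (hy : y < 2 ^ d) (hy' : y' < 2 ^ d)
    (φ ψ : ℕ → ℝ) :
    avg (2 ^ (d + s)) (fun a => avg (2 ^ (d + s)) fun b =>
      φ (hash d s a b y) * ψ (hash d s a b y')) = avg (2 ^ s) φ * avg (2 ^ s) ψ := by
  rcases lt_or_gt_of_ne h with h | h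
  · exact avg_hash_pair_of_lt h hy' φ ψ
  · simp only [mul_comm (φ _)]
    rw [avg_hash_pair_of_lt h hy, mul_comm]

theorem avg_hash_sum_sq_le {d s : ℕ} {χ : ℕ → ℝ} (h0 : avg (2 ^ s) χ = 0)
    (h1 : ∀ x < 2 ^ s, |χ x| ≤ 1) :
    avg (2 ^ (d + s)) (fun a => avg (2 ^ (d + s)) fun b =>
      (∑ y ∈ range (2 ^ d), χ (hash d s a b y)) ^ 2) ≤ 2 ^ d := by
  simp only [pow_two (∑ _ ∈ _, _), sum_mul_sum, avg_sum]
  calc _ ≤ ∑ y ∈ range (2 ^ d), ∑ y' ∈ range (2 ^ d), (if y = y' then (1 : ℝ) else 0) := by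
        refine sum_le_sum fun y hy => sum_le_sum fun y' hy' => ?_
        split_ifs with h
        · subst h
          refine avg_le (by positivity) fun a _ => avg_le (by positivity) fun b _ => ?_
          have := abs_le.1 (h1 _ (hash_lt d s a b y))
          nlinarith
        · rw [avg_hash_pair h (mem_range.1 hy) (mem_range.1 hy'), h0, zero_mul]
    _ = ∑ y ∈ range (2 ^ d), (1 : ℝ) := sum_congr rfl fun y hy => by
        rw [sum_ite_eq, if_pos hy]
    _ = 2 ^ d := by simp

open scoped Classical in
/-- Chebyshev's inequality for the number of points hashed into a set. -/
theorem avg_hash_deviation_le {d s : ℕ} {φ : ℕ → ℝ} (h : ∀ x < 2 ^ s, 0 ≤ φ x ∧ φ x ≤ 1)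
    {η : ℝ} (hη : 0 < η) :
    avg (2 ^ (d + s)) (fun a => avg (2 ^ (d + s)) fun b =>
      if η ≤ |∑ y ∈ range (2 ^ d), φ (hash d s a b y) - 2 ^ d * avg (2 ^ s) φ| then 1 else 0) ≤
      2 ^ d / η ^ 2 := by
  set p := avg (2 ^ s) φ with hp
  have hp0 : 0 ≤ p := avg_nonneg fun x hx => (h x hx).1
  have hp1 : p ≤ 1 := avg_le (by positivity) fun x hx => (h x hx).2
  have key := avg_hash_sum_sq_le (d := d) (s := s) (χ := fun x => φ x - p)
    (by rw [avg_sub, avg_const (by positivity), ← hp, sub_self])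
    (fun x hx => by rw [abs_le]; constructor <;> linarith [h x hx])
  rw [le_div_iff₀ (by positivity), ← avg_mul_right]
  simp only [← avg_mul_right]
  refine (avg_mono fun a _ => avg_mono fun b _ => ?_).trans key
  have h1 : ∑ y ∈ range (2 ^ d), (φ (hash d s a b y) - p) =
      ∑ y ∈ range (2 ^ d), φ (hash d s a b y) - 2 ^ d * p := by
    simp [sum_sub_distrib]
  rw [h1]
  split_ifs with h2
  · rw [one_mul, ← sq_abs (_ - _)]
    gcongr
  · rw [zero_mul]; positivity

end SZ

namespace SZ

open Finset

/-! ### Uniformly random bit strings -/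

/-- The string of the lowest `n` binary digits of `v`. -/
def bitsFn (n v : ℕ) : Fin n → Bool := fun i => v.testBit i

theorem ofBits_bitsFn {n v : ℕ} (h : v < 2 ^ n) : Nat.ofBits (bitsFn n v) = v := by
  unfold bitsFn
  rw [Nat.ofBits_testBit, Nat.mod_eq_of_lt h]

theorem bitsFn_ofBits {n : ℕ} (x : Fin n → Bool) : bitsFn n (Nat.ofBits x) = x := by
  funext i
  simp [bitsFn]

/-- The mean of a real function on a finite type. -/
noncomputable def mean {α : Type*} [Fintype α] (f : α → ℝ) : ℝ := (∑ x, f x) / Fintype.card α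

theorem mean_bits {n : ℕ} (f : (Fin n → Bool) → ℝ) :
    mean f = avg (2 ^ n) fun v => f (bitsFn n v) := by
  unfold mean avg
  congr 1
  · symm
    refine sum_bij (fun v _ => bitsFn n v) (fun _ _ => mem_univ _) ?_ ?_ (fun _ _ => rfl)
    · intro v hv v' hv' h
      rw [← ofBits_bitsFn (mem_range.1 hv), ← ofBits_bitsFn (mem_range.1 hv'), h]
    · intro x _
      exact ⟨Nat.ofBits x, mem_range.2 (Nat.ofBits_lt_two_pow x), bitsFn_ofBits x⟩
  · simp

open scoped Classical in
theorem unifProb_eq_mean {α : Type*} [Fintype α] (p : α → Prop) :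
    unifProb p = mean fun x => if p x then (1 : ℝ) else 0 := by
  unfold unifProb mean
  simp

theorem mean_comp_eq_sum {α σ : Type*} [Fintype α] [Fintype σ] (f : α → σ) (φ : σ → ℝ) :
    mean (fun x => φ (f x)) = ∑ r, φ r * unifProb fun x => f x = r := by
  classical
  unfold mean unifProb
  simp only [← mul_div_assoc, ← sum_div]
  congr 1
  rw [← sum_fiberwise univ f]
  refine sum_congr rfl fun r _ => ?_
  rw [sum_congr rfl fun x hx => by rw [(mem_filter.1 hx).2], sum_const, nsmul_eq_mul, mul_comm]

theorem unifProb_mem_eq_sum {α σ : Type*} [Fintype α] [Fintype σ] (f : α → σ) (E : Finset σ) :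
    unifProb (fun x => f x ∈ (E : Set σ)) = ∑ r ∈ E, unifProb fun x => f x = r := by
  classical
  rw [unifProb_eq_mean]
  convert mean_comp_eq_sum f fun r => if r ∈ (E : Set σ) then (1 : ℝ) else 0 using 1
  · congr!
  · rw [← sum_subset (subset_univ E) fun r _ hr => by rw [if_neg (mt mem_coe.1 hr), zero_mul]]
    exact sum_congr rfl fun r hr => by rw [if_pos (mem_coe.2 hr), one_mul]

/-- Total variation distance bounds the difference of the means of a `[0, 1]`-valued function. -/
theorem TVClose.abs_mean_sub_le {α β σ : Type*} [Fintype α] [Fintype β] [Fintype σ]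
    {f : α → σ} {g : β → σ} {ε : ℝ} (h : TVClose f g ε) {φ : σ → ℝ}
    (hφ : ∀ r, 0 ≤ φ r ∧ φ r ≤ 1) :
    |mean (fun x => φ (f x)) - mean fun y => φ (g y)| ≤ ε := by
  classical
  rw [mean_comp_eq_sum, mean_comp_eq_sum, ← sum_sub_distrib]
  set P : σ → ℝ := fun r => unifProb fun x => f x = r
  set R : σ → ℝ := fun r => unifProb fun y => g y = r
  have key : ∀ E : Finset σ, |∑ r ∈ E, (P r - R r)| ≤ ε := by
    intro E
    have := h (E : Set σ)
    rwa [unifProb_mem_eq_sum, unifProb_mem_eq_sum, ← sum_sub_distrib] at this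
  have h1 := (abs_le.1 (key (univ.filter fun r => 0 ≤ P r - R r))).2
  have h2 := (abs_le.1 (key (univ.filter fun r => P r - R r ≤ 0))).1
  rw [sum_filter] at h1 h2
  rw [abs_le]
  constructor
  · refine h2.trans (sum_le_sum fun r _ => ?_)
    rw [← mul_sub]
    split_ifs with h3 <;> nlinarith [hφ r]
  · refine le_trans (sum_le_sum fun r _ => ?_) h1
    rw [← mul_sub]
    split_ifs with h3 <;> nlinarith [hφ r]

theorem TVClose.of_one_le {α β σ : Type*} [Fintype α] [Fintype β]
    (f : α → σ) (g : β → σ) {ε : ℝ} (h : 1 ≤ ε) : TVClose f g ε := by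
  classical
  have h01 : ∀ {γ : Type _} [Fintype γ] (p : γ → Prop), 0 ≤ unifProb p ∧ unifProb p ≤ 1 := by
    intro γ _ p
    unfold unifProb
    refine ⟨by positivity, div_le_one_of_le₀ ?_ (by positivity)⟩
    exact_mod_cast card_filter_le _ _
  have h01' : ∀ {γ : Type _} [Fintype γ] (p : γ → Prop), 0 ≤ unifProb p ∧ unifProb p ≤ 1 := by
    intro γ _ p
    unfold unifProb
    refine ⟨by positivity, div_le_one_of_le₀ ?_ (by positivity)⟩
    exact_mod_cast card_filter_le _ _
  intro E
  have h1 := h01 fun x => f x ∈ E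
  have h2 := h01' fun x => g x ∈ E
  rw [abs_le]
  constructor <;> linarith

/-! ### Averaging operators of automata -/

/-- The expectation of `f` after one step of `Q`. -/
noncomputable def FailAutomaton.stepAvg {w d : ℕ} (Q : FailAutomaton w d)
    (f : Fin (w + 1) → ℝ) (q : Fin (w + 1)) : ℝ :=
  avg (2 ^ d) fun v => f (Q.next q (bitsFn d v))

theorem FailAutomaton.mean_run {w d : ℕ} (Q : FailAutomaton w d) (m : ℕ)
    (f : Fin (w + 1) → ℝ) (q : Fin (w + 1)) :
    mean (fun x : Fin m → Fin d → Bool => f (Q.run q x)) = Q.stepAvg^[m] f q := by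
  induction m generalizing q with
  | zero => simp [mean, FailAutomaton.run]
  | succ m ih =>
    rw [Function.iterate_succ_apply', FailAutomaton.stepAvg]
    rw [← mean_bits (fun z => Q.stepAvg^[m] f (Q.next q z))]
    simp only [← ih]
    unfold mean
    rw [← (Fin.consEquiv fun _ : Fin (m + 1) => Fin d → Bool).sum_comp, Fintype.sum_prod_type,
      ← sum_div, div_div]
    congr 1
    · refine sum_congr rfl fun z _ => sum_congr rfl fun x _ => ?_
      simp [FailAutomaton.run, List.ofFn_succ, Fin.consEquiv]
    · simp [pow_succ]

theorem FailAutomaton.stepAvg_mem {w d : ℕ} (Q : FailAutomaton w d) {f : Fin (w + 1) → ℝ}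
    (hf : ∀ r, 0 ≤ f r ∧ f r ≤ 1) (q : Fin (w + 1)) : 0 ≤ Q.stepAvg f q ∧ Q.stepAvg f q ≤ 1 :=
  ⟨avg_nonneg fun _ _ => (hf _).1, avg_le (by positivity) fun _ _ => (hf _).2⟩

theorem FailAutomaton.iterate_stepAvg_mem {w d : ℕ} (Q : FailAutomaton w d) (m : ℕ)
    {f : Fin (w + 1) → ℝ} (hf : ∀ r, 0 ≤ f r ∧ f r ≤ 1) (q : Fin (w + 1)) :
    0 ≤ Q.stepAvg^[m] f q ∧ Q.stepAvg^[m] f q ≤ 1 := by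
  induction m generalizing q with
  | zero => exact hf q
  | succ m ih =>
    rw [Function.iterate_succ_apply']
    exact Q.stepAvg_mem ih q

theorem FailAutomaton.abs_stepAvg_sub_le {w d : ℕ} (Q : FailAutomaton w d)
    {f g : Fin (w + 1) → ℝ} {e : ℝ} (h : ∀ r, |f r - g r| ≤ e) (q : Fin (w + 1)) :
    |Q.stepAvg f q - Q.stepAvg g q| ≤ e :=
  (abs_avg_sub_avg_le _ _).trans (avg_le (by positivity) fun _ _ => h _)

theorem FailAutomaton.stepAvg_last {w d : ℕ} (Q : FailAutomaton w d) (f : Fin (w + 1) → ℝ) :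
    Q.stepAvg f (Fin.last w) = f (Fin.last w) := by
  unfold FailAutomaton.stepAvg
  simp only [Q.next_last]
  exact avg_const (by positivity) _

theorem FailAutomaton.iterate_stepAvg_last {w d : ℕ} (Q : FailAutomaton w d) (m : ℕ)
    (f : Fin (w + 1) → ℝ) : Q.stepAvg^[m] f (Fin.last w) = f (Fin.last w) := by
  induction m with
  | zero => rfl
  | succ m ih => rw [Function.iterate_succ_apply', stepAvg_last, ih]

/-- One operator on functions on states approximates another to within `e` on `[0, 1]`-valued
functions. -/
def OpClose {w : ℕ} (S T : (Fin (w + 1) → ℝ) → Fin (w + 1) → ℝ) (e : ℝ) : Prop :=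
  ∀ f : Fin (w + 1) → ℝ, (∀ r, 0 ≤ f r ∧ f r ≤ 1) → ∀ q, |S f q - T f q| ≤ e

theorem IsSimulator.abs_sub_le {w d s m : ℕ} {ε : ℝ} {Sim : SimFun w d s}
    (h : IsSimulator m ε Sim) (Q : FailAutomaton w d) {f : Fin (w + 1) → ℝ}
    (hf : ∀ r, 0 ≤ f r ∧ f r ≤ 1) (q : Fin (w + 1)) :
    |avg (2 ^ s) (fun x => f (Sim Q q (bitsFn s x))) - Q.stepAvg^[m] f q| ≤ ε := by
  rw [← mean_bits fun x => f (Sim Q q x), ← Q.mean_run]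
  exact (h Q q).abs_mean_sub_le hf

theorem isSimulator_of_abs_sub_le {w d s m : ℕ} {ε : ℝ} {Sim : SimFun w d s}
    (h : ∀ (Q : FailAutomaton w d) (f : Fin (w + 1) → ℝ), (∀ r, 0 ≤ f r ∧ f r ≤ 1) → ∀ q,
      |avg (2 ^ s) (fun x => f (Sim Q q (bitsFn s x))) - Q.stepAvg^[m] f q| ≤ ε) :
    IsSimulator m ε Sim := by
  classical
  intro Q q E
  have := h Q (fun r => if r ∈ E then 1 else 0) (fun r => by split_ifs <;> simp) q
  rw [← mean_bits fun x => if Sim Q q x ∈ E then (1 : ℝ) else 0, ← Q.mean_run] at this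
  rw [unifProb_eq_mean, unifProb_eq_mean]
  exact this

/-! ### Automata given by thresholds -/

/-- The automaton which moves from a state `q` other than the fail state to the number of
thresholds `τ q 0, …, τ q (w - 1)` not exceeding the number it reads. -/
def thresholdAutomaton {w d : ℕ} (τ : Fin (w + 1) → ℕ → ℕ) : FailAutomaton w d where
  next q z := if q = Fin.last w then Fin.last w else
    ⟨((range w).filter fun r => τ q r ≤ Nat.ofBits z).card, Nat.lt_succ_of_le
      ((card_filter_le _ _).trans (card_range w).le)⟩
  next_last _ := if_pos rfl

theorem card_filter_le_iff {w v : ℕ} {τ : ℕ → ℕ} (hτ : Monotone τ) {r : ℕ} (hr : r < w) :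
    ((range w).filter fun r => τ r ≤ v).card ≤ r ↔ v < τ r := by
  constructor
  · intro h
    by_contra h1
    have : range (r + 1) ⊆ (range w).filter fun r => τ r ≤ v := by
      intro x hx
      rw [mem_range] at hx
      exact mem_filter.2 ⟨mem_range.2 (by omega), (hτ (by omega : x ≤ r)).trans (not_lt.1 h1)⟩
    have := card_le_card this
    rw [card_range] at this
    omega
  · intro h
    have : (range w).filter (fun r => τ r ≤ v) ⊆ range r := by
      intro x hx
      rw [mem_filter] at hx
      rw [mem_range]
      by_contra h1
      exact absurd ((hτ (not_lt.1 h1)).trans hx.2) (not_le.2 h)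
    exact (card_le_card this).trans (card_range r).le

/-- Two distributions on states with nearby distribution functions are close. -/
theorem abs_avg_sub_avg_le_of_cdf {w A B : ℕ} (hA : 0 < A) (hB : 0 < B)
    (g : ℕ → Fin (w + 1)) (h : ℕ → Fin (w + 1)) {β : ℝ} (hβ : 0 ≤ β)
    (hgh : ∀ r < w, |avg A (fun x => if (g x : ℕ) ≤ r then (1 : ℝ) else 0) -
      avg B (fun x => if (h x : ℕ) ≤ r then (1 : ℝ) else 0)| ≤ β)
    {f : Fin (w + 1) → ℝ} (hf : ∀ r, 0 ≤ f r ∧ f r ≤ 1) :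
    |avg A (fun x => f (g x)) - avg B (fun x => f (h x))| ≤ (w + 1) * (2 * β) := by
  set G : ℕ → ℝ := fun r => avg A fun x => if (g x : ℕ) < r then (1 : ℝ) else 0
  set H : ℕ → ℝ := fun r => avg B fun x => if (h x : ℕ) < r then (1 : ℝ) else 0
  have hGH : ∀ r ≤ w + 1, |G r - H r| ≤ β := by
    intro r hr
    rcases Nat.eq_zero_or_pos r with rfl | h0
    · simp [G, H, hβ, avg]
    rcases Nat.lt_or_ge w r with h1 | h1
    · have h2 : ∀ x, (g x : ℕ) < r := fun x => (g x).2.trans_le (by omega)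
      have h3 : ∀ x, (h x : ℕ) < r := fun x => (h x).2.trans_le (by omega)
      simp [G, H, h2, h3, avg_const hA, avg_const hB, hβ]
    · have := hgh (r - 1) (by omega)
      simp only [Nat.le_sub_one_iff_lt h0] at this
      exact this
  have expand : ∀ (y : Fin (w + 1)), f y = ∑ r : Fin (w + 1),
      f r * ((if (y : ℕ) < r + 1 then (1 : ℝ) else 0) - if (y : ℕ) < r then (1 : ℝ) else 0) := by
    intro y
    rw [Finset.sum_eq_single y]
    · simp
    · intro r _ hr
      have : (r : ℕ) ≠ y := fun h => hr (Fin.ext h)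
      rcases lt_or_gt_of_ne this with h | h
      · rw [if_neg (by omega), if_neg (by omega)]; simp
      · rw [if_pos (by omega), if_pos (by omega)]; simp
    · simp
  have hg : avg A (fun x => f (g x)) = ∑ r : Fin (w + 1), f r * (G (r + 1) - G r) := by
    simp only [expand (g _), avg_sum, avg_mul_left, avg_sub]
    rfl
  have hh : avg B (fun x => f (h x)) = ∑ r : Fin (w + 1), f r * (H (r + 1) - H r) := by
    simp only [expand (h _), avg_sum, avg_mul_left, avg_sub]
    rfl
  rw [hg, hh, ← sum_sub_distrib]
  refine (abs_sum_le_sum_abs _ _).trans ?_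
  refine (sum_le_card_nsmul _ _ (2 * β) fun r _ => ?_).trans (by simp)
  rw [← mul_sub, abs_mul, abs_of_nonneg (hf r).1]
  have h1 := abs_le.1 (hGH r (by omega))
  have h2 := abs_le.1 (hGH (r + 1) (by omega))
  have h3 : |G (r + 1) - G r - (H (r + 1) - H r)| ≤ 2 * β := by
    rw [abs_le]; constructor <;> linarith
  have := hf r
  have := abs_nonneg (G (r + 1) - G r - (H (r + 1) - H r))
  nlinarith

theorem avg_lt_indicator (D t : ℕ) :
    avg D (fun v => if v < t then (1 : ℝ) else 0) = min t D / D := by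
  unfold avg
  congr 1
  rw [sum_boole]
  congr 1
  rw [show (range D).filter (fun v => v < t) = range (min t D) by ext; simp [and_comm], card_range]

end SZ

namespace SZ

open Finset

/-! ### Randomized rounding -/

/-- Rounding of `x` to a multiple of `2 ^ (d - k)` after a shift by `κ * 2 ^ (d - 2 * k)`. -/
noncomputable def snap (d k κ : ℕ) (x : ℝ) : ℕ :=
  ⌊(x + κ * 2 ^ (d - 2 * k)) / 2 ^ (d - k)⌋₊ * 2 ^ (d - k)

theorem snap_natCast (d k κ C : ℕ) :
    snap d k κ C = (C + κ * 2 ^ (d - 2 * k)) / 2 ^ (d - k) * 2 ^ (d - k) := by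
  unfold snap
  congr 1
  rw [← Nat.floor_div_eq_div (K := ℝ)]
  push_cast
  rfl

theorem snap_mono (d k κ : ℕ) {x y : ℝ} (h : x ≤ y) : snap d k κ x ≤ snap d k κ y := by
  unfold snap
  gcongr

theorem abs_snap_sub_le {d k κ : ℕ} (hk : 2 * k ≤ d) (hκ : κ < 2 ^ k) {x : ℝ} (hx : 0 ≤ x) :
    |(snap d k κ x : ℝ) - x| ≤ 2 ^ (d - k) := by
  have hρ : (0 : ℝ) < 2 ^ (d - k) := by positivity
  have h1 : (κ : ℝ) * 2 ^ (d - 2 * k) ≤ 2 ^ (d - k) := by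
    have : (κ : ℝ) ≤ 2 ^ k := by exact_mod_cast hκ.le
    calc (κ : ℝ) * 2 ^ (d - 2 * k) ≤ 2 ^ k * 2 ^ (d - 2 * k) := by gcongr
      _ = 2 ^ (d - k) := by rw [← pow_add]; congr 1; omega
  have h0 : (0 : ℝ) ≤ κ * 2 ^ (d - 2 * k) := by positivity
  unfold snap
  push_cast
  set y := (x + κ * 2 ^ (d - 2 * k)) / 2 ^ (d - k) with hy
  have hy0 : 0 ≤ y := by positivity
  have hxy : y * 2 ^ (d - k) = x + κ * 2 ^ (d - 2 * k) := by rw [hy]; field_simp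
  have h2 := Nat.floor_le hy0
  have h3 := Nat.lt_floor_add_one y
  rw [abs_le]
  constructor <;> nlinarith

/-- The shift `κ` brings `x` close to a multiple of `2 ^ (d - k)`. -/
def BadShift (d k κ : ℕ) (x : ℝ) : Prop :=
  ∃ n : ℕ, |x + κ * 2 ^ (d - 2 * k) - n * 2 ^ (d - k)| < 2 ^ (d - 2 * k) / 2

theorem snap_eq_of_not_badShift {d k κ : ℕ} {x y : ℝ} (hx : 0 ≤ x) (hy : 0 ≤ y)
    (h : |x - y| < 2 ^ (d - 2 * k) / 2) (hb : ¬ BadShift d k κ x) :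
    snap d k κ x = snap d k κ y := by
  have hρ : (0 : ℝ) < 2 ^ (d - k) := by positivity
  have h0 : (0 : ℝ) ≤ κ * 2 ^ (d - 2 * k) := by positivity
  unfold snap
  congr 1
  rw [abs_lt] at h
  by_contra hne
  rcases lt_or_gt_of_ne hne with h1 | h1
  · rw [Nat.floor_lt (by positivity)] at h1
    set n := ⌊(y + κ * 2 ^ (d - 2 * k)) / 2 ^ (d - k)⌋₊
    have h2 : (n : ℝ) ≤ _ := Nat.floor_le (by positivity)
    rw [div_lt_iff₀ hρ] at h1
    rw [le_div_iff₀ hρ] at h2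
    exact hb ⟨n, by rw [abs_lt]; constructor <;> linarith⟩
  · rw [Nat.floor_lt (by positivity)] at h1
    set n := ⌊(x + κ * 2 ^ (d - 2 * k)) / 2 ^ (d - k)⌋₊
    have h2 : (n : ℝ) ≤ _ := Nat.floor_le (by positivity)
    rw [div_lt_iff₀ hρ] at h1
    rw [le_div_iff₀ hρ] at h2
    exact hb ⟨n, by rw [abs_lt]; constructor <;> linarith⟩

open scoped Classical in
theorem avg_badShift_le {d k : ℕ} (hk : 2 * k ≤ d) (x : ℝ) :
    avg (2 ^ k) (fun κ => if BadShift d k κ x then 1 else 0) ≤ 1 / 2 ^ k := by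
  unfold avg
  rw [sum_boole]
  push_cast
  gcongr
  rw [← Nat.cast_one, Nat.cast_le, card_le_one]
  intro κ hκ κ' hκ'
  simp only [mem_filter, mem_range] at hκ hκ'
  obtain ⟨hκ, n, hn⟩ := hκ
  obtain ⟨hκ', n', hn'⟩ := hκ'
  have hη : (0 : ℝ) < 2 ^ (d - 2 * k) := by positivity
  have hρ : (2 : ℝ) ^ (d - k) = 2 ^ k * 2 ^ (d - 2 * k) := by rw [← pow_add]; congr 1; omega
  rw [hρ] at hn hn'
  rw [abs_lt] at hn hn'
  have h1 : |((κ : ℤ) - κ' - (n - n') * 2 ^ k : ℤ)| < 1 := by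
    have h2 : |((κ : ℝ) - κ' - (n - n') * 2 ^ k)| * 2 ^ (d - 2 * k) < 1 * 2 ^ (d - 2 * k) := by
      rw [← abs_of_pos hη, ← abs_mul, abs_of_pos hη, abs_lt]
      constructor <;> linarith
    have h3 := lt_of_mul_lt_mul_right h2 hη.le
    exact_mod_cast h3
  rw [Int.abs_lt_one_iff] at h1
  have h4 : (κ : ℤ) % 2 ^ k = κ' % 2 ^ k := by
    rw [show (κ : ℤ) = κ' + (n - n') * 2 ^ k by linarith, Int.add_mul_emod_self_right]
  rw [Int.emod_eq_of_lt (by positivity) (by exact_mod_cast hκ),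
    Int.emod_eq_of_lt (by positivity) (by exact_mod_cast hκ')] at h4
  exact_mod_cast h4

/-! ### The iterated construction -/

/-- The number of `y < N` such that `g y ≤ r`. -/
def countLE (N : ℕ) (g : ℕ → ℕ) (r : ℕ) : ℕ := ((range N).filter fun y => g y ≤ r).card

theorem countLE_eq_sum (N : ℕ) (g : ℕ → ℕ) (r : ℕ) :
    (countLE N g r : ℝ) = ∑ y ∈ range N, if g y ≤ r then (1 : ℝ) else 0 := by
  simp [countLE]

/-- The automaton obtained from `Q` by `i` rounds of powering and rounding, where the hash function
with key `(a, b)` provides the seeds and `κ` the shifts. -/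
noncomputable def level {w d s : ℕ} (Sim : SimFun w d s) (k : ℕ) (Q : FailAutomaton w d)
    (a b : ℕ) (κ : ℕ → ℕ) : ℕ → FailAutomaton w d
  | 0 => Q
  | i + 1 => thresholdAutomaton fun q r => snap d k (κ i) (countLE (2 ^ d)
      (fun y => Sim (level Sim k Q a b κ i) q (bitsFn s (hash d s a b y))) r)

/-- The probability that the state simulated with a uniformly random seed is at most `r`. -/
noncomputable def simCDF {w d s : ℕ} (Sim : SimFun w d s) (Q : FailAutomaton w d)
    (q : Fin (w + 1)) (r : ℕ) : ℝ :=
  avg (2 ^ s) fun x => if (Sim Q q (bitsFn s x) : ℕ) ≤ r then (1 : ℝ) else 0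

/-- The variant of `level` where all seeds are used. -/
noncomputable def idealLevel {w d s : ℕ} (Sim : SimFun w d s) (k : ℕ) (Q : FailAutomaton w d)
    (κ : ℕ → ℕ) : ℕ → FailAutomaton w d
  | 0 => Q
  | i + 1 => thresholdAutomaton fun q r => snap d k (κ i)
      (2 ^ d * simCDF Sim (idealLevel Sim k Q κ i) q r)

section

variable {w d s : ℕ} (Sim : SimFun w d s) (k : ℕ) (Q : FailAutomaton w d)

theorem simCDF_nonneg (q : Fin (w + 1)) (r : ℕ) : 0 ≤ simCDF Sim Q q r :=
  avg_nonneg fun _ _ => by split_ifs <;> norm_num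

theorem simCDF_le_one (q : Fin (w + 1)) (r : ℕ) : simCDF Sim Q q r ≤ 1 :=
  avg_le (by positivity) fun _ _ => by split_ifs <;> norm_num

theorem simCDF_mono (q : Fin (w + 1)) : Monotone (simCDF Sim Q q) := by
  intro r r' h
  refine avg_mono fun x _ => ?_
  split_ifs with h1 h2 h2 <;> first | exact absurd (h1.trans h) h2 | norm_num

theorem idealLevel_congr {κ κ' : ℕ → ℕ} {i : ℕ} (h : ∀ j < i, κ j = κ' j) :
    idealLevel Sim k Q κ i = idealLevel Sim k Q κ' i := by
  induction i with
  | zero => rfl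
  | succ i ih =>
    rw [idealLevel, idealLevel, ih fun j hj => h j (by omega), h i (by omega)]

variable {k}

/-- One round of powering and rounding approximates the power. -/
theorem abs_idealLevel_succ_sub_le {m₀ : ℕ} {ε : ℝ} (hε : 0 ≤ ε) (hSim : IsSimulator m₀ ε Sim)
    (hk : 2 * k ≤ d) {κ : ℕ → ℕ} (hκ : ∀ i, κ i < 2 ^ k) (i : ℕ) :
    OpClose (idealLevel Sim k Q κ (i + 1)).stepAvg ((idealLevel Sim k Q κ i).stepAvg^[m₀])
      (ε + (w + 1) * (2 * (1 / 2 ^ k))) := by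
  intro f hf q
  by_cases hq : q = Fin.last w
  · subst hq
    rw [FailAutomaton.stepAvg_last, FailAutomaton.iterate_stepAvg_last, sub_self, abs_zero]
    positivity
  have h1 := hSim.abs_sub_le (idealLevel Sim k Q κ i) hf q
  set Q' := idealLevel Sim k Q κ i with hQ'
  have h2 : |(idealLevel Sim k Q κ (i + 1)).stepAvg f q -
      avg (2 ^ s) (fun x => f (Sim Q' q (bitsFn s x)))| ≤ (w + 1) * (2 * (1 / 2 ^ k)) := by
    refine abs_avg_sub_avg_le_of_cdf (by positivity) (by positivity) _ _ (by positivity) ?_ hf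
    intro r hr
    have hmono : Monotone fun r => snap d k (κ i) (2 ^ d * simCDF Sim Q' q r) := by
      intro r r' h
      exact snap_mono _ _ _ (by gcongr; exact simCDF_mono _ _ _ h)
    have h3 : avg (2 ^ d) (fun v => if ((idealLevel Sim k Q κ (i + 1)).next q (bitsFn d v) : ℕ) ≤ r
        then (1 : ℝ) else 0) =
        (min (snap d k (κ i) (2 ^ d * simCDF Sim Q' q r)) (2 ^ d) : ℕ) / (2 ^ d : ℕ) := by
      rw [← avg_lt_indicator]
      refine avg_congr fun v hv => ?_
      simp only [idealLevel, thresholdAutomaton, if_neg hq, ofBits_bitsFn hv]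
      rw [if_congr (card_filter_le_iff hmono hr) rfl rfl]
    rw [h3]
    have h0 := simCDF_nonneg Sim Q' q r
    have h1 := simCDF_le_one Sim Q' q r
    have h4 := abs_le.1 (abs_snap_sub_le (d := d) hk (hκ i)
      (x := 2 ^ d * simCDF Sim Q' q r) (by positivity))
    change |_ - simCDF Sim Q' q r| ≤ _
    have hD : (0 : ℝ) < 2 ^ d := by positivity
    have hρ : (2 : ℝ) ^ (d - k) = 2 ^ d * (1 / 2 ^ k) := by
      rw [mul_one_div, eq_div_iff (by positivity), ← pow_add]
      congr 1; omega
    rw [hρ] at h4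
    push_cast
    rw [abs_le, neg_le_sub_iff_le_add, sub_le_iff_le_add, div_le_iff₀ hD,
      ← sub_le_iff_le_add, le_div_iff₀ hD]
    have h5 : (0 : ℝ) < 1 / 2 ^ k := by positivity
    constructor
    · rw [le_min_iff]
      constructor <;> nlinarith
    · exact (min_le_left _ _).trans (by nlinarith)
  have h3 := abs_sub_le ((idealLevel Sim k Q κ (i + 1)).stepAvg f q)
    (avg (2 ^ s) (fun x => f (Sim Q' q (bitsFn s x)))) (Q'.stepAvg^[m₀] f q)
  linarith

/-- The automata of the ideal construction approximate the powers of `Q`. -/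
theorem opClose_idealLevel {m₀ : ℕ} {e : ℝ} {κ : ℕ → ℕ}
    (h : ∀ i, OpClose (idealLevel Sim k Q κ (i + 1)).stepAvg
      ((idealLevel Sim k Q κ i).stepAvg^[m₀]) e) (i : ℕ) :
    OpClose (idealLevel Sim k Q κ i).stepAvg (Q.stepAvg^[m₀ ^ i])
      ((∑ j ∈ range i, m₀ ^ j : ℕ) * e) := by
  induction i with
  | zero => intro f hf q; simp [idealLevel]
  | succ i ih =>
    intro f hf q
    have h1 := h i f hf q
    have hiter : (Q.stepAvg^[m₀ ^ i])^[m₀] = Q.stepAvg^[m₀ ^ (i + 1)] := by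
      rw [← Function.iterate_mul, pow_succ]
    have h2 : ∀ n : ℕ, ∀ q, |(idealLevel Sim k Q κ i).stepAvg^[n] f q -
        (Q.stepAvg^[m₀ ^ i])^[n] f q| ≤ n * ((∑ j ∈ range i, m₀ ^ j : ℕ) * e) := by
      intro n
      induction n with
      | zero => intro q; simp
      | succ n ihn =>
        intro q
        rw [Function.iterate_succ_apply', Function.iterate_succ_apply']
        have hmem : ∀ r, 0 ≤ (Q.stepAvg^[m₀ ^ i])^[n] f r ∧ (Q.stepAvg^[m₀ ^ i])^[n] f r ≤ 1 := by
          rw [← Function.iterate_mul]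
          exact Q.iterate_stepAvg_mem _ hf
        have h3 := (idealLevel Sim k Q κ i).abs_stepAvg_sub_le ihn q
        have h4 := ih _ hmem q
        have h5 := abs_sub_le
          ((idealLevel Sim k Q κ i).stepAvg ((idealLevel Sim k Q κ i).stepAvg^[n] f) q)
          ((idealLevel Sim k Q κ i).stepAvg ((Q.stepAvg^[m₀ ^ i])^[n] f) q)
          (Q.stepAvg^[m₀ ^ i] ((Q.stepAvg^[m₀ ^ i])^[n] f) q)
        push_cast at *
        linarith
    have h6 := h2 m₀ q
    rw [hiter] at h6
    have h7 := abs_sub_le ((idealLevel Sim k Q κ (i + 1)).stepAvg f q)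
      ((idealLevel Sim k Q κ i).stepAvg^[m₀] f q) (Q.stepAvg^[m₀ ^ (i + 1)] f q)
    rw [show (∑ j ∈ range (i + 1), m₀ ^ j) = m₀ * (∑ j ∈ range i, m₀ ^ j) + 1 by
      rw [sum_range_succ', mul_sum]; simp [pow_succ, mul_comm]]
    push_cast at *
    linarith

/-- The hash function with key `(a, b)` misrepresents the probability of `{0, …, r}`. -/
def BadHash (k : ℕ) (a b : ℕ) (q : Fin (w + 1)) (r : ℕ) : Prop :=
  2 ^ (d - 2 * k) / 2 ≤
    |∑ y ∈ range (2 ^ d), (if (Sim Q q (bitsFn s (hash d s a b y)) : ℕ) ≤ r then (1 : ℝ) else 0) -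
      2 ^ d * simCDF Sim Q q r|

theorem level_eq_idealLevel {a b u : ℕ} {κ : ℕ → ℕ}
    (h : ∀ i < u, ∀ q, ∀ r < w,
      ¬ BadShift d k (κ i) (2 ^ d * simCDF Sim (idealLevel Sim k Q κ i) q r) ∧
      ¬ BadHash Sim (idealLevel Sim k Q κ i) k a b q r) :
    level Sim k Q a b κ u = idealLevel Sim k Q κ u := by
  induction u with
  | zero => rfl
  | succ u ih =>
    rw [level, idealLevel, ih fun i hi => h i (by omega)]
    unfold thresholdAutomaton
    congr 1
    funext q z
    congr 3
    refine filter_congr fun r hr => ?_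
    obtain ⟨h1, h2⟩ := h u (by omega) q r (mem_range.1 hr)
    have h3 := simCDF_nonneg Sim (idealLevel Sim k Q κ u) q r
    unfold BadHash at h2
    beta_reduce
    rw [snap_eq_of_not_badShift (y := (countLE (2 ^ d) (fun y => Sim (idealLevel Sim k Q κ u) q
      (bitsFn s (hash d s a b y))) r : ℕ)) (by positivity) (by positivity) _ h1]
    rw [countLE_eq_sum, abs_sub_comm]
    exact not_le.1 h2

end

/-- Digit number `i` of `n` to the base `2 ^ k`. -/
def digit (k n i : ℕ) : ℕ := n / 2 ^ (k * i) % 2 ^ k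

theorem digit_lt (k n i : ℕ) : digit k n i < 2 ^ k := Nat.mod_lt _ (by positivity)

theorem digit_add_of_lt {k A i j : ℕ} (h : j < i) (B : ℕ) :
    digit k (A + 2 ^ (k * i) * B) j = digit k A j := by
  unfold digit
  obtain ⟨e, rfl⟩ := Nat.exists_eq_add_of_lt h
  rw [show k * (j + e + 1) = k * j + (k + k * e) by ring, pow_add, pow_add, mul_assoc, mul_assoc,
    Nat.add_mul_div_left _ _ (by positivity), Nat.add_mul_mod_self_left]

theorem digit_add_self {k A i : ℕ} (hA : A < 2 ^ (k * i)) (B : ℕ) :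
    digit k (A + 2 ^ (k * i) * B) i = B % 2 ^ k := by
  unfold digit
  rw [Nat.add_mul_div_left _ _ (by positivity), Nat.div_eq_of_lt hA, zero_add]

/-- Averaging a function of the first `i + 1` digits. -/
theorem avg_digit_le {k u i : ℕ} (hi : i < u) {c : ℝ} {f : ℕ → ℝ} {g : ℕ → ℕ → ℝ}
    (hf : ∀ A < 2 ^ (k * i), ∀ B, f (A + 2 ^ (k * i) * B) = g A (B % 2 ^ k))
    (hg : ∀ A < 2 ^ (k * i), avg (2 ^ k) (g A) ≤ c) : avg (2 ^ (u * k)) f ≤ c := by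
  obtain ⟨e, rfl⟩ := Nat.exists_eq_add_of_lt hi
  rw [show 2 ^ ((i + e + 1) * k) = 2 ^ (k * i) * (2 ^ k * 2 ^ (k * e)) by
    rw [← pow_add, ← pow_add]; ring_nf, avg_mul]
  refine avg_le (by positivity) fun A hA => ?_
  rw [avg_mul]
  refine le_trans (avg_mono fun κ hκ => ?_) (hg A hA)
  refine avg_le (by positivity) fun B _ => ?_
  rw [hf A hA, Nat.add_mul_mod_self_left, Nat.mod_eq_of_lt hκ]

/-! ### The simulator -/

/-- The seed length of the simulator. -/
def seedLength (d s k u : ℕ) : ℕ := (d + s) + ((d + s) + (d + u * k))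

/-- The simulated state, as a function of the number with the digits of the seed. -/
noncomputable def szaState {w d s : ℕ} (Sim : SimFun w d s) (k u : ℕ) (Q : FailAutomaton w d)
    (q : Fin (w + 1)) (X : ℕ) : Fin (w + 1) :=
  (level Sim k Q (X % 2 ^ (d + s)) (X / 2 ^ (d + s) % 2 ^ (d + s))
    (digit k (X / 2 ^ (d + s) / 2 ^ (d + s) / 2 ^ d)) u).next q
    (bitsFn d (X / 2 ^ (d + s) / 2 ^ (d + s) % 2 ^ d))

/-- The Saks–Zhou–Armoni simulator. -/
noncomputable def sza {w d s : ℕ} (Sim : SimFun w d s) (k u : ℕ) :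
    SimFun w d (seedLength d s k u) :=
  fun Q q x => szaState Sim k u Q q (Nat.ofBits x)

theorem szaState_add {w d s : ℕ} (Sim : SimFun w d s) (k u : ℕ) (Q : FailAutomaton w d)
    (q : Fin (w + 1)) {a b v : ℕ} (ha : a < 2 ^ (d + s)) (hb : b < 2 ^ (d + s)) (hv : v < 2 ^ d)
    (n : ℕ) :
    szaState Sim k u Q q (a + 2 ^ (d + s) * (b + 2 ^ (d + s) * (v + 2 ^ d * n))) =
      (level Sim k Q a b (digit k n) u).next q (bitsFn d v) := by
  have h : ∀ M, 0 < M → ∀ x < M, ∀ y, (x + M * y) % M = x ∧ (x + M * y) / M = y := by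
    intro M hM x hx y
    rw [Nat.add_mul_mod_self_left, Nat.mod_eq_of_lt hx, Nat.add_mul_div_left _ _ hM,
      Nat.div_eq_of_lt hx, zero_add]
    exact ⟨rfl, rfl⟩
  unfold szaState
  rw [(h _ (by positivity) a ha _).1, (h _ (by positivity) a ha _).2,
    (h _ (by positivity) b hb _).1, (h _ (by positivity) b hb _).2,
    (h _ (by positivity) v hv _).1, (h _ (by positivity) v hv _).2]

/-- An upper bound for the indicator of the event that the shift or the hash function is bad for
the thresholds of state `q` and target `r` in round `i`. -/
noncomputable def badWeight {w d s : ℕ} (Sim : SimFun w d s) (k : ℕ) (Q : FailAutomaton w d)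
    (a b n i : ℕ) (q : Fin (w + 1)) (r : ℕ) : ℝ :=
  open scoped Classical in
  (if BadShift d k (digit k n i)
    (2 ^ d * simCDF Sim (idealLevel Sim k Q (digit k n) i) q r) then 1 else 0) +
  (if BadHash Sim (idealLevel Sim k Q (digit k n) i) k a b q r then 1 else 0)

section

variable {w d s : ℕ} (Sim : SimFun w d s) {k : ℕ} (Q : FailAutomaton w d)

theorem badWeight_nonneg (a b n i : ℕ) (q : Fin (w + 1)) (r : ℕ) :
    0 ≤ badWeight Sim k Q a b n i q r := by
  unfold badWeight
  split_ifs <;> norm_num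

theorem abs_level_sub_idealLevel_le (a b n u : ℕ) {f : Fin (w + 1) → ℝ}
    (hf : ∀ r, 0 ≤ f r ∧ f r ≤ 1) (q : Fin (w + 1)) (z : Fin d → Bool) :
    |f ((level Sim k Q a b (digit k n) u).next q z) -
      f ((idealLevel Sim k Q (digit k n) u).next q z)| ≤
      ∑ i ∈ range u, ∑ q : Fin (w + 1), ∑ r ∈ range w, badWeight Sim k Q a b n i q r := by
  classical
  have hJ0 := badWeight_nonneg Sim (k := k) Q
  by_cases hgood : ∀ i < u, ∀ q, ∀ r < w,
    ¬ BadShift d k (digit k n i) (2 ^ d * simCDF Sim (idealLevel Sim k Q (digit k n) i) q r) ∧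
    ¬ BadHash Sim (idealLevel Sim k Q (digit k n) i) k a b q r
  · rw [level_eq_idealLevel Sim Q hgood, sub_self, abs_zero]
    exact sum_nonneg fun _ _ => sum_nonneg fun _ _ => sum_nonneg fun _ _ => hJ0 _ _ _ _ _ _
  · push Not at hgood
    obtain ⟨i, hi, q', r, hr, hbad⟩ := hgood
    have h4 : (1 : ℝ) ≤ badWeight Sim k Q a b n i q' r := by
      unfold badWeight
      by_cases h5 : BadShift d k (digit k n i)
        (2 ^ d * simCDF Sim (idealLevel Sim k Q (digit k n) i) q' r)
      · rw [if_pos h5]; split_ifs <;> norm_num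
      · rw [if_neg h5, if_pos (hbad h5)]; norm_num
    have h5 : |f ((level Sim k Q a b (digit k n) u).next q z) -
        f ((idealLevel Sim k Q (digit k n) u).next q z)| ≤ 1 := by
      have h6 := hf ((level Sim k Q a b (digit k n) u).next q z)
      have h7 := hf ((idealLevel Sim k Q (digit k n) u).next q z)
      rw [abs_le]
      constructor <;> linarith
    refine (h5.trans h4).trans ?_
    refine le_trans ?_ (single_le_sum (f := fun i => ∑ q : Fin (w + 1), ∑ r ∈ range w,
      badWeight Sim k Q a b n i q r)
      (fun _ _ => sum_nonneg fun _ _ => sum_nonneg fun _ _ => hJ0 _ _ _ _ _ _) (mem_range.2 hi))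
    refine le_trans ?_ (single_le_sum (f := fun q => ∑ r ∈ range w,
      badWeight Sim k Q a b n i q r) (fun _ _ => sum_nonneg fun _ _ => hJ0 _ _ _ _ _ _)
      (mem_univ q'))
    exact single_le_sum (f := fun r => badWeight Sim k Q a b n i q' r)
      (fun _ _ => hJ0 _ _ _ _ _ _) (mem_range.2 hr)

theorem avg_badWeight_le (hk : 5 * k ≤ d) {u i : ℕ} (hi : i < u) (q : Fin (w + 1)) (r : ℕ) :
    (avg (2 ^ (d + s)) fun a => avg (2 ^ (d + s)) fun b => avg (2 ^ (u * k)) fun n =>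
      badWeight Sim k Q a b n i q r) ≤ 5 / 2 ^ k := by
  classical
  simp only [badWeight, avg_add]
  rw [avg_const (by positivity), avg_const (by positivity)]
  have e1 : avg (2 ^ (u * k)) (fun n => if BadShift d k (digit k n i)
      (2 ^ d * simCDF Sim (idealLevel Sim k Q (digit k n) i) q r) then (1 : ℝ) else 0) ≤
      1 / 2 ^ k := by
    refine avg_digit_le hi (g := fun A κ => if BadShift d k κ
      (2 ^ d * simCDF Sim (idealLevel Sim k Q (digit k A) i) q r) then (1 : ℝ) else 0) ?_ ?_
    · intro A hA B
      rw [digit_add_self hA,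
        idealLevel_congr Sim k Q (κ' := digit k A) fun j hj => digit_add_of_lt hj B]
    · intro A hA
      convert avg_badShift_le (d := d) (k := k) (by omega) _
  have e2 : (avg (2 ^ (d + s)) fun a => avg (2 ^ (d + s)) fun b => avg (2 ^ (u * k)) fun n =>
      if BadHash Sim (idealLevel Sim k Q (digit k n) i) k a b q r then (1 : ℝ) else 0) ≤
      4 / 2 ^ k := by
    have e3 : (avg (2 ^ (d + s)) fun a => avg (2 ^ (d + s)) fun b => avg (2 ^ (u * k)) fun n =>
        if BadHash Sim (idealLevel Sim k Q (digit k n) i) k a b q r then (1 : ℝ) else 0) =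
        avg (2 ^ (u * k)) fun n => avg (2 ^ (d + s)) fun a => avg (2 ^ (d + s)) fun b =>
        if BadHash Sim (idealLevel Sim k Q (digit k n) i) k a b q r then (1 : ℝ) else 0 := by
      rw [avg_comm (2 ^ (u * k))]
      exact avg_congr fun a _ => avg_comm _ _ _
    rw [e3]
    refine avg_le (by positivity) fun n _ => ?_
    refine (avg_hash_deviation_le (d := d) (s := s)
      (φ := fun x => if (Sim (idealLevel Sim k Q (digit k n) i) q (bitsFn s x) : ℕ) ≤ r
        then (1 : ℝ) else 0) (fun x _ => by split_ifs <;> norm_num)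
      (η := 2 ^ (d - 2 * k) / 2) (by positivity)).trans ?_
    rw [div_pow, div_div_eq_mul_div, div_le_div_iff₀ (by positivity) (by positivity)]
    have : (2 : ℝ) ^ d * 2 ^ k ≤ (2 ^ (d - 2 * k)) ^ 2 := by
      rw [← pow_add, ← pow_mul]
      exact pow_le_pow_right₀ (by norm_num) (by omega)
    linarith
  calc _ ≤ 1 / (2 : ℝ) ^ k + 4 / 2 ^ k := add_le_add e1 e2
    _ = 5 / 2 ^ k := by ring

theorem avg_abs_level_sub_idealLevel_le (hk : 5 * k ≤ d) (u : ℕ) {f : Fin (w + 1) → ℝ}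
    (hf : ∀ r, 0 ≤ f r ∧ f r ≤ 1) (q : Fin (w + 1)) :
    (avg (2 ^ (d + s)) fun a => avg (2 ^ (d + s)) fun b => avg (2 ^ d) fun v =>
      avg (2 ^ (u * k)) fun n => |f ((level Sim k Q a b (digit k n) u).next q (bitsFn d v)) -
      f ((idealLevel Sim k Q (digit k n) u).next q (bitsFn d v))|) ≤
      u * (w + 1) * w * (5 / 2 ^ k) := by
  calc _ ≤ avg (2 ^ (d + s)) fun a => avg (2 ^ (d + s)) fun b => avg (2 ^ (u * k)) fun n =>
        ∑ i ∈ range u, ∑ q : Fin (w + 1), ∑ r ∈ range w, badWeight Sim k Q a b n i q r := by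
        refine avg_mono fun a _ => avg_mono fun b _ => avg_le (by positivity) fun v _ => ?_
        exact avg_mono fun n _ => abs_level_sub_idealLevel_le Sim Q a b n u hf q _
    _ = ∑ i ∈ range u, ∑ q : Fin (w + 1), ∑ r ∈ range w, avg (2 ^ (d + s)) fun a =>
        avg (2 ^ (d + s)) fun b => avg (2 ^ (u * k)) fun n => badWeight Sim k Q a b n i q r := by
        simp only [avg_sum]
    _ ≤ ∑ i ∈ range u, ∑ q : Fin (w + 1), ∑ r ∈ range w, (5 / 2 ^ k : ℝ) :=
        sum_le_sum fun i hi => sum_le_sum fun q _ => sum_le_sum fun r _ =>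
          avg_badWeight_le Sim Q hk (mem_range.1 hi) q r
    _ = u * (w + 1) * w * (5 / 2 ^ k) := by simp; ring

theorem avg_sza (u : ℕ) (f : Fin (w + 1) → ℝ) (q : Fin (w + 1)) :
    avg (2 ^ seedLength d s k u) (fun x => f (sza Sim k u Q q (bitsFn _ x))) =
      avg (2 ^ (d + s)) fun a => avg (2 ^ (d + s)) fun b => avg (2 ^ d) fun v =>
        avg (2 ^ (u * k)) fun n =>
          f ((level Sim k Q a b (digit k n) u).next q (bitsFn d v)) := by
  have : avg (2 ^ seedLength d s k u) (fun x => f (sza Sim k u Q q (bitsFn _ x))) =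
      avg (2 ^ seedLength d s k u) (fun x => f (szaState Sim k u Q q x)) :=
    avg_congr fun x hx => by rw [sza, ofBits_bitsFn hx]
  rw [this, seedLength, pow_add, avg_mul]
  refine avg_congr fun a ha => ?_
  rw [pow_add, avg_mul]
  refine avg_congr fun b hb => ?_
  rw [pow_add, avg_mul]
  refine avg_congr fun v hv => ?_
  refine avg_congr fun n _ => ?_
  rw [szaState_add Sim k u Q q ha hb hv]

end

theorem isSimulator_sza {w d s : ℕ} {Sim : SimFun w d s} {k u m₀ : ℕ} {ε e : ℝ}
    (hSim : IsSimulator m₀ ε Sim) (hε : 0 ≤ ε) (hk : 5 * k ≤ d)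
    (he : (∑ j ∈ range u, m₀ ^ j : ℕ) * (ε + (w + 1) * (2 * (1 / 2 ^ k))) +
      u * (w + 1) * w * (5 / 2 ^ k) ≤ e) :
    IsSimulator (m₀ ^ u) e (sza Sim k u) := by
  refine isSimulator_of_abs_sub_le fun Q f hf q => ?_
  rw [avg_sza]
  have h2 : |(avg (2 ^ (d + s)) fun _ => avg (2 ^ (d + s)) fun _ => avg (2 ^ d) fun v =>
      avg (2 ^ (u * k)) fun n => f ((idealLevel Sim k Q (digit k n) u).next q (bitsFn d v))) -
      Q.stepAvg^[m₀ ^ u] f q| ≤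
      (∑ j ∈ range u, m₀ ^ j : ℕ) * (ε + (w + 1) * (2 * (1 / 2 ^ k))) := by
    rw [avg_const (by positivity), avg_const (by positivity), avg_comm]
    have h3 : ∀ n, |(avg (2 ^ d) fun v =>
        f ((idealLevel Sim k Q (digit k n) u).next q (bitsFn d v))) - Q.stepAvg^[m₀ ^ u] f q| ≤
        (∑ j ∈ range u, m₀ ^ j : ℕ) * (ε + (w + 1) * (2 * (1 / 2 ^ k))) := fun n =>
      opClose_idealLevel Sim Q
        (abs_idealLevel_succ_sub_le Sim Q hε hSim (by omega) (digit_lt k n)) u f hf q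
    conv_lhs => rw [← avg_const (N := 2 ^ (u * k)) (by positivity) (Q.stepAvg^[m₀ ^ u] f q)]
    exact (abs_avg_sub_avg_le _ _).trans (avg_le (by positivity) fun n _ => h3 n)
  refine (abs_sub_le _ _ _).trans ((add_le_add ?_ h2).trans
    ((add_comm _ _).trans_le he))
  refine le_trans ?_ (avg_abs_level_sub_idealLevel_le Sim Q hk u hf q)
  refine (abs_avg_sub_avg_le _ _).trans (avg_mono fun a _ => ?_)
  refine (abs_avg_sub_avg_le _ _).trans (avg_mono fun b _ => ?_)
  refine (abs_avg_sub_avg_le _ _).trans (avg_mono fun v _ => ?_)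
  exact abs_avg_sub_avg_le _ _

end SZ

namespace SZ

/-! ### Executions with an invariant -/

/-- Execution from one configuration to another such that all configurations after the first one
satisfy `G`. -/
def Machine.Path (M : Machine) (env : Env) (G : Config M.R M.Λ → Prop) :
    Config M.R M.Λ → Config M.R M.Λ → Prop :=
  Relation.ReflTransGen fun c₁ c₂ => M.step env c₁ = some c₂ ∧ G c₂

theorem Machine.Path.reaches {M : Machine} {env : Env} {G : Config M.R M.Λ → Prop}
    {c c' : Config M.R M.Λ} (h : M.Path env G c c') :
    Relation.ReflTransGen (fun c₁ c₂ => M.step env c₁ = some c₂) c c' :=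
  Relation.ReflTransGen.mono (fun _ _ h => h.1) _ _ h

theorem Machine.Path.trans {M : Machine} {env : Env} {G : Config M.R M.Λ → Prop}
    {c c' c'' : Config M.R M.Λ} (h : M.Path env G c c') (h' : M.Path env G c' c'') :
    M.Path env G c c'' :=
  Relation.ReflTransGen.trans h h'

theorem Machine.Path.target {M : Machine} {env : Env} {G : Config M.R M.Λ → Prop}
    {c c' : Config M.R M.Λ} (h : M.Path env G c c') (hc : G c) : G c' := by
  rcases Relation.ReflTransGen.cases_tail h with rfl | ⟨_, _, h⟩
  · exact hc
  · exact h.2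

/-- An invariant which holds along a halting execution holds at all reachable configurations. -/
theorem Machine.Path.invariant {M : Machine} {env : Env} {G : Config M.R M.Λ → Prop}
    {c' : Config M.R M.Λ} (h : M.Path env G M.init c') (h0 : G M.init)
    (hc' : M.step env c' = none) {c : Config M.R M.Λ} (hc : M.Reaches env c) : G c := by
  suffices H : G c ∧ M.Path env G c c' from H.1
  induction hc with
  | refl => exact ⟨h0, h⟩
  | tail _ hstep ih =>
    obtain ⟨-, hp⟩ := ih
    rcases Relation.ReflTransGen.cases_head hp with rfl | ⟨x, ⟨hx, hGx⟩, hp'⟩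
    · rw [hc'] at hstep
      cases hstep
    · rw [hx] at hstep
      cases hstep
      exact ⟨hGx, hp'⟩

/-! ### Programs made of blocks -/

def Instr.mapLabel {R Λ Λ' : Type} (f : Λ → Λ') : Instr R Λ → Instr R Λ'
  | .assign r e l => .assign r e (f l)
  | .branch e l₁ l₀ => .branch e (f l₁) (f l₀)
  | .input r e l => .input r e (f l)
  | .param r p l => .param r p (f l)
  | .testEps a b l₁ l₀ => .testEps a b (f l₁) (f l₀)
  | .invoke r l₁ l₂ => .invoke r (f l₁) (f l₂)
  | .respond e r l₁ l₂ => .respond e r (f l₁) (f l₂)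
  | .halt r => .halt r

/-- The machine whose program consists of blocks: the block `β` performs the assignments of the
list `body β` and then the instruction `term β`. -/
def blockMachine {R Blk : Type} [Fintype R] [DecidableEq R] [Fintype Blk] (n : ℕ) (start : Blk)
    (body : Blk → List (R × Expr R)) (term : Blk → Instr R Blk) : Machine where
  R := R
  Λ := Blk × Fin (n + 1)
  start := (start, 0)
  code l := match (body l.1)[(l.2 : ℕ)]? with
    | some p => .assign p.1 p.2 (l.1, l.2 + 1)
    | none => (term l.1).mapLabel fun β => (β, 0)

/-- The effect of a list of assignments on the registers. -/
def exec {R : Type} [DecidableEq R] (v : R → ℕ) : List (R × Expr R) → R → ℕ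
  | [] => v
  | p :: l => exec (Function.update v p.1 (p.2.eval v)) l

/-- All values assigned are less than `N`. -/
def ExecBounded {R : Type} [DecidableEq R] (N : ℕ) (v : R → ℕ) : List (R × Expr R) → Prop
  | [] => True
  | p :: l => p.2.eval v < N ∧ ExecBounded N (Function.update v p.1 (p.2.eval v)) l

theorem forall_update_lt {R : Type} [DecidableEq R] {N : ℕ} {v : R → ℕ} (hv : ∀ r, v r < N)
    (r : R) {x : ℕ} (hx : x < N) (r' : R) : Function.update v r x r' < N := by
  by_cases h : r' = r
  · subst h; simpa using hx
  · rw [Function.update_of_ne h]; exact hv r'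

theorem forall_exec_lt {R : Type} [DecidableEq R] {N : ℕ} {v : R → ℕ} (hv : ∀ r, v r < N)
    {l : List (R × Expr R)} (h : ExecBounded N v l) (r : R) : exec v l r < N := by
  induction l generalizing v with
  | nil => exact hv r
  | cons p l ih => exact ih (forall_update_lt hv _ h.1) h.2

section

variable {R Blk : Type} [Fintype R] [DecidableEq R] [Fintype Blk] {n : ℕ} {start : Blk}
  {body : Blk → List (R × Expr R)} {term : Blk → Instr R Blk}

/-- The configuration at the beginning of a block. -/
def atBlock (n : ℕ) (β : Blk) (v : R → ℕ) (st : List Frame) (t : ℕ) :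
    Config R (Blk × Fin (n + 1)) :=
  ⟨.alg (β, 0), v, st, t⟩

/-- All registers are less than `N` and the stack satisfies `H`. -/
def Within {Λ : Type} (N : ℕ) (H : List Frame → Prop) (c : Config R Λ) : Prop :=
  (∀ r, c.regs r < N) ∧ H c.stack

theorem code_add {β : Blk} {i : ℕ} (hi : i < n + 1) :
    (blockMachine n start body term).code (β, ⟨i, hi⟩) = (match (body β)[i]? with
      | some p => .assign p.1 p.2 (β, ⟨i, hi⟩ + 1)
      | none => (term β).mapLabel fun β => (β, 0) : Instr R (Blk × Fin (n + 1))) := rfl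

theorem path_body_aux {env : Env} {N : ℕ} {H : List Frame → Prop} {st : List Frame} {t : ℕ}
    (hst : H st) {β : Blk} (hlen : (body β).length ≤ n) (l : List (R × Expr R)) (i : ℕ)
    (hi : i + l.length = (body β).length) (hl : (body β).drop i = l) (v : R → ℕ)
    (hv : ∀ r, v r < N) (hb : ExecBounded N v l) :
    (blockMachine n start body term).Path env (Within N H)
      ⟨.alg (β, ⟨i, by omega⟩), v, st, t⟩
      ⟨.alg (β, ⟨(body β).length, by omega⟩), exec v l, st, t⟩ := by
  induction l generalizing i v with
  | nil =>
    simp only [List.length_nil, add_zero] at hi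
    subst hi
    exact Relation.ReflTransGen.refl
  | cons p l ih =>
    simp only [List.length_cons] at hi
    have hv' := forall_update_lt hv p.1 hb.1
    have hp : (body β)[i]? = some p := by
      have := congrArg (fun l => l[0]?) hl
      simpa using this
    refine Relation.ReflTransGen.head ?_ (ih (i + 1) (by omega) ?_ _ hv' hb.2)
    · refine ⟨?_, hv', hst⟩
      simp only [Machine.step, code_add, hp]
      congr 4
      apply Fin.ext
      change _ = i + 1
      rw [Fin.val_add_one_of_lt]
      change i < n
      omega
    · rw [← List.drop_drop, hl]; rfl

/-- The last instruction of a block is executed after its assignments. -/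
theorem path_block {env : Env} {N : ℕ} {H : List Frame → Prop} {st : List Frame} {t : ℕ}
    (hst : H st) {β : Blk} (hlen : (body β).length ≤ n) {v v' : R → ℕ}
    (hv : ∀ r, v r < N) (hb : ExecBounded N v (body β)) (hx : exec v (body β) = v')
    {c : Config R (Blk × Fin (n + 1))}
    (hc : ∀ l, (blockMachine n start body term).code l =
      ((term β).mapLabel fun β => (β, 0) : Instr R (Blk × Fin (n + 1))) →
      (blockMachine n start body term).step env ⟨.alg l, v', st, t⟩ = some c)
    (hG : Within N H c) :
    (blockMachine n start body term).Path env (Within N H) (atBlock n β v st t) c := by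
  subst hx
  refine Relation.ReflTransGen.tail (path_body_aux hst hlen (body β) 0 (by simp) rfl v hv hb)
    ⟨hc _ ?_, hG⟩
  rw [code_add, List.getElem?_eq_none le_rfl]

variable {env : Env} {N : ℕ} {H : List Frame → Prop} {st : List Frame} {t : ℕ} {β : Blk}
  {v v' : R → ℕ}

theorem path_branch {e : Expr R} {l₁ l₀ l : Blk} (ht : term β = .branch e l₁ l₀)
    (hlen : (body β).length ≤ n) (hx : exec v (body β) = v')
    (hl : (if e.eval v' ≠ 0 then l₁ else l₀) = l)
    (hst : H st) (hv : ∀ r, v r < N) (hb : ExecBounded N v (body β)) :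
    (blockMachine n start body term).Path env (Within N H) (atBlock n β v st t)
      (atBlock n l v' st t) := by
  refine path_block hst hlen hv hb hx ?_ ⟨?_, hst⟩
  · intro l' hl'
    subst hl
    simp only [Machine.step, hl', ht, Instr.mapLabel, atBlock]
    change some (Config.mk (Control.alg (if e.eval v' ≠ 0 then (l₁, (0 : Fin (n + 1)))
      else (l₀, 0))) v' st t) =
      some (Config.mk (Control.alg (if e.eval v' ≠ 0 then l₁ else l₀, 0)) v' st t)
    split_ifs <;> rfl
  · subst hx
    exact forall_exec_lt hv hb

open scoped Classical in
theorem path_testEps {e₁ e₂ : Expr R} {l₁ l₀ l : Blk} (ht : term β = .testEps e₁ e₂ l₁ l₀)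
    (hlen : (body β).length ≤ n) (hx : exec v (body β) = v')
    (hl : (if (e₁.eval v' : ℝ) ≤ e₂.eval v' * env.ε then l₁ else l₀) = l)
    (hst : H st) (hv : ∀ r, v r < N) (hb : ExecBounded N v (body β)) :
    (blockMachine n start body term).Path env (Within N H) (atBlock n β v st t)
      (atBlock n l v' st t) := by
  refine path_block hst hlen hv hb hx ?_ ⟨?_, hst⟩
  · intro l' hl'
    subst hl
    simp only [Machine.step, hl', ht, Instr.mapLabel, atBlock]
    change some (Config.mk (Control.alg (if (e₁.eval v' : ℝ) ≤ e₂.eval v' * env.ε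
      then (l₁, (0 : Fin (n + 1))) else (l₀, 0))) v' st t) =
      some (Config.mk (Control.alg (if (e₁.eval v' : ℝ) ≤ e₂.eval v' * env.ε
        then l₁ else l₀, 0)) v' st t)
    split_ifs <;> rfl
  · subst hx
    exact forall_exec_lt hv hb

theorem path_param {r : R} {p : Param} {l : Blk} (ht : term β = .param r p l)
    (hlen : (body β).length ≤ n) (hx : exec v (body β) = v')
    {v'' : R → ℕ} (hv'' : Function.update v' r (env.param p) = v'')
    (hst : H st) (hv : ∀ r, v r < N) (hb : ExecBounded N v (body β)) (hp : env.param p < N) :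
    (blockMachine n start body term).Path env (Within N H) (atBlock n β v st t)
      (atBlock n l v'' st t) := by
  subst hv''
  refine path_block hst hlen hv hb hx ?_ ⟨?_, hst⟩
  · intro l' hl'
    simp only [Machine.step, hl', ht, Instr.mapLabel, atBlock]
    rfl
  · subst hx
    exact forall_update_lt (forall_exec_lt hv hb) _ hp

theorem path_input {r : R} {e : Expr R} {l : Blk} {x : Bool} (ht : term β = .input r e l)
    (hlen : (body β).length ≤ n) (hx : exec v (body β) = v')
    (hin : env.input[e.eval v']? = some x)
    {v'' : R → ℕ} (hv'' : Function.update v' r x.toNat = v'')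
    (hst : H st) (hv : ∀ r, v r < N) (hb : ExecBounded N v (body β)) (hN : 1 < N) :
    (blockMachine n start body term).Path env (Within N H) (atBlock n β v st t)
      (atBlock n l v'' st t) := by
  subst hv''
  refine path_block hst hlen hv hb hx ?_ ⟨?_, hst⟩
  · intro l' hl'
    simp only [Machine.step, hl', ht, Instr.mapLabel, atBlock]
    change some (Config.mk (Control.alg (l, (0 : Fin (n + 1)))) (Function.update v' r
      (match env.input[e.eval v']? with
        | some b => b.toNat
        | none => 2)) st t) = _
    rw [hin]
    rfl
  · subst hx
    exact forall_update_lt (forall_exec_lt hv hb) _ (lt_of_le_of_lt (Bool.toNat_le x) hN)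

/-- The oracle has been given control; its move goes to register `r`. -/
def atOracle (n : ℕ) (r : R) (l₁ l₂ : Blk) (v : R → ℕ) (st : List Frame) (t : ℕ) :
    Config R (Blk × Fin (n + 1)) :=
  ⟨.oracle r (l₁, 0) (l₂, 0), v, st, t⟩

theorem path_invoke {r : R} {l₁ l₂ : Blk} (ht : term β = .invoke r l₁ l₂)
    (hlen : (body β).length ≤ n) (hx : exec v (body β) = v')
    (hst : H st) (hst' : H (⟨env.oracle t, [], none⟩ :: st)) (hv : ∀ r, v r < N)
    (hb : ExecBounded N v (body β)) :
    (blockMachine n start body term).Path env (Within N H) (atBlock n β v st t)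
      (atOracle n r l₁ l₂ v' (⟨env.oracle t, [], none⟩ :: st) (t + 1)) := by
  refine path_block hst hlen hv hb hx ?_ ⟨?_, hst'⟩
  · intro l' hl'
    simp only [Machine.step, hl', ht, Instr.mapLabel, atOracle]
    rfl
  · subst hx
    exact forall_exec_lt hv hb

theorem path_respond {r : R} {e : Expr R} {l₁ l₂ : Blk} {τ : Strategy} {h : List (Option Bool)}
    {j : ℕ} {x : Option Bool} (ht : term β = .respond e r l₁ l₂)
    (hlen : (body β).length ≤ n) (hx : exec v (body β) = v')
    (hq : queryValue (e.eval v') = x)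
    (hst : H (⟨τ, h, some j⟩ :: st)) (hst' : H (⟨τ, x :: h, none⟩ :: st)) (hv : ∀ r, v r < N)
    (hb : ExecBounded N v (body β)) :
    (blockMachine n start body term).Path env (Within N H)
      (atBlock n β v (⟨τ, h, some j⟩ :: st) t)
      (atOracle n r l₁ l₂ v' (⟨τ, x :: h, none⟩ :: st) t) := by
  refine path_block hst hlen hv hb hx ?_ ⟨?_, hst'⟩
  · intro l' hl'
    subst hq
    simp only [Machine.step, hl', ht, Instr.mapLabel, atOracle]
    rfl
  · subst hx
    exact forall_exec_lt hv hb

theorem path_halt {r : R} (ht : term β = .halt r)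
    (hlen : (body β).length ≤ n) (hx : exec v (body β) = v')
    (hst : H st) (hv : ∀ r, v r < N) (hb : ExecBounded N v (body β)) :
    (blockMachine n start body term).Path env (Within N H)
      (atBlock n β v st t) ⟨.halted (v' r), v', st, t⟩ := by
  refine path_block hst hlen hv hb hx ?_ ⟨?_, hst⟩
  · intro l' hl'
    simp only [Machine.step, hl', ht, Instr.mapLabel]
    rfl
  · subst hx
    exact forall_exec_lt hv hb

theorem path_oracle_answer {r : R} {l₁ l₂ : Blk} {τ : Strategy} {h : List (Option Bool)}
    {x : Bool} (ha : τ h = .answer x) {p : Option ℕ}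
    (hv' : Function.update v r x.toNat = v') (hst : H st) (hv : ∀ r, v r < N) (hN : 1 < N) :
    (blockMachine n start body term).Path env (Within N H)
      (atOracle n r l₁ l₂ v (⟨τ, h, p⟩ :: st) t)
      (atBlock n l₂ v' st t) := by
  subst hv'
  refine Relation.ReflTransGen.single
    ⟨?_, forall_update_lt hv _ (lt_of_le_of_lt (Bool.toNat_le x) hN), hst⟩
  simp only [Machine.step, atOracle, ha]
  rfl

theorem path_oracle_read {r : R} {l₁ l₂ : Blk} {τ : Strategy} {h : List (Option Bool)}
    {j : ℕ} (ha : τ h = .read j) {p : Option ℕ} (hv' : Function.update v r j = v')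
    (hst : H (⟨τ, h, some j⟩ :: st)) (hv : ∀ r, v r < N) (hj : j < N) :
    (blockMachine n start body term).Path env (Within N H)
      (atOracle n r l₁ l₂ v (⟨τ, h, p⟩ :: st) t)
      (atBlock n l₁ v' (⟨τ, h, some j⟩ :: st) t) := by
  subst hv'
  refine Relation.ReflTransGen.single ⟨?_, forall_update_lt hv _ hj, hst⟩
  simp only [Machine.step, atOracle, ha]
  rfl

end

end SZ

namespace SZ

/-! ### Positions of encoded queries -/

theorem length_natBits (L n : ℕ) : (natBits L n).length = L := by simp [natBits]

theorem getElem?_natBits {L n i : ℕ} (h : i < L) : (natBits L n)[i]? = some (n.testBit i) := by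
  simp [natBits, h]

theorem getElem?_flatMap_of_length_eq {α β : Type*} {l : List α} {f : α → List β} {c : ℕ}
    (h : ∀ x ∈ l, (f x).length = c) (i : ℕ) {j : ℕ} (hj : j < c) :
    (l.flatMap f)[i * c + j]? = l[i]?.bind fun x => (f x)[j]? := by
  induction l generalizing i with
  | nil => simp
  | cons x l ih =>
    have hx : (f x).length = c := h x (by simp)
    rw [List.flatMap_cons]
    cases i with
    | zero => rw [List.getElem?_append_left (by omega)]; simp
    | succ i =>
      rw [List.getElem?_append_right (by rw [hx]; nlinarith), hx,
        show (i + 1) * c + j - c = i * c + j by rw [Nat.succ_mul]; omega,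
        ih (fun y hy => h y (by simp [hy]))]
      simp

theorem length_flatMap_of_length_eq {α β : Type*} {l : List α} {f : α → List β} {c : ℕ}
    (h : ∀ x ∈ l, (f x).length = c) : (l.flatMap f).length = l.length * c := by
  induction l with
  | nil => simp
  | cons x l ih =>
    rw [List.flatMap_cons, List.length_append, h x (by simp), ih fun y hy => h y (by simp [hy])]
    simp [Nat.succ_mul, add_comm]

theorem length_encTable {w d : ℕ} (Q : FailAutomaton w d) :
    (encTable Q).length = (w + 1) * 2 ^ d * Nat.size w := by
  unfold encTable
  rw [length_flatMap_of_length_eq (c := 2 ^ d * Nat.size w), List.length_finRange, mul_assoc]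
  intro q _
  rw [length_flatMap_of_length_eq (c := Nat.size w), List.length_range]
  intro v _
  exact length_natBits _ _

theorem getElem?_encTable {w d : ℕ} (Q : FailAutomaton w d) (q : Fin (w + 1)) {v e : ℕ}
    (hv : v < 2 ^ d) (he : e < Nat.size w) :
    (encTable Q)[(q * 2 ^ d + v) * Nat.size w + e]? =
      some ((Q.next q (bitsFn d v) : ℕ).testBit e) := by
  unfold encTable
  rw [show ((q : ℕ) * 2 ^ d + v) * Nat.size w + e =
      q * (2 ^ d * Nat.size w) + (v * Nat.size w + e) by ring,
    getElem?_flatMap_of_length_eq]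
  · rw [List.getElem?_eq_getElem (by simpa using Nat.lt_succ_iff.1 q.2)]
    simp only [List.getElem_finRange, Option.bind_some]
    rw [getElem?_flatMap_of_length_eq (fun _ _ => length_natBits _ _) _ he,
      List.getElem?_eq_getElem (by simpa using hv)]
    simp only [List.getElem_range, Option.bind_some]
    rw [getElem?_natBits he]
    rfl
  · intro q _
    rw [length_flatMap_of_length_eq (c := Nat.size w), List.length_range]
    intro v _
    exact length_natBits _ _
  · calc v * Nat.size w + e < v * Nat.size w + Nat.size w := by omega
      _ = (v + 1) * Nat.size w := by ring
      _ ≤ 2 ^ d * Nat.size w := Nat.mul_le_mul_right _ hv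

section

variable {w d s : ℕ} (Q : FailAutomaton w d) (q : Fin (w + 1)) (x : Fin s → Bool)

theorem getElem?_encInput_of_lt {j : ℕ} (hj : j < (w + 1) * 2 ^ d * Nat.size w) :
    (encInput Q q x)[j]? = (encTable Q)[j]? := by
  unfold encInput
  rw [List.append_assoc, List.getElem?_append_left (by rwa [length_encTable])]

theorem length_encInput :
    (encInput Q q x).length = (w + 1) * 2 ^ d * Nat.size w + Nat.size w + s := by
  simp [encInput, length_encTable, length_natBits, add_assoc]

/-- The part after the table consists of the digits of a number. -/
theorem getElem?_encInput_add {n e : ℕ} (hn : bitsFn s n = x) (he : e < Nat.size w + s) :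
    (encInput Q q x)[(w + 1) * 2 ^ d * Nat.size w + e]? =
      some ((2 ^ Nat.size w * n + q).testBit e) := by
  have hq : (q : ℕ) < 2 ^ Nat.size w :=
    lt_of_le_of_lt (Nat.lt_succ_iff.1 q.2) (Nat.lt_size_self w)
  unfold encInput
  rw [List.append_assoc, List.getElem?_append_right (by rw [length_encTable]; omega),
    length_encTable, Nat.add_sub_cancel_left, Nat.testBit_two_pow_mul_add _ hq]
  split_ifs with h
  · rw [List.getElem?_append_left (by rwa [length_natBits]), getElem?_natBits h]
  · rw [List.getElem?_append_right (by rw [length_natBits]; omega), length_natBits,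
      List.getElem?_ofFn, dif_pos (by omega), ← hn]
    rfl

variable (b : ℕ)

theorem getElem?_encQuery_of_lt {j : ℕ}
    (hj : j < (w + 1) * 2 ^ d * Nat.size w + Nat.size w + s) :
    (encQuery Q q x b true)[j]? = (encInput Q q x)[j]? := by
  unfold encQuery
  rw [List.append_assoc, List.getElem?_append_left (by rwa [length_encInput])]

theorem getElem?_encQuery_add (e : ℕ) :
    (encQuery Q q x b true)[(w + 1) * 2 ^ d * Nat.size w + Nat.size w + s + e]? =
      (Nat.bits b ++ [true])[e]? := by
  unfold encQuery
  rw [List.append_assoc, List.getElem?_append_right (by rw [length_encInput]; omega),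
    length_encInput, Nat.add_sub_cancel_left]

theorem length_encQuery :
    (encQuery Q q x b true).length =
      (w + 1) * 2 ^ d * Nat.size w + Nat.size w + s + Nat.size b + 1 := by
  simp [encQuery, length_encInput, Nat.size_eq_bits_len, add_assoc]

end

/-! ### Query values computed from shifted numbers -/

/-- The query value computed from the number `n`: `⊥` for `0`, the tag bit for `1`, and otherwise
digit number `1`. -/
theorem queryValue_of_two_le {n : ℕ} (h : 2 ≤ n) :
    queryValue (2 - n + n / 2 % 2) = some (n.testBit 1) := by
  rw [Nat.sub_eq_zero_of_le h, zero_add, Nat.testBit_succ, Nat.testBit_zero]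
  rcases Nat.mod_two_eq_zero_or_one (n / 2) with h | h <;> simp [h, queryValue]

theorem queryValue_guarded {n e g : ℕ} (hn : n < 2 ^ g) (he : e < g) :
    queryValue (2 - (2 * (n + 2 ^ g) + 1) / 2 ^ e +
      (2 * (n + 2 ^ g) + 1) / 2 ^ e / 2 % 2) = some (n.testBit e) := by
  have h1 : 2 ≤ (2 * (n + 2 ^ g) + 1) / 2 ^ e := by
    rw [Nat.le_div_iff_mul_le (by positivity)]
    have : 2 ^ e ≤ 2 ^ g := Nat.pow_le_pow_right (by norm_num) he.le
    omega
  rw [queryValue_of_two_le h1, Nat.testBit_div_two_pow, Nat.add_comm 1 e, Nat.testBit_succ,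
    show (2 * (n + 2 ^ g) + 1) / 2 = n + 2 ^ g by omega]
  congr 1
  have := Nat.testBit_two_pow_mul_add 1 hn e
  rw [mul_one, if_pos he, add_comm] at this
  exact this

theorem bits_getElem? (b e : ℕ) (h : e < Nat.size b) : (Nat.bits b)[e]? = some (b.testBit e) := by
  have hl : e < (Nat.bits b).length := by rwa [Nat.size_eq_bits_len]
  rw [List.getElem?_eq_getElem hl]
  congr 1
  rw [Nat.testBit_eq_inth, List.getI_eq_getElem _ hl]

theorem queryValue_bits (b e : ℕ) :
    queryValue (2 - (2 * b + 1) / 2 ^ e + (2 * b + 1) / 2 ^ e / 2 % 2) =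
      (Nat.bits b ++ [true])[e]? := by
  have hlen : (Nat.bits b).length = Nat.size b := Nat.size_eq_bits_len b
  have hdiv : (2 * b + 1) / 2 ^ e / 2 = b / 2 ^ e := by
    rw [Nat.div_right_comm,
      show (2 * b + 1) / 2 = b by omega]
  rcases lt_trichotomy e (Nat.size b) with h | h | h
  · have h1 : 2 ^ e ≤ b := Nat.lt_size.1 h
    have h2 : 1 ≤ b / 2 ^ e := by
      rwa [Nat.le_div_iff_mul_le (by positivity), one_mul]
    rw [queryValue_of_two_le (by omega), List.getElem?_append_left (by omega), bits_getElem? _ _ h,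
      Nat.testBit_succ, hdiv, Nat.testBit_div_two_pow, Nat.zero_add]
  · subst h
    have h1 : b < 2 ^ Nat.size b := Nat.lt_size_self b
    have h2 : 2 ^ Nat.size b ≤ 2 * b + 1 := by
      rcases Nat.eq_zero_or_pos b with rfl | h0
      · simp
      · obtain ⟨z, hz⟩ : ∃ z, Nat.size b = z + 1 :=
          ⟨Nat.size b - 1, by have := Nat.size_pos.2 h0; omega⟩
        have : 2 ^ z ≤ b := Nat.lt_size.1 (by omega)
        rw [hz, pow_succ]; omega
    have h3 : (2 * b + 1) / 2 ^ Nat.size b = 1 := by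
      apply Nat.div_eq_of_lt_le <;> omega
    rw [h3, List.getElem?_append_right (by omega), hlen]
    simp [queryValue]
  · have h1 : 2 * b + 1 < 2 ^ e := by
      have h2 : b < 2 ^ Nat.size b := Nat.lt_size_self b
      have h3 : 2 ^ (Nat.size b + 1) ≤ 2 ^ e := Nat.pow_le_pow_right (by norm_num) h
      rw [pow_succ] at h3
      omega
    rw [Nat.div_eq_of_lt h1, List.getElem?_eq_none (by simp; omega)]
    rfl

theorem queryAnswer_true {w d s : ℕ} (Sim : SimFun w d s) (Q : FailAutomaton w d)
    (q : Fin (w + 1)) (x : Fin s → Bool) {b : ℕ} (hb : b < Nat.size w) :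
    queryAnswer Sim Q q x b true = (Sim Q q x : ℕ).testBit b := by
  simp [queryAnswer, getElem?_natBits hb]

theorem two_mul_div_add_testBit (n e : ℕ) :
    2 * (n / 2 ^ (e + 1)) + (n.testBit e).toNat = n / 2 ^ e := by
  rw [Nat.toNat_testBit, pow_succ, ← Nat.div_div_eq_div_mul]
  omega

end SZ

namespace SZ

/-! ### The program -/

instance {R : Type} : Add (Expr R) := ⟨.add⟩
instance {R : Type} : Sub (Expr R) := ⟨.sub⟩
instance {R : Type} : Mul (Expr R) := ⟨.mul⟩
instance {R : Type} : Div (Expr R) := ⟨.div⟩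
instance {R : Type} : Mod (Expr R) := ⟨.mod⟩
instance {R : Type} (n : ℕ) : OfNat (Expr R) n := ⟨.const n⟩

/-- The registers of the algorithm. -/
inductive Rg where
  -- parameters, and numbers computed from them once and for all
  | w | d | m₀ | s | m | i | p | sz | D | P | W | K | ρ | η | B | T | u
  -- the hash key and the shifts
  | a | b | κ
  -- the level, its power of `K`, the stack, the arguments, the loop and the pending query value
  | lvl | pow | S | q | v | t | val | C | res | j | e | cur
  deriving DecidableEq

instance : Fintype Rg where
  elems := {.w, .d, .m₀, .s, .m, .i, .p, .sz, .D, .P, .W, .K, .ρ, .η, .B, .T, .u, .a, .b, .κ,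
    .lvl, .pow, .S, .q, .v, .t, .val, .C, .res, .j, .e, .cur}
  complete r := by cases r <;> decide

/-- The blocks of the program. -/
inductive Blk where
  | start | trivial | getW | getD | getM₀ | getS | getM | ones | powers | powersStep
  | height | heightLoop | heightStep | derived | load (top : Bool) | loadRead (top : Bool)
  | loadAdd (top : Bool) | unpack | eval | evalTable | evalLoop | loop | invoke | answer
  | read | readTable | readRest | readState | readIndex | shift | shiftStep | respond
  | ret | pop | finish
  deriving Fintype

def rg (r : Rg) : Expr Rg := .reg r

/-- The assignments of the blocks. -/
def szBody : Blk → List (Rg × Expr Rg)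
  | .ones => [(.D, 1), (.P, 1), (.W, 1), (.K, 1)]
  | .powersStep =>
    [(.D, rg .D * (2 - (1 - (rg .d - rg .i)))),
     (.K, rg .K * (2 - (1 - (rg .d / 8 - rg .i)))),
     (.P, rg .P * (2 - (1 - (rg .s - rg .i)))),
     (.sz, rg .sz + (1 - (rg .W - rg .w))),
     (.W, rg .W * (1 + (1 - (rg .W - rg .w)))),
     (.i, rg .i + 1)]
  | .height => [(.p, 1), (.pow, 1)]
  | .heightStep =>
    [(.p, rg .p * rg .m₀), (.pow, rg .pow * rg .K), (.u, rg .u + 1), (.lvl, rg .lvl + 1)]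
  | .derived =>
    [(.T, (rg .w + 1) * rg .D * rg .sz), (.ρ, rg .D / rg .K), (.η, rg .D / rg .K / rg .K),
     (.B, rg .D * rg .D), (.cur, rg .T),
     (.t, rg .sz + ((rg .d + rg .s) + ((rg .d + rg .s) + (rg .d + rg .u * (rg .d / 8))))),
     (.res, 0)]
  | .loadRead _ => [(.t, rg .t - 1)]
  | .loadAdd _ => [(.res, 2 * rg .res + rg .j)]
  | .unpack =>
    [(.q, rg .res % rg .W), (.cur, rg .res / rg .W), (.a, rg .cur % (rg .D * rg .P)),
     (.cur, rg .cur / (rg .D * rg .P)), (.b, rg .cur % (rg .D * rg .P)),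
     (.cur, rg .cur / (rg .D * rg .P)), (.v, rg .cur % rg .D), (.κ, rg .cur / rg .D)]
  | .evalTable =>
    [(.res, 0), (.t, rg .sz), (.cur, (rg .q * rg .D + rg .v) * rg .sz)]
  | .evalLoop => [(.t, 0), (.val, 0), (.C, 0), (.res, 0)]
  | .answer =>
    [(.val, 2 * rg .val + rg .j),
     (.t, rg .t + 1),
     (.C, rg .C + (1 - rg .t % rg .sz) * (1 - (rg .val - (rg .t - 1) / (rg .D * rg .sz))) *
        (1 - (1 - (rg .w - rg .q)))),
     (.val, rg .val * (1 - (1 - rg .t % rg .sz))),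
     (.res, rg .res + (1 - rg .t % (rg .D * rg .sz)) *
        (1 - ((rg .C + rg .κ / (rg .pow / rg .K) % rg .K * rg .η) / rg .ρ * rg .ρ - rg .v))),
     (.C, rg .C * (1 - (1 - rg .t % (rg .D * rg .sz))))]
  | .readTable =>
    [(.S, (((((((rg .S * rg .B + rg .q) * rg .B + rg .v) * rg .B + rg .t) * rg .B + rg .val) *
        rg .B + rg .C) * rg .B + rg .res) * rg .B) + rg .j % rg .sz),
     (.v, rg .j / rg .sz % rg .D), (.q, rg .j / rg .sz / rg .D),
     (.lvl, rg .lvl - 1), (.pow, rg .pow / rg .K)]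
  | .readRest => [(.e, rg .j - rg .T)]
  | .readState =>
    [(.cur, 2 * (rg .W * ((rg .a * (rg .t / rg .sz % rg .D) + rg .b) / rg .D % rg .P) + rg .q +
        rg .D * rg .P) + 1)]
  | .readIndex =>
    [(.e, rg .e - (rg .sz + rg .s)), (.cur, 2 * (rg .sz - 1 - rg .t % rg .sz) + 1)]
  | .shiftStep => [(.cur, rg .cur / 2), (.e, rg .e - 1)]
  | .pop =>
    [(.cur, 2 * (rg .res + rg .D * rg .P) + 1),
     (.e, rg .S % rg .B), (.S, rg .S / rg .B), (.res, rg .S % rg .B), (.S, rg .S / rg .B),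
     (.C, rg .S % rg .B), (.S, rg .S / rg .B), (.val, rg .S % rg .B), (.S, rg .S / rg .B),
     (.t, rg .S % rg .B), (.S, rg .S / rg .B), (.v, rg .S % rg .B), (.S, rg .S / rg .B),
     (.q, rg .S % rg .B), (.S, rg .S / rg .B), (.lvl, rg .lvl + 1), (.pow, rg .pow * rg .K)]
  | _ => []

/-- The unconditional jump. -/
def goTo (l : Blk) : Instr Rg Blk := .branch 0 l l

/-- The last instructions of the blocks. -/
def szTerm : Blk → Instr Rg Blk
  | .start => .testEps 1 12 .trivial .getW
  | .trivial => .halt .res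
  | .getW => .param .w .w .getD
  | .getD => .param .d .d .getM₀
  | .getM₀ => .param .m₀ .m₀ .getS
  | .getS => .param .s .s .getM
  | .getM => .param .m .m .ones
  | .ones => goTo .powers
  | .powers => .branch (rg .s + rg .d - rg .i) .powersStep .height
  | .powersStep => goTo .powers
  | .height => goTo .heightLoop
  | .heightLoop => .branch (rg .m - rg .p) .heightStep .derived
  | .heightStep => goTo .heightLoop
  | .derived => goTo (.load true)
  | .load top => .branch (rg .t) (.loadRead top) (if top then .unpack else .ret)
  | .loadRead top => .input .j (rg .cur + rg .t) (.loadAdd top)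
  | .loadAdd top => goTo (.load top)
  | .unpack => goTo .eval
  | .eval => .branch (rg .lvl) .evalLoop .evalTable
  | .evalTable => goTo (.load false)
  | .evalLoop => goTo .loop
  | .loop => .branch (rg .w * rg .D * rg .sz - rg .t) .invoke .ret
  | .invoke => .invoke .j .read .answer
  | .answer => goTo .loop
  | .read => .branch (rg .T - rg .j) .readTable .readRest
  | .readTable => goTo .eval
  | .readRest => .branch (rg .sz + rg .s - rg .e) .readState .readIndex
  | .readState => goTo .shift
  | .readIndex => goTo .shift
  | .shift => .branch (rg .e) .shiftStep .respond
  | .shiftStep => goTo .shift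
  | .respond => .respond (2 - rg .cur + rg .cur / 2 % 2) .j .read .answer
  | .ret => .branch (rg .u - rg .lvl) .pop .finish
  | .pop => goTo .shift
  | .finish => .halt .res

/-- The algorithm. -/
def szMachine : Machine := blockMachine 17 .start szBody szTerm

/-- The contents of the registers which the main part does not change. -/
structure Gl where
  (w d m₀ s m i p sz D P W K ρ η B T u a b κ : ℕ)

/-- The contents of the other registers. -/
structure Lo where
  (lvl pow S q v t val C res j e cur : ℕ)

def regs (g : Gl) (l : Lo) : Rg → ℕ
  | .w => g.w
  | .d => g.d
  | .m₀ => g.m₀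
  | .s => g.s
  | .m => g.m
  | .i => g.i
  | .p => g.p
  | .sz => g.sz
  | .D => g.D
  | .P => g.P
  | .W => g.W
  | .K => g.K
  | .ρ => g.ρ
  | .η => g.η
  | .B => g.B
  | .T => g.T
  | .u => g.u
  | .a => g.a
  | .b => g.b
  | .κ => g.κ
  | .lvl => l.lvl
  | .pow => l.pow
  | .S => l.S
  | .q => l.q
  | .v => l.v
  | .t => l.t
  | .val => l.val
  | .C => l.C
  | .res => l.res
  | .j => l.j
  | .e => l.e
  | .cur => l.cur

theorem length_szBody_le (β : Blk) : (szBody β).length ≤ 17 := by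
  cases β <;> simp [szBody]

/-- The configuration of `szMachine` at the beginning of the block `β`. -/
def cfg (β : Blk) (g : Gl) (l : Lo) (st : List Frame) (n : ℕ) :
    Config szMachine.R szMachine.Λ :=
  atBlock 17 β (regs g l) st n

/-- The configuration of `szMachine` when the oracle is in control. -/
def ocfg (g : Gl) (l : Lo) (st : List Frame) (n : ℕ) : Config szMachine.R szMachine.Λ :=
  atOracle 17 .j .read .answer (regs g l) st n

section

variable {env : Env} {N : ℕ} {H : List Frame → Prop} {st : List Frame} {n : ℕ} {g g' : Gl}
  {l l' : Lo}

theorem step_branch {β : Blk} {e : Expr Rg} {l₁ l₀ β' : Blk} (ht : szTerm β = .branch e l₁ l₀)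
    (hx : ∀ r, exec (regs g l) (szBody β) r = regs g' l' r)
    (hl : (if e.eval (regs g' l') ≠ 0 then l₁ else l₀) = β')
    (hst : H st) (hv : ∀ r, regs g l r < N) (hb : ExecBounded N (regs g l) (szBody β)) :
    szMachine.Path env (Within N H) (cfg β g l st n) (cfg β' g' l' st n) :=
  path_branch ht (length_szBody_le β) (funext hx) hl hst hv hb

theorem step_goTo {β β' : Blk} (ht : szTerm β = goTo β')
    (hx : ∀ r, exec (regs g l) (szBody β) r = regs g' l' r)
    (hst : H st) (hv : ∀ r, regs g l r < N) (hb : ExecBounded N (regs g l) (szBody β)) :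
    szMachine.Path env (Within N H) (cfg β g l st n) (cfg β' g' l' st n) :=
  step_branch ht hx (ite_self _) hst hv hb

theorem step_param {β β' : Blk} {r : Rg} {p : Param} (ht : szTerm β = .param r p β')
    (hβ : szBody β = []) (hx : ∀ r', Function.update (regs g l) r (env.param p) r' = regs g' l' r')
    (hst : H st) (hv : ∀ r, regs g l r < N) (hp : env.param p < N) :
    szMachine.Path env (Within N H) (cfg β g l st n) (cfg β' g' l' st n) :=
  path_param ht (length_szBody_le β) (by rw [hβ]; rfl) (funext hx) hst hv (by rw [hβ]; trivial) hp

theorem step_input {β β' : Blk} {r : Rg} {e : Expr Rg} {x : Bool} {g'' : Gl} {l'' : Lo}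
    (ht : szTerm β = .input r e β')
    (hx : ∀ r, exec (regs g l) (szBody β) r = regs g' l' r)
    (hin : env.input[e.eval (regs g' l')]? = some x)
    (hx' : ∀ r', Function.update (regs g' l') r x.toNat r' = regs g'' l'' r')
    (hst : H st) (hv : ∀ r, regs g l r < N) (hb : ExecBounded N (regs g l) (szBody β))
    (hN : 1 < N) :
    szMachine.Path env (Within N H) (cfg β g l st n) (cfg β' g'' l'' st n) :=
  path_input ht (length_szBody_le β) (funext hx) hin (funext hx') hst hv hb hN

theorem step_invoke (hst : H st) (hst' : H (⟨env.oracle n, [], none⟩ :: st))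
    (hv : ∀ r, regs g l r < N) :
    szMachine.Path env (Within N H) (cfg .invoke g l st n)
      (ocfg g l (⟨env.oracle n, [], none⟩ :: st) (n + 1)) :=
  path_invoke (β := Blk.invoke) (term := szTerm) (body := szBody) rfl
    (length_szBody_le _) rfl hst hst' hv trivial

theorem step_respond {τ : Strategy} {h : List (Option Bool)} {j : ℕ} {x : Option Bool}
    (hx : queryValue (2 - l.cur + l.cur / 2 % 2) = x) (hst : H (⟨τ, h, some j⟩ :: st))
    (hst' : H (⟨τ, x :: h, none⟩ :: st)) (hv : ∀ r, regs g l r < N) :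
    szMachine.Path env (Within N H) (cfg .respond g l (⟨τ, h, some j⟩ :: st) n)
      (ocfg g l (⟨τ, x :: h, none⟩ :: st) n) :=
  path_respond (β := Blk.respond) (term := szTerm) (body := szBody) rfl
    (length_szBody_le _) rfl hx hst hst' hv trivial

theorem step_oracle_answer {τ : Strategy} {h : List (Option Bool)} {x : Bool}
    (ha : τ h = .answer x) (hst : H st) (hv : ∀ r, regs g l r < N) (hN : 1 < N) :
    szMachine.Path env (Within N H) (ocfg g l (⟨τ, h, none⟩ :: st) n)
      (cfg .answer g { l with j := x.toNat } st n) :=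
  path_oracle_answer ha (funext fun r => by cases r <;> rfl) hst hv hN

theorem step_oracle_read {τ : Strategy} {h : List (Option Bool)} {j : ℕ}
    (ha : τ h = .read j) (hst : H (⟨τ, h, some j⟩ :: st)) (hv : ∀ r, regs g l r < N) (hj : j < N) :
    szMachine.Path env (Within N H) (ocfg g l (⟨τ, h, none⟩ :: st) n)
      (cfg .read g { l with j := j } (⟨τ, h, some j⟩ :: st) n) :=
  path_oracle_read ha (funext fun r => by cases r <;> rfl) hst hv hj

end

end SZ

namespace SZ

open Finset

/-! ### The counting loop -/

section

variable {sz D : ℕ}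

theorem loop_index {r y β : ℕ} (hy : y < D) (hβ : β < sz) :
    ((r * D + y) * sz + β) % sz = β ∧ ((r * D + y) * sz + β) / sz % D = y ∧
      ((r * D + y) * sz + β) / (D * sz) = r ∧
      ((r * D + y) * sz + β) % (D * sz) = y * sz + β := by
  have hsz : 0 < sz := by omega
  have hD : 0 < D := by omega
  have h1 : ((r * D + y) * sz + β) / sz = r * D + y := by
    rw [add_comm, Nat.add_mul_div_right _ _ hsz, Nat.div_eq_of_lt hβ, zero_add]
  have h2 : (r * D + y) / D = r := by
    rw [add_comm, Nat.add_mul_div_right _ _ hD, Nat.div_eq_of_lt hy, zero_add]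
  have h3 : (r * D + y) % D = y := by
    rw [add_comm, Nat.add_mul_mod_self_right, Nat.mod_eq_of_lt hy]
  have h4 : ((r * D + y) * sz + β) % sz = β := by
    rw [add_comm, Nat.add_mul_mod_self_right, Nat.mod_eq_of_lt hβ]
  refine ⟨h4, by rw [h1, h3], by rw [mul_comm D, ← Nat.div_div_eq_div_mul, h1, h2], ?_⟩
  rw [mul_comm D sz, Nat.mod_mul, h4, h1, h3]
  ring

/-- The leading digits of the current value of `f`, before step `t` of the loop. -/
def valAt (sz D : ℕ) (f : ℕ → ℕ) (t : ℕ) : ℕ := f (t / sz % D) / 2 ^ (sz - t % sz)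

/-- The current count, before step `t` of the loop. -/
def countAt (sz D : ℕ) (act : Prop) [Decidable act] (f : ℕ → ℕ) (t : ℕ) : ℕ :=
  if act then countLE (t / sz % D) f (t / (D * sz)) else 0

/-- The current number of thresholds not exceeding `v`, before step `t` of the loop. -/
def resAt (sz D : ℕ) (thr : ℕ → ℕ) (v t : ℕ) : ℕ :=
  ((range (t / (D * sz))).filter fun r => thr r ≤ v).card

theorem countLE_succ (y : ℕ) (f : ℕ → ℕ) (r : ℕ) :
    countLE (y + 1) f r = countLE y f r + (1 - (f y - r)) := by
  unfold countLE
  rw [range_add_one, filter_insert]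
  split_ifs with h
  · rw [card_insert_of_notMem (by simp), Nat.sub_eq_zero_of_le h]
  · omega

theorem countLE_le (y : ℕ) (f : ℕ → ℕ) (r : ℕ) : countLE y f r ≤ y :=
  (card_filter_le _ _).trans (card_range y).le

theorem valAt_step {f : ℕ → ℕ} (hsz : 0 < sz) (t : ℕ) :
    2 * valAt sz D f t + ((f (t / sz % D)).testBit (sz - 1 - t % sz)).toNat =
      f (t / sz % D) / 2 ^ (sz - 1 - t % sz) := by
  have h := Nat.mod_lt t hsz
  unfold valAt
  rw [show sz - t % sz = (sz - 1 - t % sz) + 1 by omega, two_mul_div_add_testBit]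

/-- One step of the loop. -/
theorem loop_step {f thr : ℕ → ℕ} {w q v c₀ ρ : ℕ} (hsz : 0 < sz) (hD : 0 < D)
    (hf : ∀ y, f y < 2 ^ sz)
    (hthr : ∀ r, thr r = ((if q < w then countLE D f r else 0) + c₀) / ρ * ρ) (t : ℕ)
    {val₁ C₁ : ℕ} (hval : val₁ = f (t / sz % D) / 2 ^ (sz - 1 - t % sz))
    (hC : C₁ = countAt sz D (q < w) f t + (1 - (t + 1) % sz) * (1 - (val₁ - t / (D * sz))) *
      (1 - (1 - (w - q)))) :
    val₁ * (1 - (1 - (t + 1) % sz)) = valAt sz D f (t + 1) ∧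
    resAt sz D thr v t + (1 - (t + 1) % (D * sz)) * (1 - ((C₁ + c₀) / ρ * ρ - v)) =
      resAt sz D thr v (t + 1) ∧
    C₁ * (1 - (1 - (t + 1) % (D * sz))) = countAt sz D (q < w) f (t + 1) := by
  obtain ⟨r, y, β, hy, hβ, rfl⟩ : ∃ r y β, y < D ∧ β < sz ∧ t = (r * D + y) * sz + β := by
    refine ⟨t / sz / D, t / sz % D, t % sz, Nat.mod_lt _ hD, Nat.mod_lt _ hsz, ?_⟩
    rw [mul_comm (t / sz / D) D, Nat.div_add_mod, mul_comm, Nat.div_add_mod]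
  obtain ⟨e1, e2, e3, -⟩ := loop_index (r := r) hy hβ
  rw [e1, e2] at hval
  have hact : (1 - (1 - (w - q))) = if q < w then 1 else 0 := by split_ifs <;> omega
  rw [e3, hact, countAt, e2, e3] at hC
  rw [resAt, e3]
  by_cases h1 : β + 1 < sz
  · obtain ⟨f1, f2, f3, f4⟩ := loop_index (r := r) hy h1
    rw [add_assoc ((r * D + y) * sz), valAt, resAt, countAt, f1, f2, f3, f4]
    rw [add_assoc ((r * D + y) * sz), f1] at hC
    rw [Nat.sub_eq_zero_of_le (by omega : 1 ≤ β + 1)] at hC ⊢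
    rw [Nat.sub_eq_zero_of_le (by omega : 1 ≤ y * sz + (β + 1))]
    refine ⟨?_, by simp, ?_⟩
    · rw [hval, Nat.sub_zero, mul_one]
      congr 2
      omega
    · rw [hC]; simp
  · have hβ' : β = sz - 1 := by omega
    have hv' : val₁ = f y := by rw [hval, hβ']; simp
    have ht : (r * D + y) * sz + β + 1 = (r * D + (y + 1)) * sz + 0 := by
      rw [hβ', add_assoc, Nat.sub_add_cancel hsz]; ring
    have hzero : ∀ z, f z / 2 ^ sz = 0 := fun z => Nat.div_eq_of_lt (hf z)
    by_cases h2 : y + 1 < D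
    · obtain ⟨f1, f2, f3, f4⟩ := loop_index (r := r) h2 hsz
      rw [ht, valAt, resAt, countAt, f1, f2, f3, f4]
      rw [ht, f1] at hC
      have h3 : 1 ≤ (y + 1) * sz + 0 := by
        have := Nat.mul_le_mul_left (y + 1) hsz
        omega
      rw [Nat.sub_eq_zero_of_le h3]
      refine ⟨by simp [hzero], by simp, ?_⟩
      rw [hC, hv', countLE_succ]
      split_ifs <;> simp
    · have hy' : y + 1 = D := by omega
      have ht' : (r * D + (y + 1)) * sz + 0 = ((r + 1) * D + 0) * sz + 0 := by
        rw [hy']; ring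
      obtain ⟨f1, f2, f3, f4⟩ := loop_index (r := r + 1) hD hsz
      rw [ht, ht', valAt, resAt, countAt, f1, f2, f3, f4]
      rw [ht, ht', f1] at hC
      have hC' : C₁ = if q < w then countLE D f r else 0 := by
        rw [hC, hv', ← hy', countLE_succ]
        split_ifs <;> simp
      refine ⟨by simp [hzero], ?_, by simp [countLE]⟩
      rw [hC', ← hthr, range_add_one, filter_insert]
      split_ifs with h3
      · rw [card_insert_of_notMem (by simp), Nat.sub_eq_zero_of_le h3]
        simp
      · have : 1 - (thr r - v) = 0 := by omega
        simp [this]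

end

end SZ

namespace SZ

open Finset

/-! ### The stack -/

/-- The bounds required of the stack. -/
def StackOK (w d s u : ℕ) (st : List Frame) : Prop :=
  open scoped Classical in
  st.length ≤ u ∧ st.countP (fun f => decide (∃ j, f.pending = some j ∧ IsSeedPos w d s j)) ≤ 1

/-- There is no unresolved read of the seed. -/
def SeedFree (w d s : ℕ) (st : List Frame) : Prop :=
  ∀ f ∈ st, ∀ j, f.pending = some j → ¬ IsSeedPos w d s j

theorem SeedFree.stackOK {w d s u : ℕ} {st : List Frame} (h : SeedFree w d s st)
    (hu : st.length ≤ u) : StackOK w d s u st := by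
  classical
  refine ⟨hu, ?_⟩
  rw [List.countP_eq_zero.2]
  · exact zero_le_one
  · intro f hf
    simpa using fun j hj => h f hf j hj

theorem SeedFree.stackOK_cons {w d s u : ℕ} {st : List Frame} (h : SeedFree w d s st)
    (hu : st.length + 1 ≤ u) (f : Frame) : StackOK w d s u (f :: st) := by
  classical
  have h1 := (h.stackOK (u := u) (by omega)).2
  refine ⟨hu, ?_⟩
  have h2 : st.countP (fun f => decide (∃ j, f.pending = some j ∧ IsSeedPos w d s j)) = 0 := by
    rw [List.countP_eq_zero]
    intro f hf
    simpa using fun j hj => h f hf j hj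
  rw [List.countP_cons, h2]
  split_ifs <;> omega

theorem stackOK_nil (w d s u : ℕ) : StackOK w d s u [] :=
  SeedFree.stackOK (fun _ hf => absurd hf List.not_mem_nil) (Nat.zero_le _)

/-! ### Correctness of the main part -/

/-- Reading a number from the input. -/
theorem path_load {env : Env} {N : ℕ} {H : List Frame → Prop} {st : List Frame} {n : ℕ} {g : Gl}
    (hN : 1 < N) (hst : H st) (top : Bool) {X : ℕ} (hX : X < N) (c : ℕ) {l : Lo} (hc : l.t = c)
    (hin : ∀ i < c, env.input[l.cur + i]? = some (X.testBit i)) (hres : l.res = X / 2 ^ c)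
    (hl : ∀ r, regs g l r < N) :
    ∃ j, szMachine.Path env (Within N H) (cfg (.load top) g l st n)
      (cfg (if top then .unpack else .ret) g { l with t := 0, res := X, j := j } st n) := by
  induction c generalizing l with
  | zero =>
    refine ⟨l.j, ?_⟩
    have : { l with t := 0, res := X, j := l.j } = l := by
      obtain ⟨⟩ := l
      simp_all
    rw [this]
    exact step_branch rfl (fun r => rfl) (if_neg (not_not.2 hc)) hst hl trivial
  | succ c ih =>
    have ht1 : l.t - 1 = c := by omega
    have hcN : c < N := by have : l.t < N := hl .t; omega
    have p1 : szMachine.Path env (Within N H) (cfg (.load top) g l st n)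
        (cfg (.loadRead top) g l st n) :=
      step_branch rfl (fun r => rfl) (if_pos (by change l.t ≠ 0; omega)) hst hl trivial
    have p2 : szMachine.Path env (Within N H) (cfg (.loadRead top) g l st n)
        (cfg (.loadAdd top) g { l with t := c, j := (X.testBit c).toNat } st n) := by
      refine step_input (β := .loadRead top) (g' := g) (l' := { l with t := c }) rfl
        (fun r => ?_) (hin c (by omega)) (fun r => by cases r <;> rfl) hst hl ⟨?_, trivial⟩ hN
      · cases r <;> first | rfl | exact ht1
      · change l.t - 1 < N
        omega
    have hres' : 2 * l.res + (X.testBit c).toNat = X / 2 ^ c := by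
      rw [hres, two_mul_div_add_testBit]
    have b2 := (p1.trans p2).target ⟨hl, hst⟩
    have p3 : szMachine.Path env (Within N H)
        (cfg (.loadAdd top) g { l with t := c, j := (X.testBit c).toNat } st n)
        (cfg (.load top) g { l with t := c, j := (X.testBit c).toNat, res := X / 2 ^ c } st n) := by
      refine step_goTo rfl (fun r => ?_) hst b2.1 ⟨?_, trivial⟩
      · cases r <;> first | rfl | exact hres'
      · change 2 * l.res + (X.testBit c).toNat < N
        rw [hres']
        exact (Nat.div_le_self _ _).trans_lt hX
    obtain ⟨j, p4⟩ := ih (l := { l with t := c, j := (X.testBit c).toNat, res := X / 2 ^ c }) rfl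
      (fun i hi => hin i (by omega)) rfl (p3.target b2).1
    exact ⟨j, ((p1.trans p2).trans p3).trans p4⟩

/-- Shifting, and giving the query value. -/
theorem path_shift {env : Env} {N : ℕ} {H : List Frame → Prop} {st : List Frame} {n : ℕ} {g : Gl}
    {τ : Strategy} {h : List (Option Bool)} {i : ℕ} {x : Option Bool}
    (hst : H (⟨τ, h, some i⟩ :: st)) (hst' : H (⟨τ, x :: h, none⟩ :: st)) (c : ℕ) {l : Lo}
    (hc : l.e = c) (hx : queryValue (2 - l.cur / 2 ^ c + l.cur / 2 ^ c / 2 % 2) = x)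
    (hl : ∀ r, regs g l r < N) :
    szMachine.Path env (Within N H) (cfg .shift g l (⟨τ, h, some i⟩ :: st) n)
      (ocfg g { l with e := 0, cur := l.cur / 2 ^ c } (⟨τ, x :: h, none⟩ :: st) n) := by
  induction c generalizing l with
  | zero =>
    have : { l with e := 0, cur := l.cur / 2 ^ 0 } = l := by
      obtain ⟨⟩ := l
      simp_all
    rw [this]
    rw [pow_zero, Nat.div_one] at hx
    have p1 : szMachine.Path env (Within N H) (cfg .shift g l (⟨τ, h, some i⟩ :: st) n)
        (cfg .respond g l (⟨τ, h, some i⟩ :: st) n) :=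
      step_branch rfl (fun r => rfl) (if_neg (not_not.2 hc)) hst hl trivial
    exact p1.trans (step_respond hx hst hst' hl)
  | succ c ih =>
    have p1 : szMachine.Path env (Within N H) (cfg .shift g l (⟨τ, h, some i⟩ :: st) n)
        (cfg .shiftStep g l (⟨τ, h, some i⟩ :: st) n) :=
      step_branch rfl (fun r => rfl) (if_pos (by change l.e ≠ 0; omega)) hst hl trivial
    have hcur : l.cur < N := hl .cur
    have he : l.e < N := hl .e
    have p2 : szMachine.Path env (Within N H) (cfg .shiftStep g l (⟨τ, h, some i⟩ :: st) n)
        (cfg .shift g { l with cur := l.cur / 2, e := l.e - 1 } (⟨τ, h, some i⟩ :: st) n) := by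
      refine step_goTo rfl (fun r => by cases r <;> rfl) hst hl ⟨?_, ?_, trivial⟩
      · exact (Nat.div_le_self _ _).trans_lt hcur
      · exact (Nat.sub_le _ _).trans_lt he
    have hdiv : l.cur / 2 / 2 ^ c = l.cur / 2 ^ (c + 1) := by
      rw [Nat.div_div_eq_div_mul, pow_succ, mul_comm]
    have p3 := ih (l := { l with cur := l.cur / 2, e := l.e - 1 }) (by change l.e - 1 = c; omega)
      (by rw [hdiv]; exact hx) ((p1.trans p2).target ⟨hl, hst⟩).1
    rw [hdiv] at p3
    exact (p1.trans p2).trans p3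

/-- The constant registers in the main part. -/
def mainGl (w d s k u a b κ m₀ m i p : ℕ) : Gl where
  w := w
  d := d
  m₀ := m₀
  s := s
  m := m
  i := i
  p := p
  sz := Nat.size w
  D := 2 ^ d
  P := 2 ^ s
  W := 2 ^ Nat.size w
  K := 2 ^ k
  ρ := 2 ^ (d - k)
  η := 2 ^ (d - 2 * k)
  B := 2 ^ d * 2 ^ d
  T := (w + 1) * 2 ^ d * Nat.size w
  u := u
  a := a
  b := b
  κ := κ

/-- Relations between the parameters and the bound `N` for the registers. -/
structure Sizes (w d s k u N : ℕ) : Prop where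
  pos : 0 < w
  le_pow : (w + 1) * Nat.size w ≤ 2 ^ d
  size_lt : Nat.size w < d
  two_mul_le : 2 * k ≤ d
  stack_le : ((2 ^ d * 2 ^ d) ^ 7) ^ u ≤ N
  pow_le : 2 ^ (3 * d + s + 3) ≤ N

section

variable {w d s : ℕ} (Sim : SimFun w d s) (Q : FailAutomaton w d) (k u a b κ m₀ m i₀ p₀ N : ℕ)
  (env : Env)

/-- The evaluation of the automaton of level `i`. -/
def EvalSpec (i : ℕ) : Prop :=
  ∀ (l : Lo) (st : List Frame) (n : ℕ) (q : Fin (w + 1)), l.lvl = i → l.pow = 2 ^ (k * i) →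
    l.S < ((2 ^ d * 2 ^ d) ^ 7) ^ (u - i) → l.q = q → l.v < 2 ^ d →
    (∀ r, regs (mainGl w d s k u a b κ m₀ m i₀ p₀) l r < N) →
    SeedFree w d s st → st.length = u - i →
    ∃ (l' : Lo) (n' : ℕ), szMachine.Path env (Within N (StackOK w d s u))
        (cfg .eval (mainGl w d s k u a b κ m₀ m i₀ p₀) l st n)
        (cfg .ret (mainGl w d s k u a b κ m₀ m i₀ p₀) l' st n') ∧
      l'.lvl = i ∧ l'.pow = l.pow ∧ l'.S = l.S ∧
      l'.res = (level Sim k Q a b (digit k κ) i).next q (bitsFn d l.v)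

variable {Sim Q k u a b κ m₀ m i₀ p₀ N env}

theorem Sizes.one_lt (hs : Sizes w d s k u N) : 1 < N :=
  lt_of_lt_of_le (Nat.one_lt_two_pow (by omega)) hs.pow_le

theorem Sizes.size_pos (hs : Sizes w d s k u N) : 0 < Nat.size w := Nat.size_pos.2 hs.pos

theorem Sizes.lt_pow (hs : Sizes w d s k u N) : w < 2 ^ d :=
  (Nat.lt_size_self w).trans (Nat.pow_lt_pow_right (by norm_num) hs.size_lt)

theorem Sizes.pow_lt {c : ℕ} (hs : Sizes w d s k u N) (hc : c < 3 * d + s + 3) : 2 ^ c < N :=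
  (Nat.pow_lt_pow_right (by norm_num) hc).trans_le hs.pow_le

theorem evalSpec_zero (hs : Sizes w d s k u N)
    (hin : ∀ j < (w + 1) * 2 ^ d * Nat.size w, env.input[j]? = (encTable Q)[j]?) :
    EvalSpec Sim Q k u a b κ m₀ m i₀ p₀ N env 0 := by
  intro l st n q hlvl hpow hS hq hv hl hst hlen
  have hok : StackOK w d s u st := hst.stackOK (by omega)
  have p1 : szMachine.Path env (Within N (StackOK w d s u))
      (cfg .eval (mainGl w d s k u a b κ m₀ m i₀ p₀) l st n)
      (cfg .evalTable (mainGl w d s k u a b κ m₀ m i₀ p₀) l st n) :=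
    step_branch rfl (fun r => rfl) (if_neg (not_not.2 hlvl)) hok hl trivial
  have hqw : l.q ≤ w := by rw [hq]; exact Nat.lt_succ_iff.1 q.2
  have hbase : ∀ e < Nat.size w, (l.q * 2 ^ d + l.v) * Nat.size w + e <
      (w + 1) * 2 ^ d * Nat.size w := by
    intro e he
    calc (l.q * 2 ^ d + l.v) * Nat.size w + e < (l.q * 2 ^ d + l.v) * Nat.size w + Nat.size w := by
          omega
      _ = (l.q * 2 ^ d + (l.v + 1)) * Nat.size w := by ring
      _ ≤ (l.q * 2 ^ d + 2 ^ d) * Nat.size w := by gcongr; exact hv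
      _ = (l.q + 1) * 2 ^ d * Nat.size w := by ring
      _ ≤ (w + 1) * 2 ^ d * Nat.size w := by gcongr
  have hT : (w + 1) * 2 ^ d * Nat.size w < N := by
    calc (w + 1) * 2 ^ d * Nat.size w = (w + 1) * Nat.size w * 2 ^ d := by ring
      _ ≤ 2 ^ d * 2 ^ d := by gcongr; exact hs.le_pow
      _ = 2 ^ (d + d) := (pow_add _ _ _).symm
      _ < N := hs.pow_lt (by omega)
  have p2 : szMachine.Path env (Within N (StackOK w d s u))
      (cfg .evalTable (mainGl w d s k u a b κ m₀ m i₀ p₀) l st n)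
      (cfg (.load false) (mainGl w d s k u a b κ m₀ m i₀ p₀)
        { l with res := 0, t := Nat.size w, cur := (l.q * 2 ^ d + l.v) * Nat.size w } st n) := by
    refine step_goTo rfl (fun r => by cases r <;> rfl) hok hl ⟨?_, ?_, ?_, trivial⟩
    · exact lt_trans zero_lt_one hs.one_lt
    · exact (hl .sz :)
    · exact lt_of_le_of_lt (Nat.le_add_right _ 0) ((hbase 0 hs.size_pos).trans hT)
  have hX : ((Q.next q (bitsFn d l.v) : ℕ)) < 2 ^ Nat.size w :=
    lt_of_le_of_lt (Nat.lt_succ_iff.1 (Q.next q (bitsFn d l.v)).2) (Nat.lt_size_self w)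
  have hXN : ((Q.next q (bitsFn d l.v) : ℕ)) < N :=
    hX.trans (hs.pow_lt (by have := hs.size_lt; omega))
  obtain ⟨j, p3⟩ := path_load (env := env) (n := n) hs.one_lt hok false hXN (Nat.size w)
    (l := { l with res := 0, t := Nat.size w, cur := (l.q * 2 ^ d + l.v) * Nat.size w }) rfl
    (by
      intro e he
      change env.input[(l.q * 2 ^ d + l.v) * Nat.size w + e]? = _
      rw [hin _ (hbase e he), hq, getElem?_encTable Q q hv he])
    (Nat.div_eq_of_lt hX).symm ((p1.trans p2).target ⟨hl, hok⟩).1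
  exact ⟨_, n, (p1.trans p2).trans p3, hlvl, rfl, rfl, rfl⟩

end

end SZ

namespace SZ

open Finset

theorem mul_add_lt_mul {x X y B : ℕ} (hx : x < X) (hy : y < B) : x * B + y < X * B := by
  calc x * B + y < x * B + B := by omega
    _ = (x + 1) * B := by ring
    _ ≤ X * B := Nat.mul_le_mul_right _ hx

theorem mul_add_mod_of_lt' {x y B : ℕ} (hy : y < B) : (x * B + y) % B = y := by
  rw [add_comm, Nat.add_mul_mod_self_right, Nat.mod_eq_of_lt hy]

theorem mul_add_div_of_lt' {x y B : ℕ} (hy : y < B) : (x * B + y) / B = x := by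
  rw [add_comm, Nat.add_mul_div_right _ _ (by omega), Nat.div_eq_of_lt hy, zero_add]

section

variable {w d s : ℕ} {Sim : SimFun w d s} {Q : FailAutomaton w d} {k u a b κ m₀ m i₀ p₀ N : ℕ}
  {env : Env}

/-- The state of the registers in the loop at level `i + 1`. -/
structure InLoop (w d k u i : ℕ) (q : Fin (w + 1)) (l : Lo) : Prop where
  lvl : l.lvl = i + 1
  pow : l.pow = 2 ^ (k * (i + 1))
  stack : l.S < ((2 ^ d * 2 ^ d) ^ 7) ^ (u - (i + 1))
  q_eq : l.q = q
  v_lt : l.v < 2 ^ d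
  t_lt : l.t < w * 2 ^ d * Nat.size w
  val_le : l.val ≤ w
  C_le : l.C ≤ 2 ^ d
  res_le : l.res ≤ w

theorem Sizes.pow_lt_base (hs : Sizes w d s k u N) : 2 ^ d < 2 ^ d * 2 ^ d := by
  have : 2 ^ 1 ≤ 2 ^ d := Nat.pow_le_pow_right (by norm_num) (by have := hs.size_lt; omega)
  nlinarith

theorem Sizes.base_lt (hs : Sizes w d s k u N) : 2 ^ d * 2 ^ d < N := by
  rw [← pow_add]
  exact hs.pow_lt (by omega)

theorem Sizes.table_le (hs : Sizes w d s k u N) :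
    (w + 1) * 2 ^ d * Nat.size w ≤ 2 ^ d * 2 ^ d := by
  calc (w + 1) * 2 ^ d * Nat.size w = (w + 1) * Nat.size w * 2 ^ d := by ring
    _ ≤ 2 ^ d * 2 ^ d := by gcongr; exact hs.le_pow

theorem Sizes.guard_lt (hs : Sizes w d s k u N) {x : ℕ} (hx : x < 2 ^ (d + s)) :
    2 * (x + 2 ^ d * 2 ^ s) + 1 < N := by
  have h1 : 2 ^ (d + s + 2) < N := hs.pow_lt (by omega)
  rw [← pow_add]
  have : 2 ^ (d + s + 2) = 4 * 2 ^ (d + s) := by rw [pow_add]; ring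
  omega

/-- Answering a read of the table by an evaluation at the level below. -/
theorem path_readTable (hs : Sizes w d s k u N) {i : ℕ} (hi : i < u)
    (hE : EvalSpec Sim Q k u a b κ m₀ m i₀ p₀ N env i) {q : Fin (w + 1)} {l : Lo}
    {st : List Frame} {n : ℕ} {τ : Strategy} {h : List (Option Bool)}
    (hL : InLoop w d k u i q l) (hst : SeedFree w d s st) (hlen : st.length = u - (i + 1))
    (hl : ∀ r, regs (mainGl w d s k u a b κ m₀ m i₀ p₀) l r < N)
    (hj : l.j < (w + 1) * 2 ^ d * Nat.size w) {x : Option Bool}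
    (hx : (encTable (level Sim k Q a b (digit k κ) i))[l.j]? = x) :
    ∃ j e cur n', szMachine.Path env (Within N (StackOK w d s u))
      (cfg .readTable (mainGl w d s k u a b κ m₀ m i₀ p₀) l (⟨τ, h, some l.j⟩ :: st) n)
      (ocfg (mainGl w d s k u a b κ m₀ m i₀ p₀) { l with j := j, e := e, cur := cur }
        (⟨τ, x :: h, none⟩ :: st) n') := by
  have hok : ∀ f, StackOK w d s u (f :: st) := hst.stackOK_cons (by omega)
  have hsz := hs.size_pos
  have hbase := hs.pow_lt_base
  have hlow := hs.lt_pow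
  have hszd : Nat.size w < 2 ^ d := hs.size_lt.trans Nat.lt_two_pow_self
  have hT := hs.table_le
  set B := 2 ^ d * 2 ^ d with hB
  have he : l.j % Nat.size w < B := ((Nat.mod_lt _ hsz).trans hszd).trans hbase
  have hres : l.res < B := by have := hL.res_le; omega
  have hC : l.C < B := by have := hL.C_le; omega
  have hval : l.val < B := by have := hL.val_le; omega
  have ht : l.t < B := by
    refine hL.t_lt.trans_le (le_trans ?_ hT)
    gcongr
    omega
  have hv : l.v < B := by have := hL.v_lt; omega
  have hq : l.q < B := by have := hL.q_eq; have := q.2; omega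
  set S' := (((((((l.S * B + l.q) * B + l.v) * B + l.t) * B + l.val) * B + l.C) * B + l.res) * B) +
    l.j % Nat.size w with hS'
  have hS'lt : S' < (B ^ 7) ^ (u - i) := by
    have : S' < (B ^ 7) ^ (u - (i + 1)) * B * B * B * B * B * B * B :=
      mul_add_lt_mul (mul_add_lt_mul (mul_add_lt_mul (mul_add_lt_mul (mul_add_lt_mul
        (mul_add_lt_mul (mul_add_lt_mul hL.stack hq) hv) ht) hval) hC) hres) he
    calc S' < _ := this
      _ = (B ^ 7) ^ (u - (i + 1) + 1) := by rw [pow_succ]; ring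
      _ = (B ^ 7) ^ (u - i) := by congr 1; omega
  have hS'N : S' < N := by
    refine hS'lt.trans_le (le_trans ?_ hs.stack_le)
    exact Nat.pow_le_pow_right (by positivity) (by omega)
  have hq' : l.j / Nat.size w / 2 ^ d < w + 1 := by
    rw [Nat.div_lt_iff_lt_mul (by positivity), Nat.div_lt_iff_lt_mul hsz]
    exact hj
  have hv' : l.j / Nat.size w % 2 ^ d < 2 ^ d := Nat.mod_lt _ (by positivity)
  have hlvl : l.lvl - 1 = i := by rw [hL.lvl]; rfl
  have hpow : l.pow / 2 ^ k = 2 ^ (k * i) := by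
    rw [hL.pow, Nat.mul_succ, pow_add, Nat.mul_div_cancel _ (by positivity)]
  have hbN := hs.base_lt
  have p1 : szMachine.Path env (Within N (StackOK w d s u))
      (cfg .readTable (mainGl w d s k u a b κ m₀ m i₀ p₀) l (⟨τ, h, some l.j⟩ :: st) n)
      (cfg .eval (mainGl w d s k u a b κ m₀ m i₀ p₀)
        { l with
          S := S'
          v := l.j / Nat.size w % 2 ^ d
          q := l.j / Nat.size w / 2 ^ d
          lvl := i
          pow := 2 ^ (k * i) } (⟨τ, h, some l.j⟩ :: st) n) := by
    refine step_goTo rfl (fun r => ?_) (hok _) hl ⟨hS'N, ?_, ?_, ?_, ?_, trivial⟩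
    · cases r <;> first | rfl | exact hlvl | exact hpow
    · exact lt_trans hv' (lt_trans hbase hbN)
    · exact lt_of_lt_of_le hq' (by omega)
    · exact (Nat.sub_le _ _).trans_lt (hl .lvl)
    · exact (Nat.div_le_self _ _).trans_lt (hl .pow)
  obtain ⟨l₂, n₂, p2, h2lvl, h2pow, h2S, h2res⟩ := hE _ (⟨τ, h, some l.j⟩ :: st) n
    ⟨l.j / Nat.size w / 2 ^ d, hq'⟩ rfl rfl hS'lt rfl hv' (p1.target ⟨hl, hok _⟩).1
    (by
      intro f hf j' hj'
      rcases List.mem_cons.1 hf with rfl | hf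
      · cases hj'
        rintro ⟨h1, -⟩
        omega
      · exact hst f hf j' hj')
    (by rw [List.length_cons, hlen]; omega)
  change l₂.S = S' at h2S
  change l₂.pow = 2 ^ (k * i) at h2pow
  have hl₂ := ((p1.trans p2).target ⟨hl, hok _⟩).1
  have p3 : szMachine.Path env (Within N (StackOK w d s u))
      (cfg .ret (mainGl w d s k u a b κ m₀ m i₀ p₀) l₂ (⟨τ, h, some l.j⟩ :: st) n₂)
      (cfg .pop (mainGl w d s k u a b κ m₀ m i₀ p₀) l₂ (⟨τ, h, some l.j⟩ :: st) n₂) :=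
    step_branch rfl (fun r => rfl) (if_pos (by change u - l₂.lvl ≠ 0; omega)) (hok _) hl₂ trivial
  have h2le : l₂.res < 2 ^ (d + s) := by
    rw [h2res]
    refine lt_of_lt_of_le (Fin.is_lt _) ?_
    refine le_trans ?_ (Nat.pow_le_pow_right (by norm_num) (by omega : d ≤ d + s))
    omega
  have e1 : l₂.S % B = l.j % Nat.size w := by
    simp only [h2S, hS', mul_add_mod_of_lt' he]
  have e2 : l₂.S / B % B = l.res := by
    simp only [h2S, hS', mul_add_div_of_lt' he, mul_add_mod_of_lt' hres]
  have e3 : l₂.S / B / B % B = l.C := by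
    simp only [h2S, hS', mul_add_div_of_lt' he, mul_add_div_of_lt' hres, mul_add_mod_of_lt' hC]
  have e4 : l₂.S / B / B / B % B = l.val := by
    simp only [h2S, hS', mul_add_div_of_lt' he, mul_add_div_of_lt' hres, mul_add_div_of_lt' hC,
      mul_add_mod_of_lt' hval]
  have e5 : l₂.S / B / B / B / B % B = l.t := by
    simp only [h2S, hS', mul_add_div_of_lt' he, mul_add_div_of_lt' hres, mul_add_div_of_lt' hC,
      mul_add_div_of_lt' hval, mul_add_mod_of_lt' ht]
  have e6 : l₂.S / B / B / B / B / B % B = l.v := by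
    simp only [h2S, hS', mul_add_div_of_lt' he, mul_add_div_of_lt' hres, mul_add_div_of_lt' hC,
      mul_add_div_of_lt' hval, mul_add_div_of_lt' ht, mul_add_mod_of_lt' hv]
  have e7 : l₂.S / B / B / B / B / B / B % B = l.q := by
    simp only [h2S, hS', mul_add_div_of_lt' he, mul_add_div_of_lt' hres, mul_add_div_of_lt' hC,
      mul_add_div_of_lt' hval, mul_add_div_of_lt' ht, mul_add_div_of_lt' hv, mul_add_mod_of_lt' hq]
  have d7 : l₂.S / B / B / B / B / B / B / B = l.S := by
    simp only [h2S, hS', mul_add_div_of_lt' he, mul_add_div_of_lt' hres, mul_add_div_of_lt' hC,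
      mul_add_div_of_lt' hval, mul_add_div_of_lt' ht, mul_add_div_of_lt' hv, mul_add_div_of_lt' hq]
  have hlvl2 : l₂.lvl + 1 = l.lvl := by rw [h2lvl, hL.lvl]
  have hpow2 : l₂.pow * 2 ^ k = l.pow := by
    rw [h2pow, hL.pow, Nat.mul_succ, pow_add]
  have p4 : szMachine.Path env (Within N (StackOK w d s u))
      (cfg .pop (mainGl w d s k u a b κ m₀ m i₀ p₀) l₂ (⟨τ, h, some l.j⟩ :: st) n₂)
      (cfg .shift (mainGl w d s k u a b κ m₀ m i₀ p₀)
        { l with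
          j := l₂.j
          e := l.j % Nat.size w
          cur := 2 * (l₂.res + 2 ^ d * 2 ^ s) + 1 } (⟨τ, h, some l.j⟩ :: st) n₂) := by
    have hmod : ∀ x, x % B < N := fun x => (Nat.mod_lt _ (by positivity)).trans hbN
    have hdiv : ∀ {x}, x < N → x / B < N := fun hx => (Nat.div_le_self _ _).trans_lt hx
    have hS2 : l₂.S < N := hl₂ .S
    refine step_goTo rfl (fun r => ?_) (hok _) hl₂ ⟨?_, hmod _, hdiv hS2, hmod _, hdiv (hdiv hS2),
      hmod _, hdiv (hdiv (hdiv hS2)), hmod _, hdiv (hdiv (hdiv (hdiv hS2))),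
      hmod _, hdiv (hdiv (hdiv (hdiv (hdiv hS2)))), hmod _,
      hdiv (hdiv (hdiv (hdiv (hdiv (hdiv hS2))))), hmod _,
      hdiv (hdiv (hdiv (hdiv (hdiv (hdiv (hdiv hS2)))))), ?_, ?_, trivial⟩
    · cases r
      case e => exact e1
      case res => exact e2
      case C => exact e3
      case val => exact e4
      case t => exact e5
      case v => exact e6
      case q => exact e7
      case S => exact d7
      case lvl => exact hlvl2
      case pow => exact hpow2
      all_goals rfl
    · exact hs.guard_lt h2le
    · exact lt_of_eq_of_lt hlvl2 (hl .lvl)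
    · exact lt_of_eq_of_lt hpow2 (hl .pow)
  have hxq : queryValue (2 - (2 * (l₂.res + 2 ^ d * 2 ^ s) + 1) / 2 ^ (l.j % Nat.size w) +
      (2 * (l₂.res + 2 ^ d * 2 ^ s) + 1) / 2 ^ (l.j % Nat.size w) / 2 % 2) = x := by
    rw [← pow_add, queryValue_guarded h2le
      ((Nat.mod_lt _ hsz).trans (hs.size_lt.trans_le (by omega))), ← hx, h2res]
    have := getElem?_encTable (level Sim k Q a b (digit k κ) i) ⟨_, hq'⟩ hv' (Nat.mod_lt l.j hsz)
    rw [← this]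
    congr 1
    dsimp only
    rw [mul_comm (l.j / Nat.size w / 2 ^ d), Nat.div_add_mod, mul_comm, Nat.div_add_mod]
  have hp := ((p1.trans p2).trans p3).trans p4
  have p5 := path_shift (env := env) (n := n₂) (τ := τ) (h := h) (i := l.j) (hok _) (hok _)
    (l.j % Nat.size w)
    (l := { l with
          j := l₂.j
          e := l.j % Nat.size w
          cur := 2 * (l₂.res + 2 ^ d * 2 ^ s) + 1 }) rfl hxq (hp.target ⟨hl, hok _⟩).1
  exact ⟨_, _, _, _, hp.trans p5⟩

/-- Answering a read. -/
theorem path_read (hs : Sizes w d s k u N) {i : ℕ} (hi : i < u)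
    (hE : EvalSpec Sim Q k u a b κ m₀ m i₀ p₀ N env i) {q : Fin (w + 1)} {l : Lo}
    {st : List Frame} {n : ℕ} {τ : Strategy} {h : List (Option Bool)}
    (hL : InLoop w d k u i q l) (hst : SeedFree w d s st) (hlen : st.length = u - (i + 1))
    (hl : ∀ r, regs (mainGl w d s k u a b κ m₀ m i₀ p₀) l r < N) :
    ∃ j e cur n', szMachine.Path env (Within N (StackOK w d s u))
      (cfg .read (mainGl w d s k u a b κ m₀ m i₀ p₀) l (⟨τ, h, some l.j⟩ :: st) n)
      (ocfg (mainGl w d s k u a b κ m₀ m i₀ p₀) { l with j := j, e := e, cur := cur }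
        (⟨τ, (encQuery (level Sim k Q a b (digit k κ) i) q
          (bitsFn s (hash d s a b (l.t / Nat.size w % 2 ^ d))) (Nat.size w - 1 - l.t % Nat.size w)
          true)[l.j]? :: h, none⟩ :: st) n') := by
  have hok : ∀ f, StackOK w d s u (f :: st) := hst.stackOK_cons (by omega)
  have hsz := hs.size_pos
  have hjN : l.j < N := hl .j
  set Q' := level Sim k Q a b (digit k κ) i
  set y := l.t / Nat.size w % 2 ^ d with hy
  by_cases hj : l.j < (w + 1) * 2 ^ d * Nat.size w
  · rw [getElem?_encQuery_of_lt _ _ _ _ (by omega), getElem?_encInput_of_lt _ _ _ hj]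
    obtain ⟨j, e, cur, n', p⟩ := path_readTable (n := n) (τ := τ) (h := h) hs hi hE hL hst hlen hl
      hj rfl
    refine ⟨j, e, cur, n', Machine.Path.trans ?_ p⟩
    exact step_branch rfl (fun r => rfl)
      (if_pos (by change (w + 1) * 2 ^ d * Nat.size w - l.j ≠ 0; omega)) (hok _) hl trivial
  · obtain ⟨e, he⟩ := Nat.exists_eq_add_of_le (not_lt.1 hj)
    have hsub : l.j - (w + 1) * 2 ^ d * Nat.size w = e := by omega
    have p1 : szMachine.Path env (Within N (StackOK w d s u))
        (cfg .read (mainGl w d s k u a b κ m₀ m i₀ p₀) l (⟨τ, h, some l.j⟩ :: st) n)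
        (cfg .readRest (mainGl w d s k u a b κ m₀ m i₀ p₀) l (⟨τ, h, some l.j⟩ :: st) n) :=
      step_branch rfl (fun r => rfl)
        (if_neg (not_not.2 (by change (w + 1) * 2 ^ d * Nat.size w - l.j = 0; omega)))
        (hok _) hl trivial
    have b2 : ExecBounded N (regs (mainGl w d s k u a b κ m₀ m i₀ p₀) l) (szBody .readRest) :=
      ⟨(Nat.sub_le _ _).trans_lt hjN, trivial⟩
    by_cases hes : e < Nat.size w + s
    · have p2 : szMachine.Path env (Within N (StackOK w d s u))
          (cfg .readRest (mainGl w d s k u a b κ m₀ m i₀ p₀) l (⟨τ, h, some l.j⟩ :: st) n)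
          (cfg .readState (mainGl w d s k u a b κ m₀ m i₀ p₀) { l with e := e }
            (⟨τ, h, some l.j⟩ :: st) n) := by
        refine step_branch rfl (fun r => ?_)
          (if_pos (by change Nat.size w + s - e ≠ 0; omega)) (hok _) hl b2
        cases r <;> first | rfl | exact hsub
      have hlt : 2 ^ Nat.size w * hash d s a b y + l.q < 2 ^ (d + s) := by
        have h1 : l.q < 2 ^ Nat.size w := by
          rw [hL.q_eq]
          exact lt_of_le_of_lt (Nat.lt_succ_iff.1 q.2) (Nat.lt_size_self w)
        have h2 := mul_add_lt_mul (hash_lt d s a b y) h1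
        rw [← pow_add] at h2
        rw [mul_comm]
        refine h2.trans_le (Nat.pow_le_pow_right (by norm_num) ?_)
        have := hs.size_lt
        omega
      have p3 : szMachine.Path env (Within N (StackOK w d s u))
          (cfg .readState (mainGl w d s k u a b κ m₀ m i₀ p₀) { l with e := e }
            (⟨τ, h, some l.j⟩ :: st) n)
          (cfg .shift (mainGl w d s k u a b κ m₀ m i₀ p₀)
            { l with
              e := e
              cur := 2 * (2 ^ Nat.size w * hash d s a b y + l.q + 2 ^ d * 2 ^ s) + 1 }
            (⟨τ, h, some l.j⟩ :: st) n) :=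
        step_goTo rfl (fun r => by cases r <;> rfl) (hok _) ((p1.trans p2).target ⟨hl, hok _⟩).1
          ⟨hs.guard_lt hlt, trivial⟩
      have hp := (p1.trans p2).trans p3
      refine ⟨_, _, _, _, hp.trans (path_shift (l := { l with
              e := e
              cur := 2 * (2 ^ Nat.size w * hash d s a b y + l.q + 2 ^ d * 2 ^ s) + 1 })
        (hok _) (hok _) e rfl ?_ (hp.target ⟨hl, hok _⟩).1)⟩
      change queryValue (2 - (2 * (2 ^ Nat.size w * hash d s a b y + l.q + 2 ^ d * 2 ^ s) + 1) /
        2 ^ e + (2 * (2 ^ Nat.size w * hash d s a b y + l.q + 2 ^ d * 2 ^ s) + 1) /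
        2 ^ e / 2 % 2) = _
      rw [← pow_add, queryValue_guarded hlt (by have := hs.size_lt; omega), he,
        getElem?_encQuery_of_lt _ _ _ _ (by omega), getElem?_encInput_add _ _ _ rfl hes, hL.q_eq]
    · obtain ⟨f, hf⟩ := Nat.exists_eq_add_of_le (not_lt.1 hes)
      have hsub' : e - (Nat.size w + s) = f := by omega
      have p2 : szMachine.Path env (Within N (StackOK w d s u))
          (cfg .readRest (mainGl w d s k u a b κ m₀ m i₀ p₀) l (⟨τ, h, some l.j⟩ :: st) n)
          (cfg .readIndex (mainGl w d s k u a b κ m₀ m i₀ p₀) { l with e := e }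
            (⟨τ, h, some l.j⟩ :: st) n) := by
        refine step_branch rfl (fun r => ?_)
          (if_neg (not_not.2 (by change Nat.size w + s - e = 0; omega))) (hok _) hl b2
        cases r <;> first | rfl | exact hsub
      have p3 : szMachine.Path env (Within N (StackOK w d s u))
          (cfg .readIndex (mainGl w d s k u a b κ m₀ m i₀ p₀) { l with e := e }
            (⟨τ, h, some l.j⟩ :: st) n)
          (cfg .shift (mainGl w d s k u a b κ m₀ m i₀ p₀)
            { l with
              e := f
              cur := 2 * (Nat.size w - 1 - l.t % Nat.size w) + 1 }
            (⟨τ, h, some l.j⟩ :: st) n) := by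
        refine step_goTo rfl (fun r => ?_) (hok _) ((p1.trans p2).target ⟨hl, hok _⟩).1
          ⟨?_, ?_, trivial⟩
        · cases r <;> first | rfl | exact hsub'
        · exact (Nat.sub_le _ _).trans_lt (lt_of_le_of_lt (by omega : e ≤ l.j) hjN)
        · change 2 * (Nat.size w - 1 - l.t % Nat.size w) + 1 < N
          have h1 : 2 ^ (d + 1) < N := hs.pow_lt (by omega)
          have h2 : d < 2 ^ d := Nat.lt_two_pow_self
          have := hs.size_lt
          rw [pow_succ] at h1
          omega
      have hp := (p1.trans p2).trans p3
      refine ⟨_, _, _, _, hp.trans (path_shift (l := { l with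
              e := f
              cur := 2 * (Nat.size w - 1 - l.t % Nat.size w) + 1 })
        (hok _) (hok _) f rfl ?_ (hp.target ⟨hl, hok _⟩).1)⟩
      change queryValue (2 - (2 * (Nat.size w - 1 - l.t % Nat.size w) + 1) / 2 ^ f +
        (2 * (Nat.size w - 1 - l.t % Nat.size w) + 1) / 2 ^ f / 2 % 2) = _
      rw [queryValue_bits, he, hf, ← add_assoc, ← add_assoc, getElem?_encQuery_add]

/-- A whole invocation of the oracle. -/
theorem path_oracle (hs : Sizes w d s k u N) {i : ℕ} (hi : i < u)
    (hE : EvalSpec Sim Q k u a b κ m₀ m i₀ p₀ N env i) {q : Fin (w + 1)} {l : Lo}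
    {st : List Frame} {τ : Strategy}
    (hL : InLoop w d k u i q l) (hst : SeedFree w d s st) (hlen : st.length = u - (i + 1))
    {h : List (Option Bool)} {c : Bool}
    (hr : τ.RunsTo (encQuery (level Sim k Q a b (digit k κ) i) q
      (bitsFn s (hash d s a b (l.t / Nat.size w % 2 ^ d))) (Nat.size w - 1 - l.t % Nat.size w)
      true) h c) (j e cur n : ℕ)
    (hl : ∀ r, regs (mainGl w d s k u a b κ m₀ m i₀ p₀) { l with j := j, e := e, cur := cur } r <
      N) :
    ∃ e' cur' n', szMachine.Path env (Within N (StackOK w d s u))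
      (ocfg (mainGl w d s k u a b κ m₀ m i₀ p₀) { l with j := j, e := e, cur := cur }
        (⟨τ, h, none⟩ :: st) n)
      (cfg .answer (mainGl w d s k u a b κ m₀ m i₀ p₀)
        { l with j := c.toNat, e := e', cur := cur' } st n') := by
  have hok : ∀ f, StackOK w d s u (f :: st) := hst.stackOK_cons (by omega)
  induction hr generalizing j e cur n with
  | answer ha =>
    exact ⟨_, _, _, step_oracle_answer ha (hst.stackOK (by omega)) hl hs.one_lt⟩
  | @read h j' c ha hj' _ ih =>
    have hjN : j' < N := by
      refine lt_of_le_of_lt hj' ?_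
      rw [length_encQuery]
      have h1 := hs.table_le
      have h2 := hs.size_lt
      have h3 : d < 2 ^ d := Nat.lt_two_pow_self
      have h4 : s < 2 ^ s := Nat.lt_two_pow_self
      have h5 : Nat.size (Nat.size w - 1 - l.t % Nat.size w) ≤ Nat.size w :=
        (Nat.size_le_size ((Nat.sub_le _ _).trans (Nat.sub_le _ _))).trans
          (Nat.size_le.2 Nat.lt_two_pow_self)
      have h6 : 2 ^ (2 * d + s + 2) < N := hs.pow_lt (by omega)
      have h7 : 2 ^ (2 * d + s + 2) = 4 * (2 ^ d * 2 ^ d * 2 ^ s) := by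
        rw [pow_add, pow_add, two_mul, pow_add]; ring
      have h8 : 0 < 2 ^ s := by positivity
      have h9 : 2 ^ d * 2 ^ d ≤ 2 ^ d * 2 ^ d * 2 ^ s := Nat.le_mul_of_pos_right _ h8
      have h10 : 2 ^ s ≤ 2 ^ d * 2 ^ d * 2 ^ s := Nat.le_mul_of_pos_left _ (by positivity)
      have h11 := hs.pow_lt_base
      omega
    have p1 : szMachine.Path env (Within N (StackOK w d s u))
        (ocfg (mainGl w d s k u a b κ m₀ m i₀ p₀) { l with j := j, e := e, cur := cur }
          (⟨τ, h, none⟩ :: st) n)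
        (cfg .read (mainGl w d s k u a b κ m₀ m i₀ p₀) { l with j := j', e := e, cur := cur }
          (⟨τ, h, some j'⟩ :: st) n) :=
      step_oracle_read ha (hok _) hl hjN
    obtain ⟨j₂, e₂, cur₂, n₂, p2⟩ := path_read (n := n) (τ := τ) (h := h) hs hi hE
      (l := { l with j := j', e := e, cur := cur }) (q := q)
      ⟨hL.lvl, hL.pow, hL.stack, hL.q_eq, hL.v_lt, hL.t_lt, hL.val_le, hL.C_le, hL.res_le⟩
      hst hlen (p1.target ⟨hl, hok _⟩).1
    obtain ⟨e₃, cur₃, n₃, p3⟩ := ih j₂ e₂ cur₂ n₂ ((p1.trans p2).target ⟨hl, hok _⟩).1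
    exact ⟨e₃, cur₃, n₃, (p1.trans p2).trans p3⟩

end

end SZ

namespace SZ

open Finset

section

variable {w d s : ℕ} (Sim : SimFun w d s) (Q : FailAutomaton w d) (k a b κ i : ℕ)
  (q : Fin (w + 1))

/-- The state simulated in round `i` with the seed that the hash function gives for `y`. -/
noncomputable def hashedState (y : ℕ) : ℕ :=
  Sim (level Sim k Q a b (digit k κ) i) q (bitsFn s (hash d s a b y))

/-- The thresholds of round `i`. -/
noncomputable def threshold (r : ℕ) : ℕ :=
  ((if (q : ℕ) < w then countLE (2 ^ d) (hashedState Sim Q k a b κ i q) r else 0) +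
    digit k κ i * 2 ^ (d - 2 * k)) / 2 ^ (d - k) * 2 ^ (d - k)

theorem hashedState_le (y : ℕ) : hashedState Sim Q k a b κ i q y ≤ w :=
  Nat.lt_succ_iff.1 (Fin.is_lt _)

variable {Sim Q k a b κ i q}

theorem level_succ_next (hk : 2 * k ≤ d) {v : ℕ} (hv : v < 2 ^ d) :
    ((level Sim k Q a b (digit k κ) (i + 1)).next q (bitsFn d v) : ℕ) =
      ((range w).filter fun r => threshold Sim Q k a b κ i q r ≤ v).card := by
  by_cases hq : q = Fin.last w
  · have h0 : ∀ r, threshold Sim Q k a b κ i q r = 0 := by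
      intro r
      have hlt : digit k κ i * 2 ^ (d - 2 * k) < 2 ^ (d - k) := by
        rw [show d - k = k + (d - 2 * k) by omega, pow_add]
        exact Nat.mul_lt_mul_of_pos_right (digit_lt _ _ _) (by positivity)
      rw [threshold, if_neg (by simp [hq]), zero_add, Nat.div_eq_of_lt hlt, zero_mul]
    rw [hq, FailAutomaton.next_last]
    subst hq
    simp [h0]
  · have hlt : (q : ℕ) < w := lt_of_le_of_ne (Nat.lt_succ_iff.1 q.2) fun h => hq (Fin.ext h)
    simp only [level, thresholdAutomaton, if_neg hq, ofBits_bitsFn hv, snap_natCast, threshold,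
      if_pos hlt]
    rfl

theorem resAt_le {sz D : ℕ} (thr : ℕ → ℕ) (v : ℕ) {t w : ℕ} (ht : t ≤ w * D * sz) :
    resAt sz D thr v t ≤ w := by
  refine ((card_filter_le _ _).trans (card_range _).le).trans ?_
  rw [mul_assoc] at ht
  exact Nat.div_le_of_le_mul (by rwa [mul_comm])

variable {u m₀ m i₀ p₀ N : ℕ} {env : Env}

theorem path_loop (hs : Sizes w d s k u N) (hi : i < u)
    (hE : EvalSpec Sim Q k u a b κ m₀ m i₀ p₀ N env i) (hσ : IsOracleFor Sim env.oracle)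
    {st : List Frame} (hst : SeedFree w d s st) (hlen : st.length = u - (i + 1)) {v S : ℕ}
    (hv : v < 2 ^ d) (hS : S < ((2 ^ d * 2 ^ d) ^ 7) ^ (u - (i + 1))) (c t : ℕ)
    (htc : t + c = w * 2 ^ d * Nat.size w) {l : Lo} (n : ℕ)
    (h1 : l.lvl = i + 1) (h2 : l.pow = 2 ^ (k * (i + 1))) (h3 : l.S = S) (h4 : l.q = q)
    (h5 : l.v = v) (h6 : l.t = t)
    (h7 : l.val = valAt (Nat.size w) (2 ^ d) (hashedState Sim Q k a b κ i q) t)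
    (h8 : l.C = countAt (Nat.size w) (2 ^ d) ((q : ℕ) < w) (hashedState Sim Q k a b κ i q) t)
    (h9 : l.res = resAt (Nat.size w) (2 ^ d) (threshold Sim Q k a b κ i q) v t)
    (hl : ∀ r, regs (mainGl w d s k u a b κ m₀ m i₀ p₀) l r < N) :
    ∃ (l' : Lo) (n' : ℕ), szMachine.Path env (Within N (StackOK w d s u))
        (cfg .loop (mainGl w d s k u a b κ m₀ m i₀ p₀) l st n)
        (cfg .ret (mainGl w d s k u a b κ m₀ m i₀ p₀) l' st n') ∧
      l'.lvl = i + 1 ∧ l'.pow = l.pow ∧ l'.S = S ∧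
      l'.res = resAt (Nat.size w) (2 ^ d) (threshold Sim Q k a b κ i q) v
        (w * 2 ^ d * Nat.size w) := by
  have hok : StackOK w d s u st := hst.stackOK (by omega)
  have hok' : ∀ f, StackOK w d s u (f :: st) := hst.stackOK_cons (by omega)
  have hsz := hs.size_pos
  induction c generalizing t l n with
  | zero =>
    have ht : t = w * 2 ^ d * Nat.size w := by omega
    refine ⟨l, n, ?_, h1, rfl, h3, by rw [h9, ht]⟩
    exact step_branch rfl (fun r => rfl)
      (if_neg (not_not.2 (by change w * 2 ^ d * Nat.size w - l.t = 0; omega))) hok hl trivial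
  | succ c ih =>
    have hfw := hashedState_le Sim Q k a b κ i q
    have hvalw : ∀ y e, hashedState Sim Q k a b κ i q y / 2 ^ e ≤ w := fun y e =>
      (Nat.div_le_self _ _).trans (hfw y)
    have hcount : countAt (Nat.size w) (2 ^ d) ((q : ℕ) < w) (hashedState Sim Q k a b κ i q) t ≤
        2 ^ d := by
      unfold countAt
      split_ifs
      · exact (countLE_le _ _ _).trans (Nat.mod_lt _ (by positivity)).le
      · exact Nat.zero_le _
    have hL : InLoop w d k u i q l :=
      ⟨h1, h2, by rw [h3]; exact hS, h4, by rw [h5]; exact hv, by omega,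
        by rw [h7]; exact hvalw _ _,
        by rw [h8]; exact hcount, by rw [h9]; exact resAt_le _ _ (by omega)⟩
    have p1 : szMachine.Path env (Within N (StackOK w d s u))
        (cfg .loop (mainGl w d s k u a b κ m₀ m i₀ p₀) l st n)
        (cfg .invoke (mainGl w d s k u a b κ m₀ m i₀ p₀) l st n) :=
      step_branch rfl (fun r => rfl)
        (if_pos (by change w * 2 ^ d * Nat.size w - l.t ≠ 0; omega)) hok hl trivial
    have p2 : szMachine.Path env (Within N (StackOK w d s u))
        (cfg .invoke (mainGl w d s k u a b κ m₀ m i₀ p₀) l st n)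
        (ocfg (mainGl w d s k u a b κ m₀ m i₀ p₀) l (⟨env.oracle n, [], none⟩ :: st) (n + 1)) :=
      step_invoke hok (hok' _) hl
    have hr := hσ n (level Sim k Q a b (digit k κ) i) q
      (bitsFn s (hash d s a b (l.t / Nat.size w % 2 ^ d))) (Nat.size w - 1 - l.t % Nat.size w) true
    rw [queryAnswer_true _ _ _ _ (by omega)] at hr
    obtain ⟨e', cur', n', p3⟩ := path_oracle hs hi hE hL hst hlen hr l.j l.e l.cur (n + 1) hl
    set x : ℕ := (Nat.testBit (Sim (level Sim k Q a b (digit k κ) i) q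
      (bitsFn s (hash d s a b (l.t / Nat.size w % 2 ^ d))))
      (Nat.size w - 1 - l.t % Nat.size w)).toNat with hx
    have hp := (p1.trans p2).trans p3
    have hl' := (hp.target ⟨hl, hok⟩).1
    have hval : 2 * l.val + x = hashedState Sim Q k a b κ i q (t / Nat.size w % 2 ^ d) /
        2 ^ (Nat.size w - 1 - t % Nat.size w) := by
      rw [h7, ← valAt_step hsz, hx, h6]
      rfl
    set val₁ := 2 * l.val + x with hval₁
    set C₁ := l.C + (1 - (l.t + 1) % Nat.size w) *
      (1 - (val₁ - (l.t + 1 - 1) / (2 ^ d * Nat.size w))) * (1 - (1 - (w - l.q))) with hC₁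
    have hdig : κ / (l.pow / 2 ^ k) % 2 ^ k * 2 ^ (d - 2 * k) =
        digit k κ i * 2 ^ (d - 2 * k) := by
      rw [h2, Nat.mul_succ, pow_add, Nat.mul_div_cancel _ (by positivity)]
      rfl
    obtain ⟨e1, e2, e3⟩ := loop_step (f := hashedState Sim Q k a b κ i q)
      (thr := threshold Sim Q k a b κ i q) (w := w) (q := q) (v := v)
      (c₀ := digit k κ i * 2 ^ (d - 2 * k)) (ρ := 2 ^ (d - k)) hsz (D := 2 ^ d) (by positivity)
      (fun y => (hfw y).trans_lt (Nat.lt_size_self w)) (fun r => rfl) t hval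
      (C₁ := C₁) (by rw [hC₁, h8, h6, h4, Nat.add_sub_cancel])
    rw [← h6] at e1 e2 e3
    have hC₁le : C₁ ≤ 2 ^ d + 1 := by
      rw [hC₁, h8]
      refine add_le_add hcount ?_
      calc _ ≤ 1 * 1 * 1 := by gcongr <;> exact Nat.sub_le _ _
        _ = 1 := rfl
    have hpd : 2 ^ d + 1 < N := by
      have h1 : 2 ^ (d + 1) < N := hs.pow_lt (by omega)
      have h2 : 0 < 2 ^ d := by positivity
      rw [pow_succ] at h1
      omega
    have hwN : ∀ {y}, y ≤ w → y < N := fun hy => by have := hs.lt_pow; omega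
    have hmul : ∀ {y z}, y < N → y * (1 - z) < N := fun {y z} hy =>
      lt_of_le_of_lt ((Nat.mul_le_mul_left y (Nat.sub_le 1 z)).trans (mul_one y).le) hy
    have hTN : w * 2 ^ d * Nat.size w < N := by
      refine lt_of_le_of_lt (le_trans ?_ hs.table_le) hs.base_lt
      gcongr
      omega
    have e2' : l.res + (1 - (l.t + 1) % (2 ^ d * Nat.size w)) *
        (1 - ((C₁ + κ / (l.pow / 2 ^ k) % 2 ^ k * 2 ^ (d - 2 * k)) / 2 ^ (d - k) * 2 ^ (d - k) -
          l.v)) = resAt (Nat.size w) (2 ^ d) (threshold Sim Q k a b κ i q) v (l.t + 1) := by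
      rw [h9, hdig, h5, ← e2, h6]
    have p4 : szMachine.Path env (Within N (StackOK w d s u))
        (cfg .answer (mainGl w d s k u a b κ m₀ m i₀ p₀)
          { l with j := x, e := e', cur := cur' } st n')
        (cfg .loop (mainGl w d s k u a b κ m₀ m i₀ p₀)
          { l with
            j := x
            e := e'
            cur := cur'
            t := l.t + 1
            val := valAt (Nat.size w) (2 ^ d) (hashedState Sim Q k a b κ i q) (l.t + 1)
            C := countAt (Nat.size w) (2 ^ d) ((q : ℕ) < w) (hashedState Sim Q k a b κ i q)
              (l.t + 1)
            res := resAt (Nat.size w) (2 ^ d) (threshold Sim Q k a b κ i q) v (l.t + 1) }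
          st n') := by
      have hval₁N : val₁ < N := hwN (by rw [hval]; exact hvalw _ _)
      refine step_goTo rfl (fun r => ?_) hok hl' ⟨hval₁N, ?_, hC₁le.trans_lt hpd, hmul hval₁N, ?_,
        hmul (hC₁le.trans_lt hpd), trivial⟩
      · cases r
        case val => exact e1
        case res => exact e2'
        case C => exact e3
        all_goals rfl
      · change l.t + 1 < N
        omega
      · refine lt_of_eq_of_lt e2' (hwN (resAt_le _ _ ?_))
        omega
    have hp' := hp.trans p4
    obtain ⟨l', n'', p5, r1, r2, r3, r4⟩ := ih (t + 1) (by omega) (l := { l with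
            j := x
            e := e'
            cur := cur'
            t := l.t + 1
            val := valAt (Nat.size w) (2 ^ d) (hashedState Sim Q k a b κ i q) (l.t + 1)
            C := countAt (Nat.size w) (2 ^ d) ((q : ℕ) < w) (hashedState Sim Q k a b κ i q)
              (l.t + 1)
            res := resAt (Nat.size w) (2 ^ d) (threshold Sim Q k a b κ i q) v (l.t + 1) })
      n' h1 h2 h3 h4 h5 (by rw [h6]) (by rw [h6]) (by rw [h6]) (by rw [h6])
      (hp'.target ⟨hl, hok⟩).1
    exact ⟨l', n'', hp'.trans p5, r1, r2, r3, r4⟩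

theorem evalSpec_succ (hs : Sizes w d s k u N) (hi : i < u)
    (hE : EvalSpec Sim Q k u a b κ m₀ m i₀ p₀ N env i) (hσ : IsOracleFor Sim env.oracle) :
    EvalSpec Sim Q k u a b κ m₀ m i₀ p₀ N env (i + 1) := by
  intro l st n q hlvl hpow hS hq hv hl hst hlen
  have hok : StackOK w d s u st := hst.stackOK (by omega)
  have p1 : szMachine.Path env (Within N (StackOK w d s u))
      (cfg .eval (mainGl w d s k u a b κ m₀ m i₀ p₀) l st n)
      (cfg .evalLoop (mainGl w d s k u a b κ m₀ m i₀ p₀) l st n) :=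
    step_branch rfl (fun r => rfl) (if_pos (by change l.lvl ≠ 0; omega)) hok hl trivial
  have h0 : 0 < N := lt_trans zero_lt_one hs.one_lt
  have p2 : szMachine.Path env (Within N (StackOK w d s u))
      (cfg .evalLoop (mainGl w d s k u a b κ m₀ m i₀ p₀) l st n)
      (cfg .loop (mainGl w d s k u a b κ m₀ m i₀ p₀)
        { l with t := 0, val := 0, C := 0, res := 0 } st n) :=
    step_goTo rfl (fun r => by cases r <;> rfl) hok hl ⟨h0, h0, h0, h0, trivial⟩
  have hsz := hs.size_pos
  obtain ⟨l', n', p3, r1, r2, r3, r4⟩ := path_loop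
    (l := { l with t := 0, val := 0, C := 0, res := 0 }) (q := q) hs hi hE hσ hst hlen hv hS
    (w * 2 ^ d * Nat.size w) 0 (zero_add _) n hlvl hpow rfl hq rfl rfl
    (by
      have := (hashedState_le Sim Q k a b κ i q 0).trans_lt (Nat.lt_size_self w)
      simp [valAt, Nat.div_eq_of_lt this])
    (by simp [countAt, countLE])
    (by simp [resAt]) ((p1.trans p2).target ⟨hl, hok⟩).1
  refine ⟨l', n', (p1.trans p2).trans p3, r1, r2, r3, ?_⟩
  rw [r4, level_succ_next hs.two_mul_le hv, resAt, mul_assoc,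
    Nat.mul_div_cancel _ (by positivity)]

theorem evalSpec (hs : Sizes w d s k u N) (hσ : IsOracleFor Sim env.oracle)
    (hin : ∀ j < (w + 1) * 2 ^ d * Nat.size w, env.input[j]? = (encTable Q)[j]?) (hi : i ≤ u) :
    EvalSpec Sim Q k u a b κ m₀ m i₀ p₀ N env i := by
  induction i with
  | zero => exact evalSpec_zero hs hin
  | succ i ih => exact evalSpec_succ hs hi (ih (by omega)) hσ

end

end SZ

namespace SZ

open Finset

/-! ### Initialization -/

/-- The bound for the registers. -/
def regBound (d s u : ℕ) : ℕ := 2 ^ (14 * d * u + 4 * d + 2 * s + 3)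

theorem pow_lt_regBound {d s u c : ℕ} (h : c < 14 * d * u + 4 * d + 2 * s + 3) :
    2 ^ c < regBound d s u :=
  Nat.pow_lt_pow_right (by norm_num) h

theorem regBound_pos (d s u : ℕ) : 0 < regBound d s u := Nat.two_pow_pos _

theorem lt_regBound {d s u c : ℕ} (h : c < 14 * d * u + 4 * d + 2 * s + 3) : c < regBound d s u :=
  Nat.lt_two_pow_self.trans (pow_lt_regBound h)

theorem sizes_regBound {w d s k u : ℕ} (hw : 0 < w) (h : (w + 1) * Nat.size w ≤ 2 ^ d)
    (h' : Nat.size w < d) (hk : 2 * k ≤ d) : Sizes w d s k u (regBound d s u) where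
  pos := hw
  le_pow := h
  size_lt := h'
  two_mul_le := hk
  stack_le := by
    rw [regBound, ← pow_add, ← pow_mul, ← pow_mul]
    exact Nat.pow_le_pow_right (by norm_num) (by nlinarith)
  pow_le := Nat.pow_le_pow_right (by norm_num) (by omega)

/-- The initial contents of the constant registers. -/
def zeroGl : Gl := ⟨0, 0, 0, 0, 0, 0, 0, 0, 0, 0, 0, 0, 0, 0, 0, 0, 0, 0, 0, 0⟩

/-- The constant registers after `j` rounds of computing powers. -/
def powersGl (w d m₀ s m j : ℕ) : Gl where
  w := w
  d := d
  m₀ := m₀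
  s := s
  m := m
  i := j
  p := 0
  sz := min j (Nat.size w)
  D := 2 ^ min j d
  P := 2 ^ min j s
  W := 2 ^ min j (Nat.size w)
  K := 2 ^ min j (d / 8)
  ρ := 0
  η := 0
  B := 0
  T := 0
  u := 0
  a := 0
  b := 0
  κ := 0

/-- The constant registers after `j` rounds of computing the height. -/
def heightGl (w d m₀ s m j : ℕ) : Gl where
  w := w
  d := d
  m₀ := m₀
  s := s
  m := m
  i := s + d
  p := m₀ ^ j
  sz := Nat.size w
  D := 2 ^ d
  P := 2 ^ s
  W := 2 ^ Nat.size w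
  K := 2 ^ (d / 8)
  ρ := 0
  η := 0
  B := 0
  T := 0
  u := j
  a := 0
  b := 0
  κ := 0

/-- The other registers after `j` rounds of computing the height. -/
def heightLo (lvl pow : ℕ) : Lo := ⟨lvl, pow, 0, 0, 0, 0, 0, 0, 0, 0, 0, 0⟩

theorem two_pow_min_mul (i c : ℕ) : 2 ^ min i c * (2 - (1 - (c - i))) = 2 ^ min (i + 1) c := by
  rcases lt_or_ge i c with h | h
  · rw [min_eq_left h.le, min_eq_left (by omega), pow_succ,
      show 2 - (1 - (c - i)) = 2 by omega]
  · rw [min_eq_right h, min_eq_right (by omega), show 2 - (1 - (c - i)) = 1 by omega, mul_one]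

theorem min_size_add (i w : ℕ) :
    min i (Nat.size w) + (1 - (2 ^ min i (Nat.size w) - w)) = min (i + 1) (Nat.size w) := by
  rcases lt_or_ge i (Nat.size w) with h | h
  · have := Nat.lt_size.1 h
    rw [min_eq_left h.le, min_eq_left (by omega)]
    omega
  · have := Nat.lt_size_self w
    rw [min_eq_right h, min_eq_right (by omega)]
    omega

theorem two_pow_min_size_mul (i w : ℕ) :
    2 ^ min i (Nat.size w) * (1 + (1 - (2 ^ min i (Nat.size w) - w))) =
      2 ^ min (i + 1) (Nat.size w) := by
  rw [← min_size_add]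
  rcases Nat.eq_zero_or_pos (1 - (2 ^ min i (Nat.size w) - w)) with h | h
  · rw [h, add_zero, add_zero, mul_one]
  · rw [show 1 - (2 ^ min i (Nat.size w) - w) = 1 by omega, pow_succ]

section

variable {w d s u m₀ m : ℕ} {env : Env} {H : List Frame → Prop} {N : ℕ}

theorem path_params (henv : env.w = w ∧ env.d = d ∧ env.m₀ = m₀ ∧ env.s = s ∧ env.m = m)
    (hε : ¬ 1 ≤ 12 * env.ε) (hH : H []) (hw : w < N) (hd : d < N) (hm₀ : m₀ < N) (hs : s < N)
    (hm : m < N) (hN : 1 < N) :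
    szMachine.Path env (Within N H) szMachine.init
      (cfg .powers (powersGl w d m₀ s m 0) (heightLo 0 0) [] 0) := by
  obtain ⟨rfl, rfl, rfl, rfl, rfl⟩ := henv
  have hpos : 0 < N := by omega
  have h0 : szMachine.init = cfg .start zeroGl
      (heightLo 0 0) [] 0 := by
    simp only [cfg, atBlock]
    change Config.mk _ _ _ _ = Config.mk _ _ _ _
    congr 1
    funext r
    cases r <;> rfl
  rw [h0]
  have p0 : szMachine.Path env (Within N H)
      (cfg .start zeroGl (heightLo 0 0) [] 0)
      (cfg .getW zeroGl (heightLo 0 0) [] 0) := by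
    refine path_testEps (β := Blk.start) (term := szTerm) (body := szBody) (e₁ := 1) (e₂ := 12)
      (l₁ := .trivial) (l₀ := .getW) rfl (length_szBody_le _) rfl (if_neg ?_) hH (fun r => ?_)
      trivial
    · change ¬ (((1 : ℕ) : ℝ) ≤ ((12 : ℕ) : ℝ) * env.ε)
      push_cast
      exact hε
    · cases r <;> exact hpos
  have p1 : szMachine.Path env (Within N H)
      (cfg .getW zeroGl (heightLo 0 0) [] 0)
      (cfg .getD { zeroGl with w := env.w } (heightLo 0 0) [] 0) :=
    step_param rfl rfl (fun r => by cases r <;> rfl) hH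
      (fun r => by cases r <;> exact hpos) hw
  have p2 : szMachine.Path env (Within N H)
      (cfg .getD { zeroGl with w := env.w } (heightLo 0 0) [] 0)
      (cfg .getM₀ { zeroGl with w := env.w, d := env.d }
        (heightLo 0 0) [] 0) :=
    step_param rfl rfl (fun r => by cases r <;> rfl) hH
      (fun r => by cases r <;> assumption) hd
  have p3 : szMachine.Path env (Within N H)
      (cfg .getM₀ { zeroGl with w := env.w, d := env.d }
        (heightLo 0 0) [] 0)
      (cfg .getS { zeroGl with w := env.w, d := env.d, m₀ := env.m₀ }
        (heightLo 0 0) [] 0) :=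
    step_param rfl rfl (fun r => by cases r <;> rfl) hH
      (fun r => by cases r <;> assumption) hm₀
  have p4 : szMachine.Path env (Within N H)
      (cfg .getS { zeroGl with w := env.w, d := env.d, m₀ := env.m₀ }
        (heightLo 0 0) [] 0)
      (cfg .getM { zeroGl with w := env.w, d := env.d, m₀ := env.m₀, s := env.s }
        (heightLo 0 0) [] 0) :=
    step_param rfl rfl (fun r => by cases r <;> rfl) hH
      (fun r => by cases r <;> assumption) hs
  have p5 : szMachine.Path env (Within N H)
      (cfg .getM { zeroGl with w := env.w, d := env.d, m₀ := env.m₀, s := env.s }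
        (heightLo 0 0) [] 0)
      (cfg .ones { zeroGl with w := env.w, d := env.d, m₀ := env.m₀, s := env.s, m := env.m }
        (heightLo 0 0) [] 0) :=
    step_param rfl rfl (fun r => by cases r <;> rfl) hH
      (fun r => by cases r <;> assumption) hm
  have p6 : szMachine.Path env (Within N H)
      (cfg .ones { zeroGl with w := env.w, d := env.d, m₀ := env.m₀, s := env.s, m := env.m }
        (heightLo 0 0) [] 0)
      (cfg .powers (powersGl env.w env.d env.m₀ env.s env.m 0) (heightLo 0 0) [] 0) :=
    step_goTo rfl (fun r => by cases r <;> rfl) hH (fun r => by cases r <;> assumption)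
      ⟨hN, hN, hN, hN, trivial⟩
  exact p0.trans (p1.trans (p2.trans (p3.trans (p4.trans (p5.trans p6)))))

theorem path_powers (hH : H []) (hsd : 2 ^ (s + d) < N) (hsz : Nat.size w < d)
    (c j : ℕ) (hj : j + c = s + d)
    (hl : ∀ r, regs (powersGl w d m₀ s m j) (heightLo 0 0) r < N) :
    szMachine.Path env (Within N H) (cfg .powers (powersGl w d m₀ s m j) (heightLo 0 0) [] 0)
      (cfg .height (powersGl w d m₀ s m (s + d)) (heightLo 0 0) [] 0) := by
  induction c generalizing j with
  | zero =>
    obtain rfl : j = s + d := by omega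
    exact step_branch rfl (fun r => rfl)
      (if_neg (not_not.2 (by change s + d - (s + d) = 0; omega))) hH hl trivial
  | succ c ih =>
    have p1 : szMachine.Path env (Within N H)
        (cfg .powers (powersGl w d m₀ s m j) (heightLo 0 0) [] 0)
        (cfg .powersStep (powersGl w d m₀ s m j) (heightLo 0 0) [] 0) :=
      step_branch rfl (fun r => rfl) (if_pos (by change s + d - j ≠ 0; omega)) hH hl trivial
    have hpow : ∀ c ≤ s + d, 2 ^ min (j + 1) c < N := fun c hc =>
      lt_of_le_of_lt (Nat.pow_le_pow_right (by norm_num) ((min_le_right _ _).trans hc)) hsd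
    have hlin : ∀ c ≤ s + d, c < N := fun c hc =>
      lt_of_le_of_lt hc (Nat.lt_two_pow_self.trans hsd)
    have p2 : szMachine.Path env (Within N H)
        (cfg .powersStep (powersGl w d m₀ s m j) (heightLo 0 0) [] 0)
        (cfg .powers (powersGl w d m₀ s m (j + 1)) (heightLo 0 0) [] 0) := by
      refine step_goTo rfl (fun r => ?_) hH hl ⟨?_, ?_, ?_, ?_, ?_, ?_, trivial⟩
      · cases r
        case D => exact two_pow_min_mul j d
        case K => exact two_pow_min_mul j (d / 8)
        case P => exact two_pow_min_mul j s
        case sz => exact min_size_add j w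
        case W => exact two_pow_min_size_mul j w
        all_goals rfl
      · exact lt_of_eq_of_lt (two_pow_min_mul j d) (hpow _ (by omega))
      · exact lt_of_eq_of_lt (two_pow_min_mul j (d / 8)) (hpow _ (by omega))
      · exact lt_of_eq_of_lt (two_pow_min_mul j s) (hpow _ (by omega))
      · exact lt_of_eq_of_lt (min_size_add j w)
          (hlin _ ((min_le_right _ _).trans (by omega)))
      · exact lt_of_eq_of_lt (two_pow_min_size_mul j w) (hpow _ (by omega))
      · exact hlin (j + 1) (by omega)
    exact (p1.trans p2).trans (ih (j + 1) (by omega) ((p1.trans p2).target ⟨hl, hH⟩).1)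

theorem path_height (hH : H []) (hm : m ≤ m₀ ^ u) (hm' : ∀ j < u, m₀ ^ j < m)
    (hm₀ : m₀ ^ u < N) (hpos : 0 < m₀) (hpow : 2 ^ (d / 8 * u) < N) (hu : u < N) (c j : ℕ)
    (hj : j + c = u)
    (hl : ∀ r, regs (heightGl w d m₀ s m j) (heightLo j (2 ^ (d / 8 * j))) r < N) :
    szMachine.Path env (Within N H)
      (cfg .heightLoop (heightGl w d m₀ s m j) (heightLo j (2 ^ (d / 8 * j))) [] 0)
      (cfg .derived (heightGl w d m₀ s m u) (heightLo u (2 ^ (d / 8 * u))) [] 0) := by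
  induction c generalizing j with
  | zero =>
    obtain rfl : j = u := by omega
    exact step_branch rfl (fun r => rfl)
      (if_neg (not_not.2 (by change m - m₀ ^ j = 0; omega))) hH hl trivial
  | succ c ih =>
    have p1 : szMachine.Path env (Within N H)
        (cfg .heightLoop (heightGl w d m₀ s m j) (heightLo j (2 ^ (d / 8 * j))) [] 0)
        (cfg .heightStep (heightGl w d m₀ s m j) (heightLo j (2 ^ (d / 8 * j))) [] 0) :=
      step_branch rfl (fun r => rfl)
        (if_pos (by have := hm' j (by omega); change m - m₀ ^ j ≠ 0; omega)) hH hl trivial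
    have e1 : 2 ^ (d / 8 * j) * 2 ^ (d / 8) = 2 ^ (d / 8 * (j + 1)) := by
      rw [Nat.mul_succ, pow_add]
    have p2 : szMachine.Path env (Within N H)
        (cfg .heightStep (heightGl w d m₀ s m j) (heightLo j (2 ^ (d / 8 * j))) [] 0)
        (cfg .heightLoop (heightGl w d m₀ s m (j + 1))
          (heightLo (j + 1) (2 ^ (d / 8 * (j + 1)))) [] 0) := by
      refine step_goTo rfl (fun r => ?_) hH hl ⟨?_, ?_, ?_, ?_, trivial⟩
      · cases r <;> first | rfl | exact e1
      · exact lt_of_le_of_lt (Nat.pow_le_pow_right hpos (by omega : j + 1 ≤ u)) hm₀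
      · exact lt_of_eq_of_lt e1 (lt_of_le_of_lt (Nat.pow_le_pow_right (by norm_num)
          (Nat.mul_le_mul_left _ (by omega))) hpow)
      · exact lt_of_le_of_lt (by omega : j + 1 ≤ u) hu
      · exact lt_of_le_of_lt (by omega : j + 1 ≤ u) hu
    exact (p1.trans p2).trans (ih (j + 1) (by omega) ((p1.trans p2).target ⟨hl, hH⟩).1)

end

end SZ

namespace SZ

open Finset

/-! ### The whole computation -/

section

variable {w d s u m₀ m : ℕ} {ε : ℝ} {Sim : SimFun w d s} {σ : ℕ → Strategy}

theorem exists_path_halted (hw : 0 < w) (hwd : (w + 1) * Nat.size w ≤ 2 ^ d)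
    (hsz : Nat.size w < d) (hm₀ : 0 < m₀) (hm₀w : m₀ ≤ w) (hm : m ≤ m₀ ^ u)
    (hm' : ∀ j < u, m₀ ^ j < m) (hε : ¬ 1 ≤ 12 * ε) (hσ : IsOracleFor Sim σ)
    (Q : FailAutomaton w d) (q : Fin (w + 1)) (x : Fin (seedLength d s (d / 8) u) → Bool) :
    ∃ c, szMachine.Path ⟨w, d, m₀, s, m, ε, encInput Q q x, σ⟩
        (Within (regBound d s u) (StackOK w d s u)) szMachine.init c ∧
      c.control = .halted (sza Sim (d / 8) u Q q x) := by
  set env : Env := ⟨w, d, m₀, s, m, ε, encInput Q q x, σ⟩ with henv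
  set N := regBound d s u with hN
  have hs : Sizes w d s (d / 8) u N := sizes_regBound hw hwd hsz (by omega)
  have hH := stackOK_nil w d s u
  have hwN : w < N := hs.lt_pow.trans (hs.pow_lt (by omega))
  have hpN : m₀ ^ u < N := by
    calc m₀ ^ u ≤ (2 ^ d) ^ u := Nat.pow_le_pow_left (hm₀w.trans hs.lt_pow.le) _
      _ = 2 ^ (d * u) := (pow_mul _ _ _).symm
      _ < N := pow_lt_regBound (by nlinarith)
  have hku : (d / 8) * u ≤ d * u := Nat.mul_le_mul_right _ (by omega)
  have hdu : 14 * d * u = 14 * (d * u) := by ring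
  have hu : u ≤ d * u := Nat.le_mul_of_pos_left _ (by omega)
  have p1 := path_params (w := w) (d := d) (s := s) (m₀ := m₀) (m := m) (env := env)
    (N := N) (H := StackOK w d s u)
    ⟨rfl, rfl, rfl, rfl, rfl⟩ hε hH hwN (lt_regBound (by omega)) (hm₀w.trans_lt hwN)
    (lt_regBound (by omega)) (hm.trans_lt hpN) hs.one_lt
  have g0 : Within N (StackOK w d s u) szMachine.init := ⟨fun r => by
    change 0 < N
    have := hs.one_lt
    omega, hH⟩
  have p2 := p1.trans (path_powers hH (pow_lt_regBound (by omega)) hsz (s + d) 0 (zero_add _)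
    (p1.target g0).1)
  have p3 : szMachine.Path env (Within N (StackOK w d s u))
      (cfg .height (powersGl w d m₀ s m (s + d)) (heightLo 0 0) [] 0)
      (cfg .heightLoop (heightGl w d m₀ s m 0) (heightLo 0 (2 ^ (d / 8 * 0))) [] 0) := by
    have h1 : min (s + d) (Nat.size w) = Nat.size w := min_eq_right (by omega)
    have h2 : min (s + d) d = d := min_eq_right (by omega)
    have h3 : min (s + d) s = s := min_eq_right (by omega)
    have h4 : min (s + d) (d / 8) = d / 8 := min_eq_right (by omega)
    refine step_goTo rfl (fun r => ?_) hH (p2.target g0).1 ⟨hs.one_lt, hs.one_lt, trivial⟩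
    cases r <;> first | rfl | exact h1 | exact congrArg (2 ^ ·) h1 | exact congrArg (2 ^ ·) h2 |
      exact congrArg (2 ^ ·) h3 | exact congrArg (2 ^ ·) h4
  have p4 := (p2.trans p3).trans (path_height hH hm hm' hpN hm₀ (pow_lt_regBound (by omega))
    (lt_regBound (by omega)) u 0 (zero_add _) ((p2.trans p3).target g0).1)
  set T := (w + 1) * 2 ^ d * Nat.size w with hT
  have hℓ : seedLength d s (d / 8) u = (d + s) + ((d + s) + (d + u * (d / 8))) := rfl
  have huk : u * (d / 8) = (d / 8) * u := mul_comm _ _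
  have e1 : 2 ^ d / 2 ^ (d / 8) = 2 ^ (d - (d / 8)) := Nat.pow_div (by omega) (by norm_num)
  have e2 : 2 ^ d / 2 ^ (d / 8) / 2 ^ (d / 8) = 2 ^ (d - 2 * (d / 8)) := by
    rw [e1, Nat.pow_div (by omega) (by norm_num)]
    congr 1
    omega
  have hTN : T < N := hs.table_le.trans_lt hs.base_lt
  set X := 2 ^ Nat.size w * Nat.ofBits x + q with hX
  have hqW : (q : ℕ) < 2 ^ Nat.size w :=
    lt_of_le_of_lt (Nat.lt_succ_iff.1 q.2) (Nat.lt_size_self w)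
  have hXlt : X < 2 ^ (Nat.size w + seedLength d s (d / 8) u) := by
    have h1 : Nat.ofBits x < 2 ^ seedLength d s (d / 8) u := Nat.ofBits_lt_two_pow x
    rw [hX, mul_comm, add_comm (Nat.size w), pow_add]
    exact mul_add_lt_mul h1 hqW
  have hXN : X < N := hXlt.trans (pow_lt_regBound (by omega))
  set g : Gl := mainGl w d s (d / 8) u 0 0 0 m₀ m (s + d) (m₀ ^ u) with hg
  set l : Lo := { heightLo u (2 ^ (d / 8 * u)) with
    cur := T, t := Nat.size w + seedLength d s (d / 8) u } with hl
  have p5 : szMachine.Path env (Within N (StackOK w d s u))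
      (cfg .derived (heightGl w d m₀ s m u) (heightLo u (2 ^ (d / 8 * u))) [] 0)
      (cfg (.load true) g l [] 0) := by
    refine step_goTo rfl (fun r => ?_) hH (p4.target g0).1 ⟨hTN, ?_, ?_, hs.base_lt, hTN, ?_, ?_,
      trivial⟩
    · cases r <;> first | rfl | exact e1 | exact e2
    · exact lt_of_eq_of_lt e1 (pow_lt_regBound (by omega))
    · exact lt_of_eq_of_lt e2 (pow_lt_regBound (by omega))
    · change Nat.size w + seedLength d s (d / 8) u < N
      exact lt_regBound (by omega)
    · exact lt_trans zero_lt_one hs.one_lt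
  have p6 := p4.trans p5
  obtain ⟨j, p7⟩ := path_load (env := env) (n := 0) (g := g) hs.one_lt hH true hXN
    (Nat.size w + seedLength d s (d / 8) u) (l := l) rfl
    (by
      intro i hi
      exact getElem?_encInput_add Q q x (bitsFn_ofBits x) hi)
    (Nat.div_eq_of_lt hXlt).symm (p6.target g0).1
  have p8 := p6.trans p7
  set n := Nat.ofBits x
  set a := n % 2 ^ (d + s) with ha
  set b := n / 2 ^ (d + s) % 2 ^ (d + s) with hb
  set v := n / 2 ^ (d + s) / 2 ^ (d + s) % 2 ^ d with hv
  set κ := n / 2 ^ (d + s) / 2 ^ (d + s) / 2 ^ d with hκ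
  have hDP : 2 ^ d * 2 ^ s = 2 ^ (d + s) := (pow_add _ _ _).symm
  have f1 : X % 2 ^ Nat.size w = q := by
    rw [hX, mul_comm, mul_add_mod_of_lt' hqW]
  have f2 : X / 2 ^ Nat.size w = n := by
    rw [hX, mul_comm, mul_add_div_of_lt' hqW]
  have p9 : szMachine.Path env (Within N (StackOK w d s u))
      (cfg .unpack g { l with t := 0, res := X, j := j } [] 0)
      (cfg .eval (mainGl w d s (d / 8) u a b κ m₀ m (s + d) (m₀ ^ u))
        { l with t := 0, res := X, j := j, q := q, v := v, cur := n / 2 ^ (d + s) / 2 ^ (d + s) }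
        [] 0) := by
    have hdiv : ∀ {y z : ℕ}, y < N → y / z < N := fun h => (Nat.div_le_self _ _).trans_lt h
    have hmod : ∀ {y z : ℕ}, y < N → y % z < N := fun h => (Nat.mod_le _ _).trans_lt h
    refine step_goTo rfl (fun r => ?_) hH (p8.target g0).1 ⟨hmod hXN, hdiv hXN, hmod (hdiv hXN),
      hdiv (hdiv hXN), hmod (hdiv (hdiv hXN)), hdiv (hdiv (hdiv hXN)),
      hmod (hdiv (hdiv (hdiv hXN))), hdiv (hdiv (hdiv (hdiv hXN))), trivial⟩
    cases r
    case q => exact f1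
    case a =>
      change X / 2 ^ Nat.size w % (2 ^ d * 2 ^ s) = _
      rw [f2, hDP]
      rfl
    case b =>
      change X / 2 ^ Nat.size w / (2 ^ d * 2 ^ s) % (2 ^ d * 2 ^ s) = _
      rw [f2, hDP]
      rfl
    case cur =>
      change X / 2 ^ Nat.size w / (2 ^ d * 2 ^ s) / (2 ^ d * 2 ^ s) = _
      rw [f2, hDP]
      rfl
    case v =>
      change X / 2 ^ Nat.size w / (2 ^ d * 2 ^ s) / (2 ^ d * 2 ^ s) % 2 ^ d = _
      rw [f2, hDP]
      rfl
    case κ =>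
      change X / 2 ^ Nat.size w / (2 ^ d * 2 ^ s) / (2 ^ d * 2 ^ s) / 2 ^ d = _
      rw [f2, hDP]
      rfl
    all_goals rfl
  have p10 := p8.trans p9
  have hvlt : v < 2 ^ d := Nat.mod_lt _ (by positivity)
  obtain ⟨l', n', p11, r1, r2, r3, r4⟩ := evalSpec (Sim := Sim) (Q := Q) (a := a) (b := b)
    (κ := κ) (m₀ := m₀) (m := m) (i₀ := s + d) (p₀ := m₀ ^ u) (env := env) hs hσ
    (fun j hj => getElem?_encInput_of_lt Q q x hj) le_rfl
    { l with t := 0, res := X, j := j, q := q, v := v, cur := n / 2 ^ (d + s) / 2 ^ (d + s) }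
    [] 0 q rfl rfl (by change 0 < _; positivity) rfl hvlt (p10.target g0).1
    (fun f hf => by cases hf) (by simp)
  have p12 := p10.trans p11
  have p13 : szMachine.Path env (Within N (StackOK w d s u))
      (cfg .ret (mainGl w d s (d / 8) u a b κ m₀ m (s + d) (m₀ ^ u)) l' [] n')
      (cfg .finish (mainGl w d s (d / 8) u a b κ m₀ m (s + d) (m₀ ^ u)) l' [] n') :=
    step_branch rfl (fun r => rfl) (if_neg (not_not.2 (by change u - l'.lvl = 0; omega))) hH
      (p12.target g0).1 trivial
  have p14 := p12.trans p13
  refine ⟨_, p14.trans (path_halt (β := Blk.finish) (term := szTerm) (body := szBody) (r := .res)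
    rfl (length_szBody_le _) rfl hH (p14.target g0).1 trivial), ?_⟩
  change Control.halted l'.res = _
  rw [r4]
  rfl

theorem space_le_of_within {c : Config szMachine.R szMachine.Λ} {H : List Frame → Prop}
    (h : Within (2 ^ m) H c) : c.space ≤ Fintype.card Rg * m := by
  unfold Config.space
  calc ∑ r, Nat.size (c.regs r) ≤ ∑ _r : Rg, m := sum_le_sum fun r _ => Nat.size_le.2 (h.1 r)
    _ = Fintype.card Rg * m := by simp

/-- The computation when the error bound is trivial. -/
theorem path_trivial {env : Env} (hε : 1 ≤ 12 * env.ε) {H : List Frame → Prop} (hH : H []) :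
    szMachine.Path env (Within (2 ^ 0) H) szMachine.init
      ⟨.halted 0, fun _ => 0, [], 0⟩ := by
  have p1 : szMachine.Path env (Within (2 ^ 0) H) szMachine.init
      (atBlock 17 .trivial (fun _ => 0) [] 0) := by
    refine path_testEps (β := Blk.start) (term := szTerm) (body := szBody) (e₁ := 1) (e₂ := 12)
      (l₁ := .trivial) (l₀ := .getW) rfl (length_szBody_le _) rfl (if_pos ?_) hH
      (fun r => zero_lt_one) trivial
    change ((1 : ℕ) : ℝ) ≤ ((12 : ℕ) : ℝ) * env.ε
    push_cast
    exact hε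
  exact p1.trans (path_halt (β := Blk.trivial) (term := szTerm) (body := szBody) (r := .res)
    rfl (length_szBody_le _) rfl hH (fun r => zero_lt_one) trivial)

end

end SZ

namespace SZ

open Finset

/-! ### Lower bounds for the seed length -/

/-- The automaton which moves from a state other than the fail state to a state that depends only
on the number it reads. -/
def resetAutomaton {w d : ℕ} (g : ℕ → Fin w) : FailAutomaton w d where
  next q z := if q = Fin.last w then Fin.last w else (g (Nat.ofBits z)).castSucc
  next_last _ := if_pos rfl

theorem stepAvg_resetAutomaton {w d : ℕ} (g : ℕ → Fin w) (f : Fin (w + 1) → ℝ) (n : ℕ)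
    {q : Fin (w + 1)} (hq : q ≠ Fin.last w) :
    (resetAutomaton (d := d) g).stepAvg^[n + 1] f q = avg (2 ^ d) fun v => f (g v).castSucc := by
  induction n generalizing q with
  | zero =>
    refine avg_congr fun v hv => ?_
    simp only [resetAutomaton, if_neg hq, ofBits_bitsFn hv]
  | succ n ih =>
    rw [Function.iterate_succ_apply', FailAutomaton.stepAvg]
    rw [← avg_const (N := 2 ^ d) (by positivity) (avg (2 ^ d) fun v => f (g v).castSucc)]
    refine avg_congr fun v _ => ih ?_
    simp only [resetAutomaton, if_neg hq]
    exact (Fin.castSucc_lt_last _).ne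

section

variable {w d s m₀ : ℕ} {ε : ℝ} {Sim : SimFun w d s}

theorem IsSimulator.abs_avg_sub_avg_le (h : IsSimulator m₀ ε Sim) (hm₀ : 0 < m₀) (g : ℕ → Fin w)
    {f : Fin (w + 1) → ℝ} (hf : ∀ r, 0 ≤ f r ∧ f r ≤ 1) {q : Fin (w + 1)} (hq : q ≠ Fin.last w) :
    |avg (2 ^ s) (fun x => f (Sim (resetAutomaton g) q (bitsFn s x))) -
      avg (2 ^ d) (fun v => f (g v).castSucc)| ≤ ε := by
  obtain ⟨n, rfl⟩ := Nat.exists_eq_succ_of_ne_zero hm₀.ne'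
  rw [← stepAvg_resetAutomaton g f n hq]
  exact h.abs_sub_le _ hf q

theorem card_filter_mod_mem_le (M : ℕ) {w : ℕ} (S : Finset ℕ) :
    ((range M).filter fun v => v % w ∈ S).card ≤ S.card * (M / w + 1) := by
  rw [← card_range (M / w + 1), ← card_product]
  refine card_le_card_of_injOn (fun v => (v % w, v / w)) ?_ ?_
  · intro v hv
    simp only [coe_filter, mem_range, Set.mem_ofPred_eq] at hv
    simp only [coe_product, Set.mem_prod, mem_coe, mem_range]
    exact ⟨hv.2, Nat.lt_succ_of_le (Nat.div_le_div_right hv.1.le)⟩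
  · intro v _ v' _ h
    simp only [Prod.mk.injEq] at h
    rw [← Nat.mod_add_div v w, ← Nat.mod_add_div v' w, h.1, h.2]

theorem IsSimulator.width_le (h : IsSimulator m₀ ε Sim) (hm₀ : 0 < m₀) (hw : 0 < w)
    (hwd : w ≤ 2 ^ d) (hε : ε ≤ 1 / 12) : (w : ℝ) ≤ 3 * 2 ^ s := by
  classical
  set g : ℕ → Fin w := fun v => ⟨v % w, Nat.mod_lt _ hw⟩ with hg
  have h0 : (0 : Fin (w + 1)) ≠ Fin.last w := fun h => hw.ne (congrArg Fin.val h)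
  set S : Finset ℕ := (range (2 ^ s)).image fun x =>
    (Sim (resetAutomaton g) 0 (bitsFn s x) : ℕ) with hS
  have h1 := h.abs_avg_sub_avg_le hm₀ g (f := fun r => if (r : ℕ) ∈ S then 1 else 0)
    (fun r => by split_ifs <;> norm_num) h0
  have h2 : avg (2 ^ s) (fun x => if (Sim (resetAutomaton g) 0 (bitsFn s x) : ℕ) ∈ S then (1 : ℝ)
      else 0) = 1 := by
    refine (avg_congr fun x hx => if_pos ?_).trans (avg_const (by positivity) 1)
    exact mem_image_of_mem (fun x => (Sim (resetAutomaton g) 0 (bitsFn s x) : ℕ)) (mem_range.2 hx)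
  have h3 : avg (2 ^ d) (fun v => if (((g v).castSucc : Fin (w + 1)) : ℕ) ∈ S then (1 : ℝ) else 0) =
      ((range (2 ^ d)).filter fun v => v % w ∈ S).card / (2 ^ d : ℕ) := by
    simp [avg, hg]
  rw [h2, h3] at h1
  have h4 : (((range (2 ^ d)).filter fun v => v % w ∈ S).card : ℝ) ≤ 2 ^ s * (2 ^ d / w + 1) := by
    refine (Nat.cast_le.2 (card_filter_mod_mem_le (2 ^ d) S)).trans ?_
    push_cast
    have hS' : (S.card : ℝ) ≤ 2 ^ s := by
      exact_mod_cast card_image_le.trans (card_range _).le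
    have hd : ((2 ^ d / w : ℕ) : ℝ) ≤ 2 ^ d / w := by
      exact_mod_cast Nat.cast_div_le (α := ℝ) (m := 2 ^ d) (n := w)
    gcongr
  have hw' : (0 : ℝ) < w := by exact_mod_cast hw
  have hwd' : (w : ℝ) ≤ 2 ^ d := by exact_mod_cast hwd
  have hd : (0 : ℝ) < 2 ^ d := by positivity
  have h5 : (11 / 12 : ℝ) * 2 ^ d ≤ 2 ^ s * (2 ^ d / w + 1) := by
    have := (abs_le.1 h1).2
    push_cast at this
    have h6 : (11 / 12 : ℝ) ≤
        ((range (2 ^ d)).filter fun v => v % w ∈ S).card / 2 ^ d := by linarith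
    rw [le_div_iff₀ hd] at h6
    exact h6.trans h4
  have h6 : (11 / 12 : ℝ) * 2 ^ d * w ≤ 2 ^ s * (2 ^ d + w) := by
    calc _ ≤ (2 ^ s * (2 ^ d / w + 1)) * (w : ℝ) := by gcongr
      _ = 2 ^ s * (2 ^ d + w) := by field_simp
  have h7 : (2 : ℝ) ^ d * (11 / 12 * w) ≤ 2 ^ d * (2 * 2 ^ s) := by
    have : (2 : ℝ) ^ s * (2 ^ d + w) ≤ 2 ^ s * (2 ^ d + 2 ^ d) := by gcongr
    linarith
  have h8 := le_of_mul_le_mul_left h7 hd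
  have : (0 : ℝ) < 2 ^ s := by positivity
  linarith

theorem IsSimulator.one_le_mul (h : IsSimulator m₀ ε Sim) (hm₀ : 0 < m₀) (hw : 2 ≤ w) (hε : 0 < ε)
    (hε' : 2 * ε ≤ 1) (hd : 1 ≤ ε * 2 ^ d) : 1 ≤ 3 * 2 ^ s * ε := by
  classical
  set t := ⌊ε * 2 ^ d⌋₊ + 1 with ht
  have hpos : (0 : ℝ) < 2 ^ d := by positivity
  have ht1 : ε * 2 ^ d < t := by rw [ht]; push_cast; exact Nat.lt_floor_add_one _
  have ht2 : (t : ℝ) ≤ 2 * ε * 2 ^ d := by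
    have := Nat.floor_le (a := ε * 2 ^ d) (by positivity)
    rw [ht]; push_cast; linarith
  have ht3 : t ≤ 2 ^ d := by
    have : (t : ℝ) ≤ 2 ^ d := ht2.trans (by nlinarith)
    exact_mod_cast this
  set g : ℕ → Fin w := fun v => if v < t then ⟨1, by omega⟩ else ⟨0, by omega⟩ with hg
  have h0 : (0 : Fin (w + 1)) ≠ Fin.last w := fun h => by
    have := congrArg Fin.val h
    simp at this
    omega
  have h1 := h.abs_avg_sub_avg_le hm₀ g (f := fun r => if (r : ℕ) = 1 then 1 else 0)
    (fun r => by split_ifs <;> norm_num) h0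
  have h2 : avg (2 ^ d) (fun v => if (((g v).castSucc : Fin (w + 1)) : ℕ) = 1 then (1 : ℝ) else 0) =
      t / 2 ^ d := by
    have h3 := avg_lt_indicator (2 ^ d) t
    rw [Nat.cast_pow, Nat.cast_ofNat, min_eq_left (by exact_mod_cast ht3)] at h3
    rw [← h3]
    refine avg_congr fun v _ => ?_
    simp only [hg]
    by_cases hv : v < t <;> simp [hv]
  rw [h2] at h1
  set n := ((range (2 ^ s)).filter fun x =>
    (Sim (resetAutomaton g) 0 (bitsFn s x) : ℕ) = 1).card with hn
  have h3 : avg (2 ^ s) (fun x => if (Sim (resetAutomaton g) 0 (bitsFn s x) : ℕ) = 1 then (1 : ℝ)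
      else 0) = n / 2 ^ s := by
    simp [avg, hn]
  rw [h3] at h1
  have ht1' : ε < t / 2 ^ d := by rwa [lt_div_iff₀ hpos]
  have ht2' : t / 2 ^ d ≤ 2 * ε := by rwa [div_le_iff₀ hpos]
  have hspos : (0 : ℝ) < 2 ^ s := by positivity
  have h4 := abs_le.1 h1
  have h5 : (0 : ℝ) < n / 2 ^ s := by linarith
  have h6 : 1 ≤ n := by
    rcases Nat.eq_zero_or_pos n with h | h
    · rw [h] at h5; simp at h5
    · exact h
  have h7 : (n : ℝ) / 2 ^ s ≤ 3 * ε := by linarith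
  rw [div_le_iff₀ hspos] at h7
  have h8 : (1 : ℝ) ≤ n := by exact_mod_cast h6
  linarith

theorem IsSimulator.logb_le (h : IsSimulator m₀ ε Sim) (hm₀ : 0 < m₀) (hw : 2 ≤ w) (hε : 0 < ε)
    (hε' : 12 * ε < 1) (hd : (w : ℝ) / ε ≤ 2 ^ d) : Real.logb 2 (w / ε) ≤ 4 * s := by
  have hw' : (2 : ℝ) ≤ w := by exact_mod_cast hw
  have hd' : (w : ℝ) ≤ ε * 2 ^ d := by rw [div_le_iff₀ hε] at hd; linarith
  have hpos : (0 : ℝ) < 2 ^ d := by positivity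
  have h1 := h.width_le hm₀ (by omega)
    (by
      have : (w : ℝ) ≤ 2 ^ d := by nlinarith
      exact_mod_cast this) (by linarith)
  have h2 := h.one_le_mul hm₀ hw hε (by linarith) (by linarith)
  have hs : (4 : ℝ) ≤ 2 ^ s := by
    have : (0 : ℝ) < 2 ^ s := by positivity
    nlinarith
  have h3 : (w : ℝ) / ε ≤ 2 ^ (4 * s) := by
    rw [div_le_iff₀ hε]
    have e1 : (2 : ℝ) ^ (4 * s) = (2 ^ s) ^ 4 := by rw [← pow_mul, mul_comm]
    rw [e1]
    set y := (2 : ℝ) ^ s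
    have h4 : (w : ℝ) ≤ 3 * y * (3 * y * ε) := h1.trans (le_mul_of_one_le_right (by positivity) h2)
    have h5 : 9 ≤ y ^ 2 := by nlinarith
    calc (w : ℝ) ≤ 9 * (y ^ 2 * ε) := by linarith
      _ ≤ y ^ 2 * (y ^ 2 * ε) := by gcongr
      _ = y ^ 4 * ε := by ring
  have hpos' : (0 : ℝ) < w / ε := by positivity
  calc Real.logb 2 (w / ε) ≤ Real.logb 2 (2 ^ (4 * s)) :=
        Real.logb_le_logb_of_le (by norm_num) hpos' h3
    _ = 4 * s := by rw [Real.logb_pow]; simp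

end

/-! ### The parameters -/

section

variable {w d m₀ m u : ℕ} {ε : ℝ}

theorem pow_facts_of_ceil_logb (hm₀ : 2 ≤ m₀) (hm : 1 ≤ m)
    (hu : u = ⌈Real.logb 2 (m : ℝ) / Real.logb 2 (m₀ : ℝ)⌉₊) :
    m ≤ m₀ ^ u ∧ ∀ i < u, m₀ ^ i < m := by
  have hm₀' : (1 : ℝ) < m₀ := by exact_mod_cast hm₀
  have hm' : (0 : ℝ) < m := by exact_mod_cast hm
  have hlog : 0 < Real.logb 2 (m₀ : ℝ) := Real.logb_pos (by norm_num) hm₀'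
  constructor
  · have h1 : Real.logb 2 (m : ℝ) / Real.logb 2 (m₀ : ℝ) ≤ u := by rw [hu]; exact Nat.le_ceil _
    rw [div_le_iff₀ hlog, ← Real.logb_pow,
      Real.logb_le_logb (by norm_num) hm' (by positivity)] at h1
    exact_mod_cast h1
  · intro i hi
    rw [hu, Nat.lt_ceil, lt_div_iff₀ hlog, ← Real.logb_pow,
      Real.logb_lt_logb_iff (by norm_num) (by positivity) hm'] at hi
    exact_mod_cast hi

theorem geom_sum_le_two_mul (hm₀ : 2 ≤ m₀) (n : ℕ) :
    ∑ j ∈ range (n + 1), m₀ ^ j ≤ 2 * m₀ ^ n := by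
  induction n with
  | zero => simp
  | succ n ih =>
    rw [sum_range_succ, pow_succ]
    nlinarith [Nat.mul_le_mul_left (m₀ ^ n) hm₀]

theorem geom_sum_le_of_pow_lt (hm₀ : 2 ≤ m₀) (h : ∀ i < u, m₀ ^ i < m) :
    ∑ j ∈ range u, m₀ ^ j ≤ 2 * m := by
  cases u with
  | zero => simp
  | succ n =>
    have := h n (by omega)
    exact (geom_sum_le_two_mul hm₀ n).trans (by omega)

theorem le_of_pow_lt (hm₀ : 2 ≤ m₀) (h : ∀ i < u, m₀ ^ i < m) : u ≤ m := by
  cases u with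
  | zero => exact Nat.zero_le _
  | succ n => exact Nat.succ_le_of_lt ((Nat.lt_pow_self (by omega)).trans (h n (by omega)))

/-- Estimates for the number of bits `d` of a block. -/
theorem block_facts (hw : 2 ≤ w) (hε : 0 < ε) (hε' : 12 * ε < 1)
    (hd : d = ⌈((24 : ℕ) : ℝ) * Real.logb 2 ((w : ℝ) / ε)⌉₊) :
    ((w : ℝ) / ε) ^ 2 ≤ 2 ^ (d / 8) ∧ (d : ℝ) ≤ 25 * Real.logb 2 ((w : ℝ) / ε) := by
  have hw' : (2 : ℝ) ≤ w := by exact_mod_cast hw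
  have hR : (2 : ℝ) ≤ w / ε := by rw [le_div_iff₀ hε]; nlinarith
  set L := Real.logb 2 ((w : ℝ) / ε) with hL
  have hL1 : 1 ≤ L := by
    rw [hL, Real.le_logb_iff_rpow_le (by norm_num) (by positivity), Real.rpow_one]
    exact hR
  push_cast at hd
  constructor
  · have h1 : 24 * L ≤ d := by rw [hd]; exact Nat.le_ceil _
    have h2 : (d : ℝ) ≤ 8 * (d / 8 : ℕ) + 7 := by
      have : d ≤ 8 * (d / 8) + 7 := by omega
      exact_mod_cast this
    have h3 : Real.logb 2 (((w : ℝ) / ε) ^ 2) ≤ Real.logb 2 (2 ^ (d / 8)) := by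
      rw [Real.logb_pow, Real.logb_pow, Real.logb_self_eq_one (by norm_num), ← hL]
      push_cast
      linarith
    rwa [Real.logb_le_logb (by norm_num) (by positivity) (by positivity)] at h3
  · have := (Nat.ceil_lt_add_one (a := 24 * L) (by linarith)).le
    rw [← hd] at this
    linarith

theorem sizes_of_le_pow (hw : 2 ≤ w) (hε : 0 < ε) (hε' : 12 * ε < 1)
    (hd : ((w : ℝ) / ε) ^ 2 ≤ 2 ^ (d / 8)) :
    (w + 1) * Nat.size w ≤ 2 ^ d ∧ Nat.size w < d := by
  have hw' : (2 : ℝ) ≤ w := by exact_mod_cast hw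
  have hR : (12 : ℝ) * w ≤ w / ε := by rw [le_div_iff₀ hε]; nlinarith
  have h1 : (12 * w) ^ 2 ≤ 2 ^ (d / 8) := by
    have : ((12 : ℝ) * w) ^ 2 ≤ 2 ^ (d / 8) := le_trans (by gcongr) hd
    exact_mod_cast this
  have h2 : 2 ^ (d / 8) ≤ 2 ^ d := Nat.pow_le_pow_right (by norm_num) (by omega)
  have h3 : Nat.size w ≤ w := Nat.size_le.2 Nat.lt_two_pow_self
  refine ⟨?_, ?_⟩
  · nlinarith [Nat.mul_le_mul_left (w + 1) h3]
  · have hd0 : d ≠ 0 := by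
      rintro rfl
      norm_num at h1
      nlinarith
    obtain ⟨e, rfl⟩ := Nat.exists_eq_succ_of_ne_zero hd0
    refine Nat.lt_succ_of_le (Nat.size_le.2 ?_)
    rw [Nat.succ_eq_add_one, pow_succ] at h2
    nlinarith

theorem error_le (hw : 2 ≤ w) (hε : 0 < ε) (hε' : 12 * ε < 1) {k : ℕ}
    (hk : ((w : ℝ) / ε) ^ 2 ≤ 2 ^ k) {n : ℕ} (hn : n ≤ 2 * m) (hu : u ≤ m) :
    (n : ℝ) * (ε + (w + 1) * (2 * (1 / 2 ^ k))) + u * (w + 1) * w * (5 / 2 ^ k) ≤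
      12 * m * ε := by
  have hw' : (2 : ℝ) ≤ w := by exact_mod_cast hw
  have hn' : (n : ℝ) ≤ 2 * m := by exact_mod_cast hn
  have hu' : (u : ℝ) ≤ m := by exact_mod_cast hu
  have hK : 1 / (2 : ℝ) ^ k ≤ (ε / w) ^ 2 := by
    rw [div_le_iff₀ (by positivity)]
    calc (1 : ℝ) = (ε / w) ^ 2 * ((w : ℝ) / ε) ^ 2 := by field_simp
      _ ≤ (ε / w) ^ 2 * 2 ^ k := by gcongr
  have h1 : (w + 1 : ℝ) * (2 * (1 / 2 ^ k)) ≤ ε := by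
    calc (w + 1 : ℝ) * (2 * (1 / 2 ^ k)) ≤ (w + w) * (2 * (ε / w) ^ 2) := by gcongr; linarith
      _ = 4 * ε / w * ε := by field_simp; ring
      _ ≤ 1 * ε := by
        gcongr
        rw [div_le_one (by positivity)]
        linarith
      _ = ε := one_mul ε
  have h2 : (w + 1 : ℝ) * w * (5 / 2 ^ k) ≤ ε := by
    calc (w + 1 : ℝ) * w * (5 / 2 ^ k) = (w + 1 : ℝ) * w * (5 * (1 / 2 ^ k)) := by ring
      _ ≤ (w + w) * w * (5 * (ε / w) ^ 2) := by gcongr; linarith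
      _ = 10 * ε * ε := by field_simp; ring
      _ ≤ 1 * ε := by gcongr; linarith
      _ = ε := one_mul ε
  have h3 : (n : ℝ) * (ε + (w + 1) * (2 * (1 / 2 ^ k))) ≤ 2 * m * (ε + ε) := by gcongr
  have h4 : (u : ℝ) * (w + 1) * w * (5 / 2 ^ k) ≤ m * ε := by
    calc (u : ℝ) * (w + 1) * w * (5 / 2 ^ k) = u * ((w + 1) * w * (5 / 2 ^ k)) := by ring
      _ ≤ m * ε := by gcongr
  have h5 : 0 ≤ m * ε := by positivity
  linarith

end

theorem step_halted (M : Machine) (env : Env) {c : Config M.R M.Λ} {out : ℕ}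
    (h : c.control = .halted out) : M.step env c = none := by
  simp [Machine.step, h]

end SZ

theorem theorem2 :
    ∃ (c C : ℕ) (SZA : SZ.Machine), 0 < c ∧
      ∀ (w m₀ s m d u : ℕ) (ε : ℝ), 0 < ε → ε ≤ w → s ≤ m₀ → 2 ≤ m₀ → m₀ ≤ w → 1 ≤ m →
        d = ⌈(c : ℝ) * Real.logb 2 ((w : ℝ) / ε)⌉₊ →
        u = ⌈Real.logb 2 (m : ℝ) / Real.logb 2 (m₀ : ℝ)⌉₊ →
        ∃ ℓ : ℕ, (ℓ : ℝ) ≤ C * (s + u * Real.logb 2 ((w : ℝ) / ε)) ∧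
          ∀ Sim : SZ.SimFun w d s, SZ.IsSimulator m₀ ε Sim →
            ∃ F : SZ.SimFun w d ℓ,
              (∃ m' : ℕ, m ≤ m' ∧ SZ.IsSimulator m' (12 * m * ε) F) ∧
              ∀ σ : ℕ → SZ.Strategy, SZ.IsOracleFor Sim σ →
                ∀ (Q : SZ.FailAutomaton w d) (q : Fin (w + 1)) (x : Fin ℓ → Bool),
                  let env : SZ.Env := ⟨w, d, m₀, s, m, ε, SZ.encInput Q q x, σ⟩
                  SZA.Outputs env (F Q q x) ∧
                  ∀ cfg, SZA.Reaches env cfg →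
                    cfg.numInvocations ≤ u ∧
                    cfg.numSeedReads w d s ≤ 1 ∧
                    (cfg.space : ℝ) ≤ C * (s + u * Real.logb 2 ((w : ℝ) / ε) + 1) := by
  refine ⟨24, 12864, SZ.szMachine, by norm_num, ?_⟩
  intro w m₀ s m d u ε hε hεw hsm hm₀ hm₀w hm hd hu
  have hw : 2 ≤ w := hm₀.trans hm₀w
  set L := Real.logb 2 ((w : ℝ) / ε) with hL
  have hL0 : 0 ≤ L := Real.logb_nonneg (by norm_num) (by rw [le_div_iff₀ hε]; linarith)
  by_cases hε' : 1 ≤ 12 * ε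
  · refine ⟨0, by push_cast; positivity, fun Sim _ => ⟨fun _ _ _ => 0, ⟨m, le_rfl, fun Q q => ?_⟩,
      ?_⟩⟩
    · have : (1 : ℝ) ≤ m := by exact_mod_cast hm
      exact SZ.TVClose.of_one_le _ _ (by nlinarith)
    · intro σ _ Q q x env
      have hH := SZ.stackOK_nil w d s u
      have p := SZ.path_trivial (env := env) hε' hH
      refine ⟨⟨_, p.reaches, rfl⟩, fun cfg hcfg => ?_⟩
      have hG := p.invariant ⟨fun r => zero_lt_one, hH⟩ (SZ.step_halted _ _ rfl) hcfg
      refine ⟨hG.2.1, hG.2.2, ?_⟩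
      have h1 : cfg.space ≤ 0 := SZ.space_le_of_within hG
      have h2 : (cfg.space : ℝ) ≤ 0 := by exact_mod_cast h1
      exact h2.trans (by positivity)
  · by_cases hex : ∃ Sim : SZ.SimFun w d s, SZ.IsSimulator m₀ ε Sim
    swap
    · exact ⟨0, by push_cast; positivity, fun Sim hSim => absurd ⟨Sim, hSim⟩ hex⟩
    have hε'' : 12 * ε < 1 := not_le.1 hε'
    obtain ⟨hk, hdL⟩ := SZ.block_facts hw hε hε'' hd
    obtain ⟨hwd, hsz⟩ := SZ.sizes_of_le_pow hw hε hε'' hk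
    obtain ⟨hmu, hmu'⟩ := SZ.pow_facts_of_ceil_logb hm₀ hm hu
    have hR : (1 : ℝ) ≤ w / ε := by rw [le_div_iff₀ hε]; linarith
    have hRd : (w : ℝ) / ε ≤ 2 ^ d := by
      calc (w : ℝ) / ε ≤ (w / ε) ^ 2 := by nlinarith
        _ ≤ 2 ^ (d / 8) := hk
        _ ≤ 2 ^ d := pow_le_pow_right₀ (by norm_num) (by omega)
    have hLs : L ≤ 4 * s := by
      obtain ⟨Sim, hSim⟩ := hex
      exact hSim.logb_le (by omega) hw hε hε'' hRd
    have huL : 0 ≤ u * L := by positivity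
    have hdu : (d : ℝ) * u ≤ 25 * (u * L) := by
      calc (d : ℝ) * u ≤ 25 * L * u := by gcongr
        _ = 25 * (u * L) := by ring
    have hs0 : (0 : ℝ) ≤ s := by positivity
    refine ⟨SZ.seedLength d s (d / 8) u, ?_, fun Sim hSim => ⟨SZ.sza Sim (d / 8) u, ⟨m₀ ^ u, hmu,
      SZ.isSimulator_sza hSim hε.le (by omega) (SZ.error_le hw hε hε'' hk
        (SZ.geom_sum_le_of_pow_lt hm₀ hmu') (SZ.le_of_pow_lt hm₀ hmu'))⟩, ?_⟩⟩
    · have h1 : ((d / 8 : ℕ) : ℝ) ≤ d := by exact_mod_cast Nat.div_le_self d 8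
      have h2 : (u : ℝ) * (d / 8 : ℕ) ≤ d * u := by
        rw [mul_comm]
        gcongr
      rw [SZ.seedLength]
      push_cast at *
      linarith
    · intro σ hσ Q q x env
      obtain ⟨c, p, hc⟩ := SZ.exists_path_halted (by omega) hwd hsz (by omega) hm₀w hmu hmu' hε'
        hσ Q q x
      have hH := SZ.stackOK_nil w d s u
      refine ⟨⟨c, p.reaches, hc⟩, fun cfg hcfg => ?_⟩
      have hG := p.invariant ⟨fun r => SZ.regBound_pos d s u, hH⟩
        (SZ.step_halted _ _ hc) hcfg
      refine ⟨hG.2.1, hG.2.2, ?_⟩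
      have h1 : cfg.space ≤ 32 * (14 * d * u + 4 * d + 2 * s + 3) := SZ.space_le_of_within hG
      have h2 : (cfg.space : ℝ) ≤ 32 * (14 * d * u + 4 * d + 2 * s + 3) := by exact_mod_cast h1
      push_cast
      linarith
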